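/- Let $\mathbb G$ be a Carnot group of step two: a simply connected Lie group whose Lie algebra is $\mathfrak g=V_1\oplus V_2$ with $[V_1,V_1]=V_2\neq 0$ and $[V_1,V_2]=0$. In exponential coordinates, $\mathbb G=\exp\mathfrak g$ with $\exp\xi\exp\eta=\exp(\xi+\eta+\tfrac12[\xi,\eta])$. Fix an inner product on $\mathfrak g$ with $V_1\perp V_2$, give $\mathbb G$ the corresponding left-invariant Riemannian metric, let $dg$ be the Haar measure that is the image under $\exp$ of Lebesgue measure on $\mathfrak g$, and let $X_1,\dots,X_m$ be the left-invariant vector fields given by an orthonormal basis of $V_1$. Write $\Delta_H u=\sum_i X_i^2u$, $|\nabla_H u|^2=\sum_i (X_iu)^2$ and $\|\nabla_H^2u\|^2=\sum_{i,j}\big(\tfrac12(X_iX_ju+X_jX_iu)\big)^2$. Let $\Omega\subset\mathbb G$ be a bounded open set of class $C^2$, with Riemannian outer unit normal $\nu$ and Riemannian surface measure $\sigma$ on $\partial\Omega$. Let $N^H=\sum_j\langle\nu,X_j\rangle X_j$, let $d\sigma_H=|N^H|\,d\sigma$ be the $H$-perimeter measure, and let $\Sigma=\{g\in\partial\Omega: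 N^H(g)=0\}$ be the characteristic set. On $\partial\Omega\setminus\Sigma$ the horizontal mean curvature is $\mathcal H=\sum_{i=1}^{m-1}\langle\nabla^H_{e_i}e_i,\,N^H/|N^H|\rangle$, where $e_1,\dots,e_{m-1}$ is a local orthonormal frame of $T\partial\Omega\cap H\mathbb G$ (with $H\mathbb G$ the horizontal bundle spanned by $X_1,\dots,X_m$) and $\nabla^H$ is the projection onto $H\mathbb G$ of the Levi-Civita connection. At a point of $\Sigma$, $\mathcal H$ is the limit of its values on $\partial\Omega\setminus\Sigma$ if that limit exists and is finite; the values on $\Sigma$ are otherwise irrelevant, since $\sigma_H(\Sigma)=0$. Let $u\in\Gamma^3(\overline\Omega)\cap C^2(\overline\Omega)$ with $u=0$ on $\partial\Omega$ (no sign condition on $u$). Here $u\in\Gamma^3(\overline\Omega)$ means that $u$ is continuous on $\overline\Omega$ and its derivatives $X_{j_1}\cdots X_{j_s}u$, $1\le s\le 3$, exist in $\Omega$ and extend continuously to $\overline\Omega$. Then all the integrals below are finite and $$\left|\int_\Omega(\Delta_Hu)^2\,dg-\int_\Omega\|\nabla_H^2u\|^2\,dg+\frac34\sum_{i,j=1}^m\int_\Omega([X_i,X_j]u)^2\,dg\right|\le\int_{\partial\Omega}|\mathcal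 H|\,|\nabla_Hu|^2\,d\sigma_H .$$ -/

import Mathlib

open MeasureTheory Filter Topology Module

noncomputable section

namespace Carnot

/-- A finite-dimensional real Lie algebra with an inner product (no compatibility is required). -/
class EuclideanLieAlgebra (𝔤 : Type*) extends
    NormedAddCommGroup 𝔤, LieRing 𝔤, InnerProductSpace ℝ 𝔤, LieAlgebra ℝ 𝔤 where
  finiteDimensional : FiniteDimensional ℝ 𝔤

instance {𝔤 : Type*} [EuclideanLieAlgebra 𝔤] : FiniteDimensional ℝ 𝔤 :=
  EuclideanLieAlgebra.finiteDimensional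

instance {𝔤 : Type*} [EuclideanLieAlgebra 𝔤] : CompleteSpace 𝔤 :=
  FiniteDimensional.complete ℝ 𝔤

/-- A stratification of step two: `𝔤 = V₁ ⊕ V₂`, `[V₁, V₁] = V₂ ≠ 0`, `[V₁, V₂] = 0`, the two
layers being orthogonal. -/
structure StepTwoStratification (𝔤 : Type*) [EuclideanLieAlgebra 𝔤] where
  V₁ : Submodule ℝ 𝔤
  V₂ : Submodule ℝ 𝔤
  isCompl : IsCompl V₁ V₂
  orthogonal : V₁ ⟂ V₂
  bracket_V₁_V₁ : Submodule.span ℝ {z : 𝔤 | ∃ x ∈ V₁, ∃ y ∈ V₁, ⁅x, y⁆ = z} = V₂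
  bracket_V₁_V₂ : ∀ x ∈ V₁, ∀ y ∈ V₂, ⁅x, y⁆ = 0
  V₂_ne_bot : V₂ ≠ ⊥

section LieAlgebraFacts

variable {𝔤 : Type*} [EuclideanLieAlgebra 𝔤] (S : StepTwoStratification 𝔤)

theorem StepTwoStratification.lie_V₂ (x y : 𝔤) (hy : y ∈ S.V₂) : ⁅x, y⁆ = 0 := by
  have key : ∀ z ∈ S.V₂, ∀ w ∈ S.V₂, ⁅z, w⁆ = 0 := by
    intro z hz w hw
    rw [← S.bracket_V₁_V₁] at hz
    induction hz using Submodule.span_induction with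
    | mem z hz =>
      obtain ⟨a, ha, b, hb, rfl⟩ := hz
      rw [lie_lie, S.bracket_V₁_V₂ b hb w hw, S.bracket_V₁_V₂ a ha w hw]
      simp
    | zero => simp
    | add p q _ _ hp hq => rw [add_lie, hp, hq, add_zero]
    | smul c p _ hp => rw [smul_lie, hp, smul_zero]
  have hx : x ∈ S.V₁ ⊔ S.V₂ := by rw [S.isCompl.sup_eq_top]; trivial
  obtain ⟨a, ha, b, hb, rfl⟩ := Submodule.mem_sup.1 hx
  rw [add_lie, S.bracket_V₁_V₂ a ha y hy, key b hb y hy, add_zero]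

theorem StepTwoStratification.lie_mem_V₂ (x y : 𝔤) : ⁅x, y⁆ ∈ S.V₂ := by
  have hx : x ∈ S.V₁ ⊔ S.V₂ := by rw [S.isCompl.sup_eq_top]; trivial
  have hy : y ∈ S.V₁ ⊔ S.V₂ := by rw [S.isCompl.sup_eq_top]; trivial
  obtain ⟨a, ha, b, hb, rfl⟩ := Submodule.mem_sup.1 hx
  obtain ⟨c, hc, d, hd, rfl⟩ := Submodule.mem_sup.1 hy
  have h1 : ⁅a + b, d⁆ = 0 := S.lie_V₂ _ d hd
  have h2 : ⁅b, c⁆ = 0 := by rw [← lie_skew, S.lie_V₂ c b hb, neg_zero]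
  rw [lie_add, h1, add_zero, add_lie, h2, add_zero, ← S.bracket_V₁_V₁]
  exact Submodule.subset_span ⟨a, ha, c, hc, rfl⟩

/-- The Lie algebra is nilpotent of step two. -/
theorem StepTwoStratification.lie_lie_eq_zero {𝔤 : Type*} [EuclideanLieAlgebra 𝔤]
    (S : StepTwoStratification 𝔤) (x y z : 𝔤) : ⁅x, ⁅y, z⁆⁆ = 0 :=
  S.lie_V₂ _ _ (S.lie_mem_V₂ y z)

end LieAlgebraFacts

/-- The Carnot group of step two with stratified Lie algebra `𝔤`: the simply connected Lie group
of `𝔤`, whose points are uniquely of the form `exp ξ`, `ξ ∈ 𝔤`, and whose product is given by the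
Baker-Campbell-Hausdorff formula `exp ξ * exp η = exp (ξ + η + [ξ, η] / 2)`. -/
@[ext]
structure StepTwoGroup {𝔤 : Type*} [EuclideanLieAlgebra 𝔤] (S : StepTwoStratification 𝔤) where
  exp ::
  log : 𝔤

namespace StepTwoGroup

variable {𝔤 : Type*} [EuclideanLieAlgebra 𝔤] {S : StepTwoStratification 𝔤}

instance : Mul (StepTwoGroup S) :=
  ⟨fun g h => exp (g.log + h.log + (1 / 2 : ℝ) • ⁅g.log, h.log⁆)⟩

instance : One (StepTwoGroup S) := ⟨exp 0⟩

instance : Inv (StepTwoGroup S) := ⟨fun g => exp (-g.log)⟩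

theorem log_mul (g h : StepTwoGroup S) :
    (g * h).log = g.log + h.log + (1 / 2 : ℝ) • ⁅g.log, h.log⁆ := rfl

theorem log_one : (1 : StepTwoGroup S).log = 0 := rfl

theorem log_inv (g : StepTwoGroup S) : (g⁻¹).log = -g.log := rfl

instance : Group (StepTwoGroup S) :=
  Group.ofLeftAxioms
    (fun a b c => by
      have h1 := S.lie_lie_eq_zero a.log b.log c.log
      have h2 : ⁅⁅a.log, b.log⁆, c.log⁆ = 0 := by
        rw [← lie_skew, S.lie_lie_eq_zero, neg_zero]
      ext
      simp only [log_mul, add_lie, lie_add, smul_lie, lie_smul, h1, h2, smul_zero, add_zero,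
        smul_add]
      abel)
    (fun a => by ext; simp [log_mul, log_one])
    (fun a => by ext; simp [log_mul, log_one, log_inv])

/-- The topology that makes `exp` a homeomorphism. -/
instance : TopologicalSpace (StepTwoGroup S) := TopologicalSpace.induced log inferInstance

instance : MeasurableSpace (StepTwoGroup S) := borel _

instance : BorelSpace (StepTwoGroup S) := ⟨rfl⟩

end StepTwoGroup

open StepTwoGroup

section Analysis

variable {𝔤 : Type*} [EuclideanLieAlgebra 𝔤] {S : StepTwoStratification 𝔤}

/-- The bi-invariant Haar measure `dg`: the image under `exp` of Lebesgue measure on `𝔤`. -/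
def haar (S : StepTwoStratification 𝔤) [MeasurableSpace 𝔤] [BorelSpace 𝔤] :
    Measure (StepTwoGroup S) :=
  Measure.map exp (volume : Measure 𝔤)

/-- `(ξ f)(g) = d/dt f(g exp(tξ))` at `t = 0`: the action on `f` of the left-invariant vector
field that equals `ξ` at the identity. -/
def lieDeriv (ξ : 𝔤) (f : StepTwoGroup S → ℝ) (g : StepTwoGroup S) : ℝ :=
  deriv (fun t : ℝ => f (g * exp (t • ξ))) 0

/-- The commutator `[X, Y] f = X (Y f) - Y (X f)`. -/
def commutator (ξ η : 𝔤) (f : StepTwoGroup S → ℝ) (g : StepTwoGroup S) : ℝ :=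
  lieDeriv ξ (lieDeriv η f) g - lieDeriv η (lieDeriv ξ f) g

/-- The entry `f_{,ij} = (X_i X_j f + X_j X_i f) / 2` of the symmetrized horizontal Hessian. -/
def symHessian (ξ η : 𝔤) (f : StepTwoGroup S → ℝ) (g : StepTwoGroup S) : ℝ :=
  (lieDeriv ξ (lieDeriv η f) g + lieDeriv η (lieDeriv ξ f) g) / 2

/-- The horizontal Laplacian `∑ X_i (X_i f)`. -/
def horizontalLaplacian {m : ℕ} (X : Fin m → 𝔤) (f : StepTwoGroup S → ℝ)
    (g : StepTwoGroup S) : ℝ :=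
  ∑ i, lieDeriv (X i) (lieDeriv (X i) f) g

/-- The squared Hilbert-Schmidt norm of the symmetrized horizontal Hessian. -/
def symHessianNormSq {m : ℕ} (X : Fin m → 𝔤) (f : StepTwoGroup S → ℝ)
    (g : StepTwoGroup S) : ℝ :=
  ∑ i, ∑ j, symHessian (X i) (X j) f g ^ 2

/-- The Folland-Stein class `Γ^k(Ω̄)`: `f` is continuous on `Ω̄`, and its derivatives
`X_{j₁} ⋯ X_{j_s} f`, `s ≤ k`, exist in `Ω` and extend continuously to `Ω̄`. -/
def FollandStein {m : ℕ} (X : Fin m → 𝔤) (Ω : Set (StepTwoGroup S)) :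
    ℕ → (StepTwoGroup S → ℝ) → Prop
  | 0, f => ContinuousOn f (closure Ω)
  | k + 1, f => ContinuousOn f (closure Ω) ∧
      ∀ i, ∃ h : StepTwoGroup S → ℝ, FollandStein X Ω k h ∧
        ∀ g ∈ Ω, HasDerivAt (fun t : ℝ => f (g * exp (t • X i))) (h g) 0

/-- `f` is of class `C^k` on `A`, in the global chart `exp`. -/
def IsCkOn (k : ℕ) (f : StepTwoGroup S → ℝ) (A : Set (StepTwoGroup S)) : Prop :=
  ContDiffOn ℝ k (fun ξ : 𝔤 => f (exp ξ)) (exp ⁻¹' A)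

/-- `|∇_H f|²` on `Ω̄`, computed from the continuous extensions to `Ω̄` of the derivatives
`X_i f` in `Ω`. -/
def horizontalGradNormSq {m : ℕ} (X : Fin m → 𝔤) (Ω : Set (StepTwoGroup S))
    (f : StepTwoGroup S → ℝ) (g : StepTwoGroup S) : ℝ :=
  ∑ i, extendFrom Ω (lieDeriv (X i) f) g ^ 2

end Analysis

section Geometry

/-! Tangent vectors at `g` are identified with elements of `𝔤` through left translation. The
left-invariant Riemannian metric that is the given inner product at the identity then becomes the
inner product of `𝔤` at every point. -/

variable {𝔤 : Type*} [EuclideanLieAlgebra 𝔤] {S : StepTwoStratification 𝔤}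

/-- The Riemannian gradient, left-translated to the identity. -/
def riemannianGradient (φ : StepTwoGroup S → ℝ) (g : StepTwoGroup S) : 𝔤 :=
  gradient (fun ξ : 𝔤 => φ (g * exp ξ)) 0

/-- `φ` is a `C²` defining function of `Ω` near the boundary point `g`. -/
def IsLocalDefiningFunction (Ω : Set (StepTwoGroup S)) (g : StepTwoGroup S)
    (φ : StepTwoGroup S → ℝ) : Prop :=
  g ∈ frontier Ω ∧ ∃ U : Set (StepTwoGroup S), IsOpen U ∧ g ∈ U ∧ IsCkOn 2 φ U ∧
    (∀ h ∈ U, riemannianGradient φ h ≠ 0) ∧ ∀ h ∈ U, (h ∈ Ω ↔ φ h < 0)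

/-- A bounded open set of class `C²`. -/
structure IsC2BoundedOpen (Ω : Set (StepTwoGroup S)) : Prop where
  isOpen : IsOpen Ω
  isBounded : Bornology.IsBounded (log '' Ω)
  exists_defining : ∀ g ∈ frontier Ω, ∃ φ, IsLocalDefiningFunction Ω g φ

open Classical in
/-- The Riemannian outer unit normal `ν = ∇φ / |∇φ|` on `∂Ω`, for any local defining function. -/
def outerNormal (Ω : Set (StepTwoGroup S)) (g : StepTwoGroup S) : 𝔤 :=
  if h : ∃ φ, IsLocalDefiningFunction Ω g φ then
    ‖riemannianGradient h.choose g‖⁻¹ • riemannianGradient h.choose g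
  else 0

/-- The horizontal normal `N^H = ∑ ⟨ν, X_j⟩ X_j`: the projection of `ν` onto the first layer. -/
def horizontalNormal (Ω : Set (StepTwoGroup S)) (g : StepTwoGroup S) : 𝔤 :=
  S.V₁.starProjection (outerNormal Ω g)

/-- The angle function `W = |N^H|`. -/
def angle (Ω : Set (StepTwoGroup S)) (g : StepTwoGroup S) : ℝ := ‖horizontalNormal Ω g‖

/-- The characteristic set of `Ω`. -/
def characteristicSet (Ω : Set (StepTwoGroup S)) : Set (StepTwoGroup S) :=
  {g ∈ frontier Ω | angle Ω g = 0}

/-- The horizontal Gauss map `ν^H = N^H / |N^H|`. -/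
def horizontalGaussMap (Ω : Set (StepTwoGroup S)) (g : StepTwoGroup S) : 𝔤 :=
  (angle Ω g)⁻¹ • horizontalNormal Ω g

/-- The adjoint, for the inner product of `𝔤`, of `ad ξ = [ξ, ·]`. -/
def adAdjoint (ξ : 𝔤) : 𝔤 →ₗ[ℝ] 𝔤 := LinearMap.adjoint (LieAlgebra.ad ℝ 𝔤 ξ : 𝔤 →ₗ[ℝ] 𝔤)

/-- The Levi-Civita connection `∇_v Y` at `g`: the derivative of the components of `Y` in a
left-invariant frame, plus the covariant derivative of the left-invariant field through `Y g`,
given by the Koszul formula. -/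
def leviCivita (v : 𝔤) (Y : StepTwoGroup S → 𝔤) (g : StepTwoGroup S) : 𝔤 :=
  deriv (fun t : ℝ => Y (g * exp (t • v))) 0 +
    (1 / 2 : ℝ) • (⁅v, Y g⁆ - adAdjoint v (Y g) - adAdjoint (Y g) v)

/-- The horizontal connection `∇^H_v Y`: the projection of `∇_v Y` onto the first layer. -/
def horizontalConnection (v : 𝔤) (Y : StepTwoGroup S → 𝔤) (g : StepTwoGroup S) : 𝔤 :=
  S.V₁.starProjection (leviCivita v Y g)

/-- The fields `e_1, …, e_{m-1}` (of class `C¹` near `g₀`) restrict on `∂Ω`, near `g₀`, to an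
orthonormal frame of the horizontal tangent bundle `T ∂Ω ∩ H𝔾`. -/
def IsHorizontalTangentFrame (Ω : Set (StepTwoGroup S)) (g₀ : StepTwoGroup S)
    (e : Fin (finrank ℝ S.V₁ - 1) → StepTwoGroup S → 𝔤) : Prop :=
  ∃ U : Set (StepTwoGroup S), IsOpen U ∧ g₀ ∈ U ∧
    (∀ i, ContDiffOn ℝ 1 (fun ξ : 𝔤 => e i (exp ξ)) (exp ⁻¹' U)) ∧
    ∀ g ∈ U ∩ frontier Ω, Orthonormal ℝ (fun i => e i g) ∧
      ∀ i, e i g ∈ S.V₁ ∧ inner ℝ (outerNormal Ω g) (e i g) = 0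

open Classical in
/-- The horizontal mean curvature `∑ ⟨∇^H_{e_i} e_i, ν^H⟩` at noncharacteristic boundary points
(for any orthonormal frame as above). -/
def meanCurvatureOffChar (Ω : Set (StepTwoGroup S)) (g : StepTwoGroup S) : ℝ :=
  if h : ∃ e, IsHorizontalTangentFrame Ω g e then
    ∑ i, inner ℝ (horizontalConnection (h.choose i g) (h.choose i) g) (horizontalGaussMap Ω g)
  else 0

open Classical in
/-- The horizontal mean curvature `𝓗` of `∂Ω`; at a characteristic point it is the limit of its
values at noncharacteristic points if that exists (and `0`, as a convention, otherwise). -/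
def meanCurvature (Ω : Set (StepTwoGroup S)) (g : StepTwoGroup S) : ℝ :=
  if g ∈ characteristicSet Ω then
    if h : ∃ l, Tendsto (meanCurvatureOffChar Ω) (𝓝[frontier Ω \ characteristicSet Ω] g) (𝓝 l)
    then h.choose else 0
  else meanCurvatureOffChar Ω g

/-- The differential of `ψ` at `p`, left-translated to the identity. -/
def leftDifferential {n : ℕ} (ψ : EuclideanSpace ℝ (Fin n) → StepTwoGroup S)
    (p : EuclideanSpace ℝ (Fin n)) : EuclideanSpace ℝ (Fin n) →L[ℝ] 𝔤 :=
  fderiv ℝ (fun q => ((ψ p)⁻¹ * ψ q).log) p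

/-- `ψ`, on the open set `U ⊆ ℝⁿ`, is an injective `C¹` immersion with values in `A`. -/
structure IsLocalParametrization {n : ℕ} (A : Set (StepTwoGroup S))
    (U : Set (EuclideanSpace ℝ (Fin n)))
    (ψ : EuclideanSpace ℝ (Fin n) → StepTwoGroup S) : Prop where
  isOpen : IsOpen U
  contDiffOn : ContDiffOn ℝ 1 (fun p => (ψ p).log) U
  injOn : Set.InjOn ψ U
  immersion : ∀ p ∈ U, Function.Injective (leftDifferential ψ p)
  mapsTo : Set.MapsTo ψ U A

/-- The Riemannian area density `√ det (⟨∂_a ψ, ∂_b ψ⟩)` of a parametrization. -/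
def areaDensity {n : ℕ} (ψ : EuclideanSpace ℝ (Fin n) → StepTwoGroup S)
    (p : EuclideanSpace ℝ (Fin n)) : ℝ :=
  √(Matrix.det (Matrix.gram ℝ
    (fun a : Fin n => leftDifferential ψ p (EuclideanSpace.single a (1 : ℝ)))))

/-- The Riemannian surface measure `σ` of a hypersurface `A`: on the image of a local
parametrization `ψ` it is the image under `ψ` of Lebesgue measure with the area density, and it
is the smallest measure that dominates all these measures (which agree on overlaps). -/
def surfaceMeasure (A : Set (StepTwoGroup S)) : Measure (StepTwoGroup S) :=
  sSup {μ | ∃ (U : Set (EuclideanSpace ℝ (Fin (finrank ℝ 𝔤 - 1))))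
    (ψ : EuclideanSpace ℝ (Fin (finrank ℝ 𝔤 - 1)) → StepTwoGroup S),
    IsLocalParametrization A U ψ ∧
    μ = Measure.map ψ
      ((volume.restrict U).withDensity (fun p => ENNReal.ofReal (areaDensity ψ p)))}

/-- The horizontal perimeter measure `dσ_H = W dσ` on `∂Ω`. -/
def perimeterMeasure (Ω : Set (StepTwoGroup S)) : Measure (StepTwoGroup S) :=
  (surfaceMeasure (frontier Ω)).withDensity (fun g => ENNReal.ofReal (angle Ω g))

end Geometry

end Carnot

end

/-! The proof is a Bochner argument. Consider the horizontal field with components `F_i = X_i u Δ_H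
u - ∑_j X_j u (2 X_j X_i u - X_i X_j u)` (`flux`). Its divergence `∑ X_i F_i` is a quadratic
expression in the second derivatives plus the third-order terms `∑ X_j u (X_j X_i X_i - 2 X_i X_j
X_i + X_i X_i X_j) u = ∑ X_j u [X_i, [X_i, X_j]] u`, and these vanish because the group has step
two. Splitting `X_i X_j u` into symmetric and antisymmetric parts turns the quadratic expression
into the integrand of the theorem; the weights `2` and `-1` in `F` are what produces the coefficient
`3/4`. Hence the quantity inside the absolute value is the flux of `F` through the boundary
(`integral_bochner_eq`).

On the boundary `u = 0`, so `∇_H u = k N^H` for some function `k`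
(`exists_eq_mul_inner_outerNormal`). Differentiating `⟨∇_H u, e_l⟩ = 0` along `e_l` and summing over
a horizontal tangent frame expresses `𝓗` through the second derivatives of `u`
(`mul_meanCurvatureOffChar_eq`), and the flux density becomes `-𝓗 |∇_H u|² |N^H|`. At characteristic
points the flux density vanishes together with `|N^H|`, so nothing about `𝓗` is needed there. Up to
the final `|∫ f| ≤ ∫ |f|` everything is an equality.

The work lies in the regularity. The components `F_i` are only known to be differentiable in
horizontal directions. Therefore the commutator identity is proved weakly, against test functions,
and holds almost everywhere (`cubic_commutator_ae_eq_zero`), and the divergence theorem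
(`integral_eq_integral_boundary`) is proved for functions that have a continuous derivative along a
single left-invariant field. It rests on the invariance of Lebesgue measure under the flow, on a
cutoff in a thin layer along the boundary, and on the identification of the surface measure in a
`C²` chart (`surfaceMeasure_restrict_patch`). The assumption that `u` is `C²` up to the boundary
enters only in the pointwise computations on `∂Ω`. -/

namespace Carnot

/-! ### Left-invariant fields in exponential coordinates. -/

section Frame

variable {𝔤 : Type*} [EuclideanLieAlgebra 𝔤]

/-- The Lie bracket as a continuous bilinear map. -/
noncomputable def bracketCLM : 𝔤 →L[ℝ] 𝔤 →L[ℝ] 𝔤 :=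
  LinearMap.toContinuousLinearMap
    ((LinearMap.toContinuousLinearMap : (𝔤 →ₗ[ℝ] 𝔤) ≃ₗ[ℝ] (𝔤 →L[ℝ] 𝔤)).toLinearMap ∘ₗ
      (LieAlgebra.ad ℝ 𝔤 : 𝔤 →ₗ[ℝ] Module.End ℝ 𝔤))

@[simp] theorem bracketCLM_apply (x y : 𝔤) : bracketCLM x y = ⁅x, y⁆ := rfl

/-- The differential at the identity of the left translation by `exp ξ`, in exponential
coordinates. -/
noncomputable def frame (ξ : 𝔤) : 𝔤 →L[ℝ] 𝔤 :=
  ContinuousLinearMap.id ℝ 𝔤 + (1 / 2 : ℝ) • bracketCLM ξ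

theorem frame_apply (ξ v : 𝔤) : frame ξ v = v + (1 / 2 : ℝ) • ⁅ξ, v⁆ := rfl

@[fun_prop]
theorem contDiff_frame {n : WithTop ℕ∞} : ContDiff ℝ n (frame : 𝔤 → 𝔤 →L[ℝ] 𝔤) := by
  unfold frame; fun_prop

theorem continuous_frame : Continuous (frame : 𝔤 → 𝔤 →L[ℝ] 𝔤) :=
  (contDiff_frame (n := 0)).continuous

theorem hasFDerivAt_frame_apply (X ξ : 𝔤) :
    HasFDerivAt (fun ζ : 𝔤 => frame ζ X)
      ((1 / 2 : ℝ) • (bracketCLM (𝔤 := 𝔤)).flip X) ξ := by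
  have h : HasFDerivAt (fun ζ : 𝔤 => (bracketCLM (𝔤 := 𝔤)).flip X ζ) _ ξ :=
    ((bracketCLM (𝔤 := 𝔤)).flip X).hasFDerivAt
  exact (h.const_smul (1 / 2 : ℝ)).const_add X

variable (S : StepTwoStratification 𝔤)
include S

/-- `frame ξ X` differs from `X` by an element of the centre, so brackets do not see the base point.
-/
theorem lie_frame (ξ X Y : 𝔤) : ⁅frame ξ X, Y⁆ = ⁅X, Y⁆ := by
  rw [frame_apply, add_lie, smul_lie, ← lie_skew ⁅ξ, X⁆ Y, S.lie_lie_eq_zero]; simp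

theorem frame_lie (ξ X Y : 𝔤) : frame ξ ⁅X, Y⁆ = ⁅X, Y⁆ := by
  rw [frame_apply, S.lie_lie_eq_zero]; simp

theorem frame_neg_frame (ξ X : 𝔤) : frame (-ξ) (frame ξ X) = X := by
  rw [frame_apply (-ξ), frame_apply, neg_lie, lie_add, lie_smul, S.lie_lie_eq_zero, smul_zero,
    add_zero, smul_neg, add_neg_cancel_right]

theorem frame_frame_neg (ξ X : 𝔤) : frame ξ (frame (-ξ) X) = X := by
  simpa using frame_neg_frame S (-ξ) X

/-- The coefficients of a left-invariant field are constant along its integral curves, which are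
therefore straight lines in these coordinates. -/
theorem frame_add_frame (ξ X : 𝔤) (t : ℝ) : frame (ξ + t • frame ξ X) X = frame ξ X := by
  rw [frame_apply, frame_apply, add_lie, smul_lie, add_lie, smul_lie, lie_self,
    ← lie_skew ⁅ξ, X⁆, S.lie_lie_eq_zero]
  simp

/-- The map is unipotent because `(ad ξ)² = 0`. The determinant is the characteristic polynomial of
the nilpotent map `-(ad ξ) / 2`, a pure power of the variable, evaluated at `1`. -/
theorem det_frame (ξ : 𝔤) : (frame ξ).det = 1 := by
  have hnil : IsNilpotent (-(1 / 2 : ℝ) • (LieAlgebra.ad ℝ 𝔤 ξ : Module.End ℝ 𝔤)) := by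
    refine ⟨2, LinearMap.ext fun v => ?_⟩
    simp [pow_two, S.lie_lie_eq_zero]
  have h := LinearMap.eval_charpoly (-(1 / 2 : ℝ) • (LieAlgebra.ad ℝ 𝔤 ξ : Module.End ℝ 𝔤)) 1
  rw [hnil.charpoly_eq_X_pow_finrank] at h
  simp only [Polynomial.eval_pow, Polynomial.eval_X, one_pow] at h
  rw [h]
  change LinearMap.det _ = _
  congr 1
  ext v
  simp [frame_apply]

end Frame

/-! ### Transfer between the group and its Lie algebra. -/

section Coordinates

variable {𝔤 : Type*} [EuclideanLieAlgebra 𝔤] {S : StepTwoStratification 𝔤}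

open StepTwoGroup

theorem mul_exp_smul (g : StepTwoGroup S) (t : ℝ) (X : 𝔤) :
    g * exp (t • X) = exp (g.log + t • frame g.log X) := by
  ext
  simp only [log_mul, frame_apply, lie_smul, smul_add]
  rw [smul_comm, add_assoc]

theorem mul_exp (g : StepTwoGroup S) (X : 𝔤) : g * exp X = exp (g.log + frame g.log X) := by
  simpa using mul_exp_smul g 1 X

variable (S) in
/-- The exponential map as a homeomorphism. -/
def expHomeomorph : 𝔤 ≃ₜ StepTwoGroup S where
  toFun := exp
  invFun := log
  left_inv _ := rfl
  right_inv _ := rfl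
  continuous_toFun := continuous_induced_rng.2 continuous_id
  continuous_invFun := continuous_induced_dom

@[fun_prop]
theorem continuous_exp : Continuous (exp : 𝔤 → StepTwoGroup S) := (expHomeomorph S).continuous

@[fun_prop]
theorem continuous_log : Continuous (log : StepTwoGroup S → 𝔤) :=
  (expHomeomorph S).symm.continuous

theorem exp_preimage_closure (A : Set (StepTwoGroup S)) :
    exp ⁻¹' closure A = closure (exp ⁻¹' A) := (expHomeomorph S).preimage_closure A

theorem exp_preimage_frontier (A : Set (StepTwoGroup S)) :
    exp ⁻¹' frontier A = frontier (exp ⁻¹' A) := (expHomeomorph S).preimage_frontier A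

variable [MeasurableSpace 𝔤] [BorelSpace 𝔤]

theorem measurableEmbedding_exp : MeasurableEmbedding (exp : 𝔤 → StepTwoGroup S) :=
  (expHomeomorph S).measurableEmbedding

theorem setIntegral_haar (F : StepTwoGroup S → ℝ) (A : Set (StepTwoGroup S)) :
    ∫ g in A, F g ∂(haar S) = ∫ ξ in exp ⁻¹' A, F (exp ξ) := by
  rw [haar, measurableEmbedding_exp.setIntegral_map]

theorem integrableOn_haar_iff (F : StepTwoGroup S → ℝ) (A : Set (StepTwoGroup S)) :
    IntegrableOn F A (haar S) ↔ IntegrableOn (fun ξ => F (exp ξ)) (exp ⁻¹' A) := by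
  rw [haar, measurableEmbedding_exp.integrableOn_map_iff]; rfl

end Coordinates

/-! ### Integration by parts along left-invariant fields in the interior. -/

section InteriorIntegration

variable {𝔤 : Type*} [EuclideanLieAlgebra 𝔤] (S : StepTwoStratification 𝔤)
  [MeasurableSpace 𝔤] [BorelSpace 𝔤]
include S

theorem measurePreserving_frame (ξ : 𝔤) :
    MeasurePreserving (frame ξ : 𝔤 → 𝔤) volume volume := by
  refine ⟨(frame ξ).continuous.measurable, ?_⟩
  have hd : LinearMap.det (frame ξ : 𝔤 →ₗ[ℝ] 𝔤) = 1 := det_frame S ξ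
  have h := Measure.map_linearMap_addHaar_eq_smul_addHaar (volume : Measure 𝔤)
    (f := (frame ξ : 𝔤 →ₗ[ℝ] 𝔤)) (by rw [hd]; exact one_ne_zero)
  rw [hd] at h
  simpa using h

/-- The flow of a left-invariant vector field preserves Lebesgue measure. -/
theorem measurePreserving_flow (X : 𝔤) (t : ℝ) :
    MeasurePreserving (fun ξ : 𝔤 => ξ + t • frame ξ X) volume volume := by
  -- The flow is right translation by `exp (t X)`. It is affine in `ξ`: since `t [ξ, X] = -[t X,
  -- ξ]`, it is the linear map `frame (-(t • X))` followed by the translation by `t • X`.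
  have h := (measurePreserving_add_right (volume : Measure 𝔤) (t • X)).comp
    (measurePreserving_frame S (-(t • X)))
  convert h using 1
  ext ξ
  simp only [Function.comp, frame_apply, neg_lie, smul_lie, ← lie_skew X ξ]
  simp only [smul_neg, neg_neg, smul_add, smul_comm t (1 / 2 : ℝ)]
  abel

/-- The integral of `f` composed with the flow at time `t` does not depend on `t`. Differentiating
it under the integral sign at `t = 0` uses only the derivative of `f` along the field. -/
theorem integral_eq_zero_of_hasDerivAt_flow (X : 𝔤) {f h : 𝔤 → ℝ} (hf : Continuous f)
    (hfc : HasCompactSupport f) (hh : Continuous h)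
    (hd : ∀ ξ, HasDerivAt (fun t : ℝ => f (ξ + t • frame ξ X)) (h ξ) 0) : ∫ ξ, h ξ = 0 := by
  have hcontT : Continuous (fun p : ℝ × 𝔤 => p.2 + p.1 • frame p.2 X) := by
    have := continuous_frame (𝔤 := 𝔤)
    fun_prop
  have hTT : ∀ (s t : ℝ) (ξ : 𝔤), (ξ + t • frame ξ X) + s • frame (ξ + t • frame ξ X) X
      = ξ + (t + s) • frame ξ X := by
    intro s t ξ
    rw [frame_add_frame S, add_smul, add_assoc]
  have hd' : ∀ ξ (t : ℝ), HasDerivAt (fun t : ℝ => f (ξ + t • frame ξ X))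
      (h (ξ + t • frame ξ X)) t := by
    intro ξ t
    have h1 := hd (ξ + t • frame ξ X)
    simp only [hTT] at h1
    have h2 := HasDerivAt.comp_sub_const (x := t) (a := t) (by simpa using h1)
    simpa using h2
  have hzero : ∀ ξ, ξ ∉ tsupport f → h ξ = 0 := by
    intro ξ hξ
    have h0 : (fun t : ℝ => f (ξ + t • frame ξ X)) =ᶠ[𝓝 0] fun _ => 0 := by
      have hc : Tendsto (fun t : ℝ => ξ + t • frame ξ X) (𝓝 0) (𝓝 ξ) := by
        have : Continuous (fun t : ℝ => ξ + t • frame ξ X) := by fun_prop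
        simpa using this.tendsto 0
      have := hc.eventually ((isClosed_tsupport f).isOpen_compl.mem_nhds hξ)
      filter_upwards [this] with t ht
      exact image_eq_zero_of_notMem_tsupport ht
    exact (hd ξ).unique ((hasDerivAt_const (0 : ℝ) (0 : ℝ)).congr_of_eventuallyEq h0)
  have hhc : HasCompactSupport h := HasCompactSupport.intro hfc hzero
  obtain ⟨C, hC⟩ := hhc.exists_bound_of_continuous hh
  -- All points that can meet the support of `f` within time `1`. It is compact, so the constant `C`
  -- on it is an integrable bound for the difference quotients.
  set K : Set 𝔤 := (fun p : ℝ × 𝔤 => p.2 + p.1 • frame p.2 X) '' (Set.Icc (-1) 1 ×ˢ tsupport f)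
  have hK : IsCompact K := (isCompact_Icc.prod hfc).image hcontT
  have hmemK : ∀ (t : ℝ) ξ, t ∈ Set.Icc (-1 : ℝ) 1 → ξ + t • frame ξ X ∈ tsupport f → ξ ∈ K := by
    intro t ξ ht hξ
    refine ⟨(-t, ξ + t • frame ξ X), ⟨⟨by linarith [ht.2], by linarith [ht.1]⟩, hξ⟩, ?_⟩
    simp only [hTT]
    simp
  have key := hasDerivAt_integral_of_dominated_loc_of_deriv_le (μ := (volume : Measure 𝔤))
    (F := fun (t : ℝ) ξ => f (ξ + t • frame ξ X)) (F' := fun t ξ => h (ξ + t • frame ξ X))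
    (x₀ := (0 : ℝ)) (s := Set.Icc (-1) 1) (bound := K.indicator fun _ => C)
    (Icc_mem_nhds (by norm_num) (by norm_num))
    (Eventually.of_forall fun t =>
      (hf.comp (hcontT.comp (Continuous.prodMk_right t))).aestronglyMeasurable)
    (by simpa using hf.integrable_of_hasCompactSupport hfc)
    (hh.comp (hcontT.comp (Continuous.prodMk_right 0))).aestronglyMeasurable
    (Eventually.of_forall fun ξ t ht => by
      by_cases hξ : ξ ∈ K
      · rw [Set.indicator_of_mem hξ]; exact hC _
      · rw [Set.indicator_of_notMem hξ, hzero _ fun hm => hξ (hmemK t ξ ht hm), norm_zero])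
    ((integrable_indicator_iff hK.measurableSet).2
      (integrableOn_const hK.measure_lt_top.ne))
    (Eventually.of_forall fun ξ t _ => hd' ξ t)
  have hconst : (fun t : ℝ => ∫ ξ, f (ξ + t • frame ξ X)) = fun _ => ∫ ξ, f ξ := by
    funext t
    rw [← (measurePreserving_flow S X t).map_eq,
      integral_map (measurePreserving_flow S X t).measurable.aemeasurable
        hf.aestronglyMeasurable, (measurePreserving_flow S X t).map_eq]
  have h2 := key.2
  rw [hconst] at h2
  simpa using h2.unique (hasDerivAt_const (0 : ℝ) _)

/-- Integration by parts for a left-invariant vector field `X` against a test function; only the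
derivative of `f` in the direction `X` is needed. -/
theorem integral_mul_add_fderiv_mul_eq_zero (X : 𝔤) {O : Set 𝔤} (hO : IsOpen O) {f h k : 𝔤 → ℝ}
    (hf : ContinuousOn f O) (hh : ContinuousOn h O)
    (hd : ∀ ξ ∈ O, HasDerivAt (fun t : ℝ => f (ξ + t • frame ξ X)) (h ξ) 0)
    (hk : ContDiff ℝ 1 k) (hkc : HasCompactSupport k) (hks : tsupport k ⊆ O) :
    ∫ ξ, (k ξ * h ξ + fderiv ℝ k ξ (frame ξ X) * f ξ) = 0 := by
  have hk0 : ∀ ξ, ξ ∉ tsupport k → fderiv ℝ k ξ = 0 := fun ξ hξ => by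
    have := (support_fderiv_subset ℝ (f := k))
    by_contra hne
    exact hξ (this hne)
  have hev : ∀ ξ, ξ ∉ tsupport k → ∀ᶠ ζ in 𝓝 ξ, ζ ∉ tsupport k := fun ξ hξ =>
    (isClosed_tsupport k).isOpen_compl.mem_nhds hξ
  refine integral_eq_zero_of_hasDerivAt_flow S X (f := fun ξ => k ξ * f ξ) ?_ ?_ ?_ ?_
  · rw [continuous_iff_continuousAt]
    intro ξ
    by_cases hξ : ξ ∈ tsupport k
    · exact hk.continuous.continuousAt.mul (hf.continuousAt (hO.mem_nhds (hks hξ)))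
    · refine (continuousAt_const (y := (0 : ℝ))).congr ?_
      filter_upwards [hev ξ hξ] with ζ hζ
      rw [image_eq_zero_of_notMem_tsupport hζ, zero_mul]
  · exact hkc.mul_right
  · rw [continuous_iff_continuousAt]
    intro ξ
    by_cases hξ : ξ ∈ tsupport k
    · have h1 : Continuous fun ζ => fderiv ℝ k ζ (frame ζ X) :=
        (hk.continuous_fderiv one_ne_zero).clm_apply
          (continuous_frame.clm_apply continuous_const)
      exact (hk.continuous.continuousAt.mul (hh.continuousAt (hO.mem_nhds (hks hξ)))).add
        (h1.continuousAt.mul (hf.continuousAt (hO.mem_nhds (hks hξ))))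
    · refine (continuousAt_const (y := (0 : ℝ))).congr ?_
      filter_upwards [hev ξ hξ] with ζ hζ
      simp [image_eq_zero_of_notMem_tsupport hζ, hk0 ζ hζ]
  · intro ξ
    have hline : HasDerivAt (fun t : ℝ => ξ + t • frame ξ X) (frame ξ X) 0 := by
      simpa using ((hasDerivAt_id (0 : ℝ)).smul_const (frame ξ X)).const_add ξ
    by_cases hξ : ξ ∈ tsupport k
    · have h1 : HasDerivAt (fun t : ℝ => k (ξ + t • frame ξ X)) (fderiv ℝ k ξ (frame ξ X)) 0 := by
        have h0 : HasFDerivAt k (fderiv ℝ k ξ) (ξ + (0 : ℝ) • frame ξ X) := by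
          simpa using (hk.differentiable one_ne_zero ξ).hasFDerivAt
        exact h0.comp_hasDerivAt (0 : ℝ) hline
      have h2 := h1.mul (hd ξ (hks hξ))
      refine h2.congr_deriv ?_
      simp; ring
    · have hc : Tendsto (fun t : ℝ => ξ + t • frame ξ X) (𝓝 0) (𝓝 ξ) := by
        simpa using hline.continuousAt.tendsto
      rw [image_eq_zero_of_notMem_tsupport hξ, hk0 ξ hξ]
      simp only [zero_mul, zero_apply, add_zero]
      refine (hasDerivAt_const (0 : ℝ) (0 : ℝ)).congr_of_eventuallyEq ?_
      filter_upwards [hc.eventually (hev ξ hξ)] with t ht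
      rw [image_eq_zero_of_notMem_tsupport ht, zero_mul]

end InteriorIntegration

end Carnot

namespace Carnot

/-! ### Commutators on smooth functions. -/

section Smooth

variable {𝔤 : Type*} [EuclideanLieAlgebra 𝔤]

/-- The left-invariant vector field `X`, in exponential coordinates, applied to a differentiable
function. -/
noncomputable def coordDeriv (X : 𝔤) (k : 𝔤 → ℝ) (ξ : 𝔤) : ℝ := fderiv ℝ k ξ (frame ξ X)

theorem contDiff_coordDeriv (X : 𝔤) {k : 𝔤 → ℝ} {n : ℕ} (hk : ContDiff ℝ (n + 1 : ℕ) k) :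
    ContDiff ℝ n (coordDeriv X k) :=
  ContDiff.clm_apply (hk.fderiv_right (by norm_cast))
    (contDiff_frame.clm_apply contDiff_const)

theorem tsupport_coordDeriv_subset (X : 𝔤) (k : 𝔤 → ℝ) : tsupport (coordDeriv X k) ⊆ tsupport k := by
  refine closure_minimal (fun ξ hξ => ?_) (isClosed_tsupport k)
  refine support_fderiv_subset ℝ (f := k) fun h0 => hξ ?_
  simp [coordDeriv, h0]

theorem coordDeriv_add (X : 𝔤) {k l : 𝔤 → ℝ} (hk : Differentiable ℝ k) (hl : Differentiable ℝ l)
    (ξ : 𝔤) : coordDeriv X (fun ζ => k ζ + l ζ) ξ = coordDeriv X k ξ + coordDeriv X l ξ := by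
  simp only [coordDeriv]
  rw [fderiv_fun_add (hk ξ) (hl ξ)]; rfl

/-- The first-order term comes from differentiating the affine coefficients of the field `Y`; it is
the only part that is not symmetric in `X` and `Y`. -/
theorem coordDeriv_coordDeriv (X Y : 𝔤) {k : 𝔤 → ℝ} (hk : ContDiff ℝ 2 k) (ξ : 𝔤) :
    coordDeriv X (coordDeriv Y k) ξ = fderiv ℝ (fderiv ℝ k) ξ (frame ξ X) (frame ξ Y) +
      (1 / 2 : ℝ) * fderiv ℝ k ξ ⁅frame ξ X, Y⁆ := by
  have h1 : DifferentiableAt ℝ (fderiv ℝ k) ξ :=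
    (hk.fderiv_right (m := 1) (by norm_num)).differentiable one_ne_zero ξ
  have h2 := h1.hasFDerivAt.clm_apply (hasFDerivAt_frame_apply Y ξ)
  change fderiv ℝ (fun ζ => fderiv ℝ k ζ (frame ζ Y)) ξ (frame ξ X) = _
  rw [h2.fderiv]
  simp [add_comm]

variable (S : StepTwoStratification 𝔤)
include S

/-- The second derivatives cancel by symmetry, and the two half-brackets add up to one full bracket.
-/
theorem coordDeriv_comm_sub (X Y : 𝔤) {k : 𝔤 → ℝ} (hk : ContDiff ℝ 2 k) (ξ : 𝔤) :
    coordDeriv X (coordDeriv Y k) ξ - coordDeriv Y (coordDeriv X k) ξ = coordDeriv ⁅X, Y⁆ k ξ := by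
  have hsymm : IsSymmSndFDerivAt ℝ k ξ :=
    hk.contDiffAt.isSymmSndFDerivAt (by simp)
  rw [coordDeriv_coordDeriv X Y hk, coordDeriv_coordDeriv Y X hk, hsymm.eq (frame ξ X) (frame ξ Y),
    lie_frame S, lie_frame S, coordDeriv, frame_lie S, ← lie_skew X Y, map_neg]
  ring

/-- The left side is `[X, [X, Y]] k` written out, and the double bracket is zero in step two. -/
theorem coordDeriv_cubic (X Y : 𝔤) {k : 𝔤 → ℝ} (hk : ContDiff ℝ 3 k) (ξ : 𝔤) :
    coordDeriv X (coordDeriv X (coordDeriv Y k)) ξ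
      - 2 * coordDeriv X (coordDeriv Y (coordDeriv X k)) ξ
      + coordDeriv Y (coordDeriv X (coordDeriv X k)) ξ = 0 := by
  have h2 : ContDiff ℝ 2 k := hk.of_le (by norm_num)
  have hX : ContDiff ℝ 2 (coordDeriv X k) := contDiff_coordDeriv (n := 2) X hk
  have hYX : ContDiff ℝ 1 (coordDeriv Y (coordDeriv X k)) := contDiff_coordDeriv (n := 1) Y hX
  have hZ : ContDiff ℝ 2 (coordDeriv ⁅X, Y⁆ k) := contDiff_coordDeriv (n := 2) _ hk
  have e1 : coordDeriv X (coordDeriv Y k)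
      = fun ζ => coordDeriv Y (coordDeriv X k) ζ + coordDeriv ⁅X, Y⁆ k ζ := by
    funext ζ
    rw [← coordDeriv_comm_sub S X Y h2]; ring
  rw [e1, coordDeriv_add X (hYX.differentiable one_ne_zero) (hZ.differentiable two_ne_zero)]
  have e2 := coordDeriv_comm_sub S X Y hX ξ
  have e3 := coordDeriv_comm_sub S X ⁅X, Y⁆ h2 ξ
  rw [S.lie_lie_eq_zero] at e3
  have e4 : coordDeriv (0 : 𝔤) k ξ = 0 := by simp [coordDeriv]
  rw [e4] at e3
  linarith

end Smooth

/-! ### The cubic commutator identity for functions with horizontal derivatives only. -/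

section Weak

theorem integral_sub_two_mul_add {α : Type*} [MeasurableSpace α] {μ : Measure α} {a b c : α → ℝ}
    (ha : Integrable a μ) (hb : Integrable b μ) (hc : Integrable c μ) :
    ∫ x, (a x - 2 * b x + c x) ∂μ = ∫ x, a x ∂μ - 2 * ∫ x, b x ∂μ + ∫ x, c x ∂μ := by
  have h1 := integral_add (ha.sub (hb.const_mul 2)) hc
  have h2 := integral_sub ha (hb.const_mul 2)
  rw [integral_const_mul] at h2
  simp only [Pi.sub_apply] at h1
  rw [h1, h2]

variable {𝔤 : Type*} [EuclideanLieAlgebra 𝔤] (S : StepTwoStratification 𝔤)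
  [MeasurableSpace 𝔤] [BorelSpace 𝔤]

theorem integrable_mul_of_tsupport_subset {O : Set 𝔤} (hO : IsOpen O) {f k : 𝔤 → ℝ}
    (hf : ContinuousOn f O) (hk : Continuous k) (hkc : HasCompactSupport k) (hks : tsupport k ⊆ O) :
    Integrable fun ξ => k ξ * f ξ := by
  refine Continuous.integrable_of_hasCompactSupport ?_ hkc.mul_right
  rw [continuous_iff_continuousAt]
  intro ξ
  by_cases hξ : ξ ∈ tsupport k
  · exact hk.continuousAt.mul (hf.continuousAt (hO.mem_nhds (hks hξ)))
  · refine (continuousAt_const (y := (0 : ℝ))).congr ?_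
    filter_upwards [(isClosed_tsupport k).isOpen_compl.mem_nhds hξ] with ζ hζ
    rw [image_eq_zero_of_notMem_tsupport hζ, zero_mul]

include S in
theorem integral_mul_eq_neg_coordDeriv (X : 𝔤) {O : Set 𝔤} (hO : IsOpen O) {f h k : 𝔤 → ℝ}
    (hf : ContinuousOn f O) (hh : ContinuousOn h O)
    (hd : ∀ ξ ∈ O, HasDerivAt (fun t : ℝ => f (ξ + t • frame ξ X)) (h ξ) 0)
    (hk : ContDiff ℝ 1 k) (hkc : HasCompactSupport k) (hks : tsupport k ⊆ O) :
    ∫ ξ, k ξ * h ξ = - ∫ ξ, coordDeriv X k ξ * f ξ := by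
  have h1 := integral_mul_add_fderiv_mul_eq_zero S X hO hf hh hd hk hkc hks
  rw [integral_add] at h1
  · exact eq_neg_of_add_eq_zero_left h1
  · exact integrable_mul_of_tsupport_subset hO hh hk.continuous hkc hks
  · have hs := tsupport_coordDeriv_subset X k
    exact integrable_mul_of_tsupport_subset hO hf
      (contDiff_coordDeriv (n := 0) X (by simpa using hk)).continuous
      (hkc.of_isClosed_subset (isClosed_tsupport _) hs) (hs.trans hks)

include S in
/-- Let `uₐ`, `uₐᵦ`, … be the derivatives `Xₐ u`, `Xᵦ Xₐ u`, … of `u` in the classical sense. If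
they are continuous then `X` commutes with the commutator `[X, Y]` on `u`. -/
theorem cubic_commutator_ae_eq_zero (X Y : 𝔤) {O : Set 𝔤} (hO : IsOpen O)
    {u uX uY uXX uXY uYX uXXY uXYX uYXX : 𝔤 → ℝ}
    (cu : ContinuousOn u O) (cX : ContinuousOn uX O) (cY : ContinuousOn uY O)
    (cXX : ContinuousOn uXX O) (cXY : ContinuousOn uXY O) (cYX : ContinuousOn uYX O)
    (cXXY : ContinuousOn uXXY O) (cXYX : ContinuousOn uXYX O) (cYXX : ContinuousOn uYXX O)
    (dX : ∀ ξ ∈ O, HasDerivAt (fun t : ℝ => u (ξ + t • frame ξ X)) (uX ξ) 0)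
    (dY : ∀ ξ ∈ O, HasDerivAt (fun t : ℝ => u (ξ + t • frame ξ Y)) (uY ξ) 0)
    (dXX : ∀ ξ ∈ O, HasDerivAt (fun t : ℝ => uX (ξ + t • frame ξ X)) (uXX ξ) 0)
    (dXY : ∀ ξ ∈ O, HasDerivAt (fun t : ℝ => uX (ξ + t • frame ξ Y)) (uXY ξ) 0)
    (dYX : ∀ ξ ∈ O, HasDerivAt (fun t : ℝ => uY (ξ + t • frame ξ X)) (uYX ξ) 0)
    (dXXY : ∀ ξ ∈ O, HasDerivAt (fun t : ℝ => uXX (ξ + t • frame ξ Y)) (uXXY ξ) 0)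
    (dXYX : ∀ ξ ∈ O, HasDerivAt (fun t : ℝ => uXY (ξ + t • frame ξ X)) (uXYX ξ) 0)
    (dYXX : ∀ ξ ∈ O, HasDerivAt (fun t : ℝ => uYX (ξ + t • frame ξ X)) (uYXX ξ) 0) :
    ∀ᵐ ξ, ξ ∈ O → uXXY ξ - 2 * uXYX ξ + uYXX ξ = 0 := by
  have hc : ContinuousOn (fun ξ => uXXY ξ - 2 * uXYX ξ + uYXX ξ) O :=
    (cXXY.sub (continuousOn_const.mul cXYX)).add cYXX
  refine hO.ae_eq_zero_of_integral_contDiff_smul_eq_zero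
    (hc.locallyIntegrableOn hO.measurableSet) fun k hk hkc hks => ?_
  have h3 : ContDiff ℝ 3 k := by exact_mod_cast contDiff_infty.1 hk 3
  -- Three integrations by parts move a word of derivatives onto the test function; the word is
  -- reversed and the sign is `(-1)³`.
  have triple : ∀ (A B C : 𝔤) {f fA fAB fABC : 𝔤 → ℝ}, ContinuousOn f O → ContinuousOn fA O →
      ContinuousOn fAB O → ContinuousOn fABC O →
      (∀ ξ ∈ O, HasDerivAt (fun t : ℝ => f (ξ + t • frame ξ A)) (fA ξ) 0) →
      (∀ ξ ∈ O, HasDerivAt (fun t : ℝ => fA (ξ + t • frame ξ B)) (fAB ξ) 0) →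
      (∀ ξ ∈ O, HasDerivAt (fun t : ℝ => fAB (ξ + t • frame ξ C)) (fABC ξ) 0) →
      (∫ ξ, k ξ * fABC ξ = - ∫ ξ, coordDeriv A (coordDeriv B (coordDeriv C k)) ξ * f ξ) ∧
      Integrable fun ξ => coordDeriv A (coordDeriv B (coordDeriv C k)) ξ * f ξ := by
    intro A B C f fA fAB fABC c0 c1 c2 c3 d1 d2 d3
    have s1 := tsupport_coordDeriv_subset C k
    have s2 := tsupport_coordDeriv_subset B (coordDeriv C k)
    have s3 := tsupport_coordDeriv_subset A (coordDeriv B (coordDeriv C k))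
    have r1 : ContDiff ℝ 2 (coordDeriv C k) := contDiff_coordDeriv (n := 2) C h3
    have r2 : ContDiff ℝ 1 (coordDeriv B (coordDeriv C k)) := contDiff_coordDeriv (n := 1) B r1
    have r3 : ContDiff ℝ 0 (coordDeriv A (coordDeriv B (coordDeriv C k))) :=
      contDiff_coordDeriv (n := 0) A (by simpa using r2)
    have k1 : HasCompactSupport (coordDeriv C k) :=
      hkc.of_isClosed_subset (isClosed_tsupport _) s1
    have k2 : HasCompactSupport (coordDeriv B (coordDeriv C k)) :=
      k1.of_isClosed_subset (isClosed_tsupport _) s2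
    have k3 : HasCompactSupport (coordDeriv A (coordDeriv B (coordDeriv C k))) :=
      k2.of_isClosed_subset (isClosed_tsupport _) s3
    constructor
    · rw [integral_mul_eq_neg_coordDeriv S C hO c2 c3 d3 (h3.of_le (by norm_num)) hkc hks,
        integral_mul_eq_neg_coordDeriv S B hO c1 c2 d2 (r1.of_le (by norm_num)) k1 (s1.trans hks),
        integral_mul_eq_neg_coordDeriv S A hO c0 c1 d1 r2 k2 (s2.trans (s1.trans hks)), neg_neg]
    · exact integrable_mul_of_tsupport_subset hO c0 r3.continuous k3
        (s3.trans (s2.trans (s1.trans hks)))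
  obtain ⟨e1, i1⟩ := triple X X Y cu cX cXX cXXY dX dXX dXXY
  obtain ⟨e2, i2⟩ := triple X Y X cu cX cXY cXYX dX dXY dXYX
  obtain ⟨e3, i3⟩ := triple Y X X cu cY cYX cYXX dY dYX dYXX
  have j : ∀ {f : 𝔤 → ℝ}, ContinuousOn f O → Integrable fun ξ => k ξ * f ξ := fun hf =>
    integrable_mul_of_tsupport_subset hO hf hk.continuous hkc hks
  -- The combination `XXY - 2 XYX + YXX` is unchanged when its words are reversed, so the smooth
  -- identity applies to the test function as it stands.
  have hzero : ∫ ξ, (coordDeriv X (coordDeriv X (coordDeriv Y k)) ξ * u ξ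
      - 2 * (coordDeriv X (coordDeriv Y (coordDeriv X k)) ξ * u ξ)
      + coordDeriv Y (coordDeriv X (coordDeriv X k)) ξ * u ξ) = 0 := by
    rw [← integral_zero 𝔤 ℝ]
    congr 1
    funext ξ
    have := coordDeriv_cubic S X Y h3 ξ
    linear_combination u ξ * this
  rw [integral_sub_two_mul_add i1 i2 i3] at hzero
  calc ∫ ξ, k ξ • (uXXY ξ - 2 * uXYX ξ + uYXX ξ)
      = ∫ ξ, (k ξ * uXXY ξ - 2 * (k ξ * uXYX ξ) + k ξ * uYXX ξ) := by
        congr 1; funext ξ; rw [smul_eq_mul]; ring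
    _ = 0 := by
        rw [integral_sub_two_mul_add (j cXXY) (j cXYX) (j cYXX), e1, e2, e3]
        linarith

end Weak

end Carnot

namespace Carnot

open StepTwoGroup

/-! ### Independence of the outer normal from the defining function. -/

section Normal

variable {𝔤 : Type*} [EuclideanLieAlgebra 𝔤] {S : StepTwoStratification 𝔤}
  {Ω : Set (StepTwoGroup S)} {g : StepTwoGroup S} {φ : StepTwoGroup S → ℝ}

theorem hasFDerivAt_comp_mul_exp {D : 𝔤 →L[ℝ] ℝ}
    (h : HasFDerivAt (fun ξ : 𝔤 => φ (exp ξ)) D g.log) :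
    HasFDerivAt (fun ξ : 𝔤 => φ (g * exp ξ)) (D ∘L frame g.log) 0 := by
  simp only [mul_exp]
  have h1 : HasFDerivAt (fun ξ : 𝔤 => g.log + frame g.log ξ) (frame g.log) 0 :=
    (frame g.log).hasFDerivAt.const_add _
  have h2 : HasFDerivAt (fun ξ : 𝔤 => φ (exp ξ)) D (g.log + frame g.log 0) := by simpa using h
  exact h2.comp (0 : 𝔤) h1

theorem inner_riemannianGradient {D : 𝔤 →L[ℝ] ℝ}
    (h : HasFDerivAt (fun ξ : 𝔤 => φ (exp ξ)) D g.log) (v : 𝔤) :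
    inner ℝ (riemannianGradient φ g) v = D (frame g.log v) := by
  rw [riemannianGradient, gradient, (hasFDerivAt_comp_mul_exp h).fderiv,
    InnerProductSpace.toDual_symm_apply]
  rfl

theorem hasDerivAt_line (ξ v : 𝔤) : HasDerivAt (fun t : ℝ => ξ + t • v) v 0 := by
  simpa using ((hasDerivAt_id (0 : ℝ)).smul_const v).const_add ξ

theorem hasDerivAt_comp_line {F : Type*} [NormedAddCommGroup F] [NormedSpace ℝ F]
    {f : 𝔤 → F} {D : 𝔤 →L[ℝ] F} {ξ : 𝔤} (h : HasFDerivAt f D ξ) (v : 𝔤) :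
    HasDerivAt (fun t : ℝ => f (ξ + t • v)) (D v) 0 := by
  have h' : HasFDerivAt f D (ξ + (0 : ℝ) • v) := by simpa using h
  exact h'.comp_hasDerivAt (0 : ℝ) (hasDerivAt_line ξ v)

theorem IsLocalDefiningFunction.hasFDerivAt (h : IsLocalDefiningFunction Ω g φ) :
    HasFDerivAt (fun ξ : 𝔤 => φ (exp ξ)) (fderiv ℝ (fun ξ : 𝔤 => φ (exp ξ)) g.log) g.log := by
  obtain ⟨-, U, hU, hgU, hC, -, -⟩ := h
  exact ((hC.contDiffAt ((hU.preimage continuous_exp).mem_nhds hgU)).differentiableAt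
    (by norm_num)).hasFDerivAt

theorem IsLocalDefiningFunction.riemannianGradient_ne_zero
    (h : IsLocalDefiningFunction Ω g φ) : riemannianGradient φ g ≠ 0 := by
  obtain ⟨-, U, hU, hgU, -, hne, -⟩ := h
  exact hne g hgU

theorem IsLocalDefiningFunction.eventually_mem_iff (h : IsLocalDefiningFunction Ω g φ) :
    ∀ᶠ ξ in 𝓝 g.log, (exp ξ ∈ Ω ↔ φ (exp ξ) < 0) := by
  obtain ⟨-, U, hU, hgU, -, -, hiff⟩ := h
  filter_upwards [(hU.preimage continuous_exp).mem_nhds hgU] with ξ hξ using hiff _ hξ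

theorem IsLocalDefiningFunction.apply_eq_zero (h : IsLocalDefiningFunction Ω g φ) : φ g = 0 := by
  have hc : Tendsto (fun ξ : 𝔤 => φ (exp ξ)) (𝓝 g.log) (𝓝 (φ g)) :=
    h.hasFDerivAt.continuousAt.tendsto
  have hg : g.log ∈ frontier (exp ⁻¹' Ω) := by
    rw [← exp_preimage_frontier]; exact h.1
  rcases lt_trichotomy (φ g) 0 with h0 | h0 | h0
  · refine absurd ?_ hg.2
    rw [mem_interior_iff_mem_nhds]
    filter_upwards [hc.eventually (gt_mem_nhds h0), h.eventually_mem_iff] with ξ h1 h2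
      using h2.2 h1
  · exact h0
  · have h1 := mem_closure_iff_frequently.1 hg.1
    obtain ⟨ξ, hξ, h2, h3⟩ :=
      (h1.and_eventually ((hc.eventually (lt_mem_nhds h0)).and h.eventually_mem_iff)).exists
    exact absurd (h3.1 hξ) (not_lt.2 (le_of_lt h2))

/-- An open half-space contained in a closed one through the same origin has the same boundary
hyperplane, so the two normals are positive multiples of each other. -/
theorem exists_pos_smul_eq_of_inner_neg_imp {E : Type*} [NormedAddCommGroup E]
    [InnerProductSpace ℝ E] {G H : E} (hG : G ≠ 0) (hH : H ≠ 0)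
    (himp : ∀ v, inner ℝ G v < 0 → inner ℝ H v ≤ 0) : ∃ c : ℝ, 0 < c ∧ H = c • G := by
  have hG2 : (0 : ℝ) < inner ℝ G G := real_inner_self_pos.2 hG
  -- A vector of the closed half-space is the limit of `v - ε • G`, which lies in the open one.
  have hle : ∀ v, inner ℝ G v ≤ 0 → inner ℝ H v ≤ 0 := by
    intro v hv
    have ht : Tendsto (fun ε : ℝ => inner ℝ H (v - ε • G)) (𝓝[>] 0) (𝓝 (inner ℝ H v)) := by
      have : Continuous (fun ε : ℝ => inner ℝ H (v - ε • G)) := by fun_prop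
      simpa using (this.tendsto 0).mono_left nhdsWithin_le_nhds
    refine le_of_tendsto ht ?_
    filter_upwards [self_mem_nhdsWithin] with ε hε
    refine himp _ ?_
    rw [inner_sub_right, inner_smul_right]
    nlinarith [mul_pos (show (0 : ℝ) < ε from hε) hG2]
  have horth : ∀ v, inner ℝ G v = 0 → inner ℝ H v = 0 := by
    intro v hv
    refine le_antisymm (hle v hv.le) ?_
    have := hle (-v) (by simp [hv])
    simpa using this
  have hHG : H = (inner ℝ G H / inner ℝ G G) • G := by
    set w := H - (inner ℝ G H / inner ℝ G G) • G with hw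
    have h1 : inner ℝ G w = 0 := by
      rw [hw, inner_sub_right, inner_smul_right, div_mul_cancel₀ _ hG2.ne', sub_self]
    have h2 : inner ℝ H w = 0 := horth w h1
    have h3 : inner ℝ w w = 0 := by
      conv_lhs => rw [hw, inner_sub_left, inner_smul_left]
      rw [h1, h2]; simp
    exact sub_eq_zero.1 (inner_self_eq_zero.1 h3)
  refine ⟨inner ℝ G H / inner ℝ G G, ?_, hHG⟩
  have h1 := hle (-G) (by simp [inner_neg_right])
  rw [inner_neg_right, real_inner_comm] at h1
  refine lt_of_le_of_ne (div_nonneg (by linarith) hG2.le) fun h0 => hH ?_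
  rw [hHG, ← h0, zero_smul]

/-- A direction in which `φ` decreases points into `Ω`. There `ψ` is negative, and it vanishes at
`g`, so its derivative in that direction cannot be positive. -/
theorem IsLocalDefiningFunction.inner_neg_imp {ψ : StepTwoGroup S → ℝ}
    (h : IsLocalDefiningFunction Ω g φ) (h' : IsLocalDefiningFunction Ω g ψ) (v : 𝔤)
    (hv : inner ℝ (riemannianGradient φ g) v < 0) : inner ℝ (riemannianGradient ψ g) v ≤ 0 := by
  rw [inner_riemannianGradient h.hasFDerivAt] at hv
  rw [inner_riemannianGradient h'.hasFDerivAt]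
  have hφ := hasDerivAt_comp_line h.hasFDerivAt (frame g.log v)
  have hψ := hasDerivAt_comp_line h'.hasFDerivAt (frame g.log v)
  rw [hasDerivAt_iff_tendsto_slope] at hφ hψ
  have hsub : 𝓝[>] (0 : ℝ) ≤ 𝓝[≠] 0 := nhdsWithin_mono _ fun t ht => ne_of_gt ht
  have hφ0 : φ (exp g.log) = 0 := h.apply_eq_zero
  have hψ0 : ψ (exp g.log) = 0 := h'.apply_eq_zero
  have hline : Tendsto (fun t : ℝ => g.log + t • frame g.log v) (𝓝[>] 0) (𝓝 g.log) := by
    simpa using (hasDerivAt_line g.log (frame g.log v)).continuousAt.tendsto.mono_left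
      nhdsWithin_le_nhds
  refine le_of_tendsto (hψ.mono_left hsub) ?_
  filter_upwards [(hφ.mono_left hsub).eventually (gt_mem_nhds hv), self_mem_nhdsWithin,
    hline.eventually h.eventually_mem_iff, hline.eventually h'.eventually_mem_iff] with t h1 ht h2 h3
  have ht' : (0 : ℝ) < t := ht
  simp only [slope_def_field, zero_smul, add_zero, sub_zero, hφ0, hψ0] at h1 ⊢
  have h4 : φ (exp (g.log + t • frame g.log v)) < 0 := by
    by_contra hge
    exact absurd h1 (not_lt.2 (div_nonneg (not_lt.1 hge) ht'.le))
  exact div_nonpos_of_nonpos_of_nonneg (h3.1 (h2.2 h4)).le ht'.le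

/-- The outer unit normal can be computed from any local defining function. -/
theorem IsLocalDefiningFunction.outerNormal_eq (h : IsLocalDefiningFunction Ω g φ) :
    outerNormal Ω g = ‖riemannianGradient φ g‖⁻¹ • riemannianGradient φ g := by
  have hex : ∃ φ, IsLocalDefiningFunction Ω g φ := ⟨φ, h⟩
  rw [outerNormal, dif_pos hex]
  have h' := hex.choose_spec
  obtain ⟨c, hc, he⟩ := exists_pos_smul_eq_of_inner_neg_imp h.riemannianGradient_ne_zero
    h'.riemannianGradient_ne_zero (h.inner_neg_imp h')
  rw [he, norm_smul, Real.norm_of_nonneg hc.le, smul_smul]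
  congr 1
  field_simp

theorem IsLocalDefiningFunction.norm_outerNormal (h : IsLocalDefiningFunction Ω g φ) :
    ‖outerNormal Ω g‖ = 1 := by
  rw [h.outerNormal_eq, norm_smul, norm_inv, norm_norm,
    inv_mul_cancel₀ (norm_ne_zero_iff.2 h.riemannianGradient_ne_zero)]

theorem outerNormal_of_notMem_frontier (hg : g ∉ frontier Ω) : outerNormal Ω g = 0 := by
  rw [outerNormal, dif_neg]
  rintro ⟨φ, h, -⟩
  exact hg h

end Normal

end Carnot

namespace Carnot

open StepTwoGroup

/-! ### Charts that straighten the boundary. -/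

section Chart

/-- The parameter space of hypersurfaces. -/
abbrev ParamSpace (𝔤 : Type*) [EuclideanLieAlgebra 𝔤] : Type :=
  EuclideanSpace ℝ (Fin (finrank ℝ 𝔤 - 1))

variable {𝔤 : Type*} [EuclideanLieAlgebra 𝔤] {S : StepTwoStratification 𝔤}

/-- A chart of `𝔤`, of class `C²`, that straightens the boundary of `Ω`. -/
structure BoundaryChart (Ω : Set (StepTwoGroup S)) where
  toChart : OpenPartialHomeomorph 𝔤 (ParamSpace 𝔤 × ℝ)
  contDiffOn : ContDiffOn ℝ 2 toChart toChart.source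
  contDiffOn_symm : ContDiffOn ℝ 2 toChart.symm toChart.target
  mem_iff : ∀ ξ ∈ toChart.source, exp ξ ∈ Ω ↔ (toChart ξ).2 < 0

include S in
-- The subtraction of natural numbers is genuine because `V₂ ≠ 0` makes the dimension positive.
theorem StepTwoStratification.finrank_eq : finrank ℝ 𝔤 = finrank ℝ 𝔤 - 1 + 1 := by
  have : Nontrivial 𝔤 := by
    obtain ⟨x, -, hx⟩ := Submodule.exists_mem_ne_zero_of_ne_bot S.V₂_ne_bot
    exact ⟨x, 0, hx⟩
  have := finrank_pos (R := ℝ) (M := 𝔤)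
  omega

/-- The inverse function theorem for `ξ ↦ (π ξ, φ (exp ξ))`, where `π` is the orthogonal projection
onto the kernel of the differential of `φ` at the base point, identified with the parameter space.
-/
theorem IsLocalDefiningFunction.exists_boundaryChart {Ω : Set (StepTwoGroup S)}
    {g : StepTwoGroup S} {φ : StepTwoGroup S → ℝ} (h : IsLocalDefiningFunction Ω g φ) :
    ∃ c : BoundaryChart Ω, g.log ∈ c.toChart.source := by
  have hD := h.hasFDerivAt
  have hne := h.riemannianGradient_ne_zero
  set D : 𝔤 →L[ℝ] ℝ := fderiv ℝ (fun ξ : 𝔤 => φ (exp ξ)) g.log with hDdef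
  obtain ⟨-, U, hU, hgU, hC, -, hiff⟩ := h
  have hU' : IsOpen (exp ⁻¹' U : Set 𝔤) := hU.preimage continuous_exp
  have hD0 : (D : 𝔤 →ₗ[ℝ] ℝ) ≠ 0 := by
    intro h0
    apply hne
    have h1 := inner_riemannianGradient hD (riemannianGradient φ g)
    have h2 : D (frame g.log (riemannianGradient φ g)) = 0 := LinearMap.congr_fun h0 _
    rw [h2] at h1
    exact inner_self_eq_zero.1 h1
  have hker : finrank ℝ (LinearMap.ker (D : 𝔤 →ₗ[ℝ] ℝ)) = finrank ℝ (ParamSpace 𝔤) := by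
    have h1 := Module.Dual.finrank_ker_add_one_of_ne_zero (f := (D : 𝔤 →ₗ[ℝ] ℝ)) hD0
    have h2 := S.finrank_eq
    rw [finrank_euclideanSpace_fin]
    omega
  let e : LinearMap.ker (D : 𝔤 →ₗ[ℝ] ℝ) ≃L[ℝ] ParamSpace 𝔤 :=
    ContinuousLinearEquiv.ofFinrankEq hker
  let π : 𝔤 →L[ℝ] ParamSpace 𝔤 :=
    (e : _ →L[ℝ] ParamSpace 𝔤) ∘L (LinearMap.ker (D : 𝔤 →ₗ[ℝ] ℝ)).orthogonalProjectionOnto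
  have hinj : Function.Injective ((π.prod D : 𝔤 →L[ℝ] ParamSpace 𝔤 × ℝ) :
      𝔤 →ₗ[ℝ] ParamSpace 𝔤 × ℝ) := by
    rw [← LinearMap.ker_eq_bot, Submodule.eq_bot_iff]
    intro v hv
    have hv' : (π v, D v) = 0 := hv
    have h1 : π v = 0 := congrArg Prod.fst hv'
    have h2 : D v = 0 := congrArg Prod.snd hv'
    have h3 : (LinearMap.ker (D : 𝔤 →ₗ[ℝ] ℝ)).orthogonalProjectionOnto v = 0 :=
      e.injective (h1.trans e.map_zero.symm)
    have h4 : v ∈ LinearMap.ker (D : 𝔤 →ₗ[ℝ] ℝ) := h2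
    have h5 := Submodule.orthogonalProjectionOnto_mem_subspace_eq_self (⟨v, h4⟩ : LinearMap.ker (D : 𝔤 →ₗ[ℝ] ℝ))
    rw [h3] at h5
    exact congrArg Subtype.val h5.symm
  have hfr : finrank ℝ 𝔤 = finrank ℝ (ParamSpace 𝔤 × ℝ) := by
    rw [finrank_prod, finrank_euclideanSpace_fin, finrank_self]; exact S.finrank_eq
  let A : 𝔤 ≃L[ℝ] ParamSpace 𝔤 × ℝ :=
    (LinearEquiv.ofInjectiveOfFinrankEq _ hinj hfr).toContinuousLinearEquiv
  have hA : (A : 𝔤 →L[ℝ] ParamSpace 𝔤 × ℝ) = π.prod D := by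
    ext1 v; rfl
  let F : 𝔤 → ParamSpace 𝔤 × ℝ := fun ξ => (π ξ, φ (exp ξ))
  have hFC : ContDiffOn ℝ 2 F (exp ⁻¹' U) := π.contDiff.contDiffOn.prodMk hC
  have hgU' : g.log ∈ (exp ⁻¹' U : Set 𝔤) := hgU
  have hFat : ContDiffAt ℝ 2 F g.log := hFC.contDiffAt (hU'.mem_nhds hgU')
  have hFD : HasFDerivAt F (A : 𝔤 →L[ℝ] ParamSpace 𝔤 × ℝ) g.log := by
    rw [hA]; exact π.hasFDerivAt.prodMk hD
  let Φ := hFat.toOpenPartialHomeomorph F hFD two_ne_zero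
  have hΦ : (Φ : 𝔤 → ParamSpace 𝔤 × ℝ) = F := rfl
  have hsymm : ContDiffAt ℝ 2 Φ.symm (F g.log) := hFat.to_localInverse hFD two_ne_zero
  -- The inverse is known to be `C²` only near the image of the base point. The chart is shrunk so
  -- that this holds on its whole target.
  obtain ⟨W, hWsub, hWo, hWm⟩ := mem_nhds_iff.1 (hsymm.eventually (by simp))
  let s : Set 𝔤 := exp ⁻¹' U ∩ (Φ.source ∩ Φ ⁻¹' W)
  have hs : IsOpen s := hU'.inter (Φ.isOpen_inter_preimage hWo)
  have hgs : g.log ∈ Φ.source := hFat.mem_toOpenPartialHomeomorph_source hFD two_ne_zero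
  refine ⟨⟨Φ.restrOpen s hs, ?_, ?_, ?_⟩, ?_⟩
  · exact hFC.mono fun ξ hξ => hξ.2.1
  · intro y hy
    refine ContDiffAt.contDiffWithinAt (hWsub ?_)
    have h1 : Φ (Φ.symm y) ∈ W := hy.2.2.2
    rwa [Φ.right_inv hy.1] at h1
  · intro ξ hξ
    exact hiff _ hξ.2.1
  · exact ⟨hgs, hgU', hgs, hWm⟩

end Chart

namespace BoundaryChart

variable {𝔤 : Type*} [EuclideanLieAlgebra 𝔤] {S : StepTwoStratification 𝔤}
  {Ω : Set (StepTwoGroup S)} (c : BoundaryChart Ω)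

/-- The last coordinate of the chart, a defining function of `Ω`. -/
noncomputable def height (g : StepTwoGroup S) : ℝ := (c.toChart g.log).2

/-- The domain of the parametrization of the boundary. -/
def paramDomain : Set (ParamSpace 𝔤) := {p | (p, (0 : ℝ)) ∈ c.toChart.target}

/-- The parametrization of the boundary, in exponential coordinates. -/
noncomputable def coordParam (p : ParamSpace 𝔤) : 𝔤 := c.toChart.symm (p, 0)

/-- The parametrization of the boundary. -/
noncomputable def param (p : ParamSpace 𝔤) : StepTwoGroup S := exp (c.coordParam p)

theorem isOpen_paramDomain : IsOpen c.paramDomain :=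
  c.toChart.open_target.preimage (by fun_prop)

theorem contDiffAt {ξ : 𝔤} (hξ : ξ ∈ c.toChart.source) : ContDiffAt ℝ 2 c.toChart ξ :=
  c.contDiffOn.contDiffAt (c.toChart.open_source.mem_nhds hξ)

theorem contDiffAt_symm {y : ParamSpace 𝔤 × ℝ} (hy : y ∈ c.toChart.target) :
    ContDiffAt ℝ 2 c.toChart.symm y :=
  c.contDiffOn_symm.contDiffAt (c.toChart.open_target.mem_nhds hy)

theorem hasFDerivAt {ξ : 𝔤} (hξ : ξ ∈ c.toChart.source) :
    HasFDerivAt c.toChart (fderiv ℝ c.toChart ξ) ξ :=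
  ((c.contDiffAt hξ).differentiableAt two_ne_zero).hasFDerivAt

theorem hasFDerivAt_symm {y : ParamSpace 𝔤 × ℝ} (hy : y ∈ c.toChart.target) :
    HasFDerivAt c.toChart.symm (fderiv ℝ c.toChart.symm y) y :=
  ((c.contDiffAt_symm hy).differentiableAt two_ne_zero).hasFDerivAt

theorem fderiv_fderiv_symm {y : ParamSpace 𝔤 × ℝ} (hy : y ∈ c.toChart.target)
    (w : ParamSpace 𝔤 × ℝ) :
    fderiv ℝ c.toChart (c.toChart.symm y) (fderiv ℝ c.toChart.symm y w) = w := by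
  have h1 := (c.hasFDerivAt (c.toChart.map_target hy)).comp y (c.hasFDerivAt_symm hy)
  have h2 : HasFDerivAt (c.toChart ∘ c.toChart.symm) (ContinuousLinearMap.id ℝ _) y :=
    (hasFDerivAt_id y).congr_of_eventuallyEq (by
      filter_upwards [c.toChart.open_target.mem_nhds hy] with z hz using c.toChart.right_inv hz)
  exact DFunLike.congr_fun (h1.unique h2) w

theorem fderiv_symm_fderiv {y : ParamSpace 𝔤 × ℝ} (hy : y ∈ c.toChart.target) (v : 𝔤) :
    fderiv ℝ c.toChart.symm y (fderiv ℝ c.toChart (c.toChart.symm y) v) = v := by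
  have hξ := c.toChart.map_target hy
  have h0 : HasFDerivAt c.toChart.symm (fderiv ℝ c.toChart.symm y)
      (c.toChart (c.toChart.symm y)) := by
    rw [c.toChart.right_inv hy]; exact c.hasFDerivAt_symm hy
  have h1 := h0.comp (c.toChart.symm y) (c.hasFDerivAt hξ)
  have h2 : HasFDerivAt (c.toChart.symm ∘ c.toChart) (ContinuousLinearMap.id ℝ _)
      (c.toChart.symm y) :=
    (hasFDerivAt_id _).congr_of_eventuallyEq (by
      filter_upwards [c.toChart.open_source.mem_nhds hξ] with z hz using c.toChart.left_inv hz)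
  exact DFunLike.congr_fun (h1.unique h2) v

theorem hasFDerivAt_height {ξ : 𝔤} (hξ : ξ ∈ c.toChart.source) :
    HasFDerivAt (fun ζ : 𝔤 => c.height (exp ζ))
      (ContinuousLinearMap.snd ℝ _ ℝ ∘L fderiv ℝ c.toChart ξ) ξ :=
  (ContinuousLinearMap.snd ℝ (ParamSpace 𝔤) ℝ).hasFDerivAt.comp ξ (c.hasFDerivAt hξ)

theorem mem_closure_imp {ξ : 𝔤} (hξ : ξ ∈ c.toChart.source) (h : exp ξ ∈ closure Ω) :
    (c.toChart ξ).2 ≤ 0 := by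
  by_contra! hpos
  have h1 : ξ ∈ closure (exp ⁻¹' Ω : Set 𝔤) := by rw [← exp_preimage_closure]; exact h
  have hc : ContinuousAt (fun ζ => (c.toChart ζ).2) ξ :=
    continuous_snd.continuousAt.comp (c.toChart.continuousAt hξ)
  obtain ⟨ζ, hζ, h2, h3⟩ := ((mem_closure_iff_frequently.1 h1).and_eventually
    ((hc.eventually (lt_mem_nhds hpos)).and (c.toChart.open_source.mem_nhds hξ))).exists
  exact absurd ((c.mem_iff ζ h3).1 hζ) (not_lt.2 (le_of_lt h2))

theorem mem_closure_iff {ξ : 𝔤} (hξ : ξ ∈ c.toChart.source) :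
    exp ξ ∈ closure Ω ↔ (c.toChart ξ).2 ≤ 0 := by
  refine ⟨c.mem_closure_imp hξ, fun hle => ?_⟩
  have h1 : ξ ∈ closure (exp ⁻¹' Ω : Set 𝔤) := by
    have hy := c.toChart.map_source hξ
    -- Lowering the last chart coordinate by `ε` moves the point into `Ω`.
    have ht : Tendsto (fun ε : ℝ => c.toChart.symm ((c.toChart ξ).1, (c.toChart ξ).2 - ε))
        (𝓝[>] 0) (𝓝 ξ) := by
      have h2 : Tendsto (fun ε : ℝ => ((c.toChart ξ).1, (c.toChart ξ).2 - ε))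
          (𝓝[>] 0) (𝓝 (c.toChart ξ)) := by
        have : Continuous (fun ε : ℝ => ((c.toChart ξ).1, (c.toChart ξ).2 - ε)) := by fun_prop
        simpa using (this.tendsto 0).mono_left nhdsWithin_le_nhds
      have h3 := (c.toChart.continuousAt_symm hy).tendsto.comp h2
      rwa [c.toChart.left_inv hξ] at h3
    have hev : ∀ᶠ ε : ℝ in 𝓝[>] 0, ((c.toChart ξ).1, (c.toChart ξ).2 - ε) ∈ c.toChart.target := by
      have : Continuous (fun ε : ℝ => ((c.toChart ξ).1, (c.toChart ξ).2 - ε)) := by fun_prop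
      refine nhdsWithin_le_nhds (this.continuousAt.eventually
        (c.toChart.open_target.mem_nhds ?_))
      simpa using hy
    refine mem_closure_of_tendsto ht ?_
    filter_upwards [hev, self_mem_nhdsWithin] with ε h2 hε
    refine (c.mem_iff _ (c.toChart.map_target h2)).2 ?_
    rw [c.toChart.right_inv h2]
    have : (0 : ℝ) < ε := hε
    change (c.toChart ξ).2 - ε < 0
    linarith
  rw [← exp_preimage_closure] at h1
  exact h1

theorem mem_frontier_iff (hΩ : IsOpen Ω) {ξ : 𝔤} (hξ : ξ ∈ c.toChart.source) :
    exp ξ ∈ frontier Ω ↔ (c.toChart ξ).2 = 0 := by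
  rw [hΩ.frontier_eq, Set.mem_sdiff, c.mem_closure_iff hξ, c.mem_iff ξ hξ, not_lt]
  exact ⟨fun h => le_antisymm h.1 h.2, fun h => ⟨h.le, h.ge⟩⟩

theorem isLocalDefiningFunction {g : StepTwoGroup S} (hg : g.log ∈ c.toChart.source)
    (hgf : g ∈ frontier Ω) : IsLocalDefiningFunction Ω g c.height := by
  refine ⟨hgf, log ⁻¹' c.toChart.source, c.toChart.open_source.preimage continuous_log, hg, ?_, ?_,
    fun h hh => c.mem_iff h.log hh⟩
  · exact contDiff_snd.comp_contDiffOn c.contDiffOn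
  · intro h hh h0
    have h1 := inner_riemannianGradient (c.hasFDerivAt_height (ξ := h.log) hh)
    have hy := c.toChart.map_source hh
    have h2 := c.fderiv_fderiv_symm hy (0, 1)
    rw [c.toChart.left_inv hh] at h2
    have h3 := h1 (frame (-h.log) (fderiv ℝ c.toChart.symm (c.toChart h.log) (0, 1)))
    rw [frame_frame_neg S, h0, inner_zero_left, ContinuousLinearMap.comp_apply, h2] at h3
    simp at h3

theorem param_mem_frontier (hΩ : IsOpen Ω) {p : ParamSpace 𝔤} (hp : p ∈ c.paramDomain) :
    c.param p ∈ frontier Ω := by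
  refine (c.mem_frontier_iff hΩ (c.toChart.map_target hp)).2 ?_
  rw [c.toChart.right_inv hp]

theorem coordParam_mem_source {p : ParamSpace 𝔤} (hp : p ∈ c.paramDomain) :
    c.coordParam p ∈ c.toChart.source := c.toChart.map_target hp

theorem toChart_coordParam {p : ParamSpace 𝔤} (hp : p ∈ c.paramDomain) :
    c.toChart (c.coordParam p) = (p, 0) := c.toChart.right_inv hp

theorem coordParam_fst {ξ : 𝔤} (hξ : ξ ∈ c.toChart.source) (h0 : (c.toChart ξ).2 = 0) :
    (c.toChart ξ).1 ∈ c.paramDomain ∧ c.coordParam (c.toChart ξ).1 = ξ := by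
  have h1 : ((c.toChart ξ).1, (0 : ℝ)) = c.toChart ξ := by rw [← h0]
  constructor
  · change ((c.toChart ξ).1, (0 : ℝ)) ∈ c.toChart.target
    rw [h1]; exact c.toChart.map_source hξ
  · change c.toChart.symm ((c.toChart ξ).1, (0 : ℝ)) = ξ
    rw [h1]; exact c.toChart.left_inv hξ

theorem contDiffOn_coordParam : ContDiffOn ℝ 2 c.coordParam c.paramDomain :=
  c.contDiffOn_symm.comp (contDiff_id.prodMk contDiff_const).contDiffOn fun _ hp => hp

theorem hasFDerivAt_coordParam {p : ParamSpace 𝔤} (hp : p ∈ c.paramDomain) :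
    HasFDerivAt c.coordParam
      (fderiv ℝ c.toChart.symm (p, 0) ∘L ContinuousLinearMap.inl ℝ (ParamSpace 𝔤) ℝ) p := by
  have h1 : HasFDerivAt (fun p : ParamSpace 𝔤 => (p, (0 : ℝ)))
      (ContinuousLinearMap.inl ℝ (ParamSpace 𝔤) ℝ) p := hasFDerivAt_prodMk_left p 0
  exact (c.hasFDerivAt_symm hp).comp p h1

theorem leftDifferential_eq {n : ℕ} {ψ : EuclideanSpace ℝ (Fin n) → StepTwoGroup S}
    {p : EuclideanSpace ℝ (Fin n)} {D : EuclideanSpace ℝ (Fin n) →L[ℝ] 𝔤}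
    (h : HasFDerivAt (fun q => (ψ q).log) D p) :
    leftDifferential ψ p = frame (-(ψ p).log) ∘L D := by
  have h1 : (fun q => ((ψ p)⁻¹ * ψ q).log)
      = fun q => -(ψ p).log + frame (-(ψ p).log) (ψ q).log := by
    funext q
    rw [log_mul, log_inv, frame_apply, add_assoc]
  rw [leftDifferential, h1]
  exact (((frame (-(ψ p).log)).hasFDerivAt.comp p h).const_add _).fderiv

theorem leftDifferential_param {p : ParamSpace 𝔤} (hp : p ∈ c.paramDomain) :
    leftDifferential c.param p = frame (-(c.coordParam p)) ∘L
      (fderiv ℝ c.toChart.symm (p, 0) ∘L ContinuousLinearMap.inl ℝ (ParamSpace 𝔤) ℝ) :=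
  leftDifferential_eq (c.hasFDerivAt_coordParam hp)

theorem isLocalParametrization (hΩ : IsOpen Ω) :
    IsLocalParametrization (frontier Ω) c.paramDomain c.param where
  isOpen := c.isOpen_paramDomain
  contDiffOn := c.contDiffOn_coordParam.of_le (by norm_num)
  injOn := by
    intro p hp q hq hpq
    have h1 : c.coordParam p = c.coordParam q := congrArg log hpq
    have h2 := c.toChart_coordParam hp
    rw [h1, c.toChart_coordParam hq] at h2
    exact (congrArg Prod.fst h2).symm
  immersion := by
    intro p hp v w hvw
    rw [c.leftDifferential_param hp] at hvw
    have h1 := congrArg (frame (c.coordParam p)) hvw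
    simp only [ContinuousLinearMap.comp_apply, frame_frame_neg S] at h1
    have h2 := congrArg (fderiv ℝ c.toChart (c.toChart.symm (p, 0))) h1
    rw [c.fderiv_fderiv_symm hp, c.fderiv_fderiv_symm hp] at h2
    exact congrArg Prod.fst h2
  mapsTo := fun _ hp => c.param_mem_frontier hΩ hp

end BoundaryChart

end Carnot

namespace Carnot

open StepTwoGroup

/-! ### Gram determinants and the area density. -/

section LinearAlgebra

variable {𝔤 : Type*} [EuclideanLieAlgebra 𝔤]

/-- A linear isometry from the (Hilbert) product `ℝⁿ⁻¹ × ℝ` to `𝔤`. -/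
theorem StepTwoStratification.exists_volumeChart (S : StepTwoStratification 𝔤)
    [MeasurableSpace 𝔤] [BorelSpace 𝔤] :
    ∃ J : (ParamSpace 𝔤 × ℝ) ≃L[ℝ] 𝔤, MeasurePreserving J volume volume ∧
      ∀ v w, inner ℝ (J v) (J w) = inner ℝ v.1 w.1 + v.2 * w.2 := by
  have hfr : finrank ℝ (WithLp 2 (ParamSpace 𝔤 × ℝ)) = finrank ℝ 𝔤 := by
    rw [(WithLp.linearEquiv 2 ℝ (ParamSpace 𝔤 × ℝ)).finrank_eq, finrank_prod,
      finrank_euclideanSpace_fin, finrank_self]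
    exact S.finrank_eq.symm
  let J₀ : WithLp 2 (ParamSpace 𝔤 × ℝ) ≃ₗᵢ[ℝ] 𝔤 :=
    (stdOrthonormalBasis ℝ _).equiv (stdOrthonormalBasis ℝ 𝔤) (finCongr hfr)
  refine ⟨(WithLp.prodContinuousLinearEquiv 2 ℝ (ParamSpace 𝔤) ℝ).symm.trans
    J₀.toContinuousLinearEquiv, ?_, ?_⟩
  · exact J₀.measurePreserving.comp (WithLp.volume_preserving_toLp _ _)
  · intro v w
    change inner ℝ (J₀ (WithLp.toLp 2 v)) (J₀ (WithLp.toLp 2 w)) = _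
    rw [J₀.inner_map_map, WithLp.prod_inner_apply]
    simp [mul_comm]

/-- The standard basis of `ℝⁿ × ℝ`. -/
noncomputable def prodBasis (n : ℕ) : Basis (Fin n ⊕ Unit) ℝ (EuclideanSpace ℝ (Fin n) × ℝ) :=
  (EuclideanSpace.basisFun (Fin n) ℝ).toBasis.prod (Basis.singleton Unit ℝ)

theorem sum_prodBasis_repr_mul {n : ℕ} (v w : EuclideanSpace ℝ (Fin n) × ℝ) :
    ∑ k, (prodBasis n).repr v k * (prodBasis n).repr w k = inner ℝ v.1 w.1 + v.2 * w.2 := by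
  rw [Fintype.sum_sum_type]
  simp [prodBasis, PiLp.inner_apply, mul_comm]

theorem prodBasis_inl {n : ℕ} (a : Fin n) :
    prodBasis n (Sum.inl a) = (EuclideanSpace.single a (1 : ℝ), 0) := by
  ext <;> simp [prodBasis]

theorem prodBasis_inr {n : ℕ} (a : Unit) : prodBasis n (Sum.inr a) = (0, 1) := by
  ext <;> simp [prodBasis]

/-- Volume is base area times height. The vector `G` is orthogonal to the image of the hyperplane.
Replacing the last basis vector by a preimage `(b, s)` of `G` makes the full Gram matrix block
diagonal, with corner `s = ‖G‖²`; this change of basis has determinant `s`, and comparing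
determinants gives the formula. -/
theorem det_gram_of_inner_eq_snd {n : ℕ} (J : (EuclideanSpace ℝ (Fin n) × ℝ) ≃L[ℝ] 𝔤)
    (hJ : ∀ v w, inner ℝ (J v) (J w) = inner ℝ v.1 w.1 + v.2 * w.2)
    (T : EuclideanSpace ℝ (Fin n) × ℝ →L[ℝ] 𝔤) (hT : Function.Surjective T) (G : 𝔤)
    (hG : ∀ w, inner ℝ G (T w) = w.2) :
    (Matrix.gram ℝ fun a : Fin n => T (EuclideanSpace.single a (1 : ℝ), 0)).det
      = ‖G‖ ^ 2 * ((J.symm : 𝔤 →L[ℝ] _) ∘L T).det ^ 2 := by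
  classical
  obtain ⟨⟨b, s⟩, hb⟩ := hT G
  have hs : s = inner ℝ G G := by
    have := hG (b, s)
    rw [hb] at this
    exact this.symm
  have hs0 : s ≠ 0 := by
    intro h0
    have h1 := hG (0, 1)
    rw [inner_self_eq_zero.1 (hs.symm.trans h0)] at h1
    simp at h1
  -- `R` fixes the hyperplane and sends the last basis vector to the preimage `(b, s)` of `G`.
  let R : EuclideanSpace ℝ (Fin n) × ℝ →ₗ[ℝ] EuclideanSpace ℝ (Fin n) × ℝ :=
    (LinearMap.fst ℝ _ ℝ + (LinearMap.snd ℝ _ ℝ).smulRight b).prod (s • LinearMap.snd ℝ _ ℝ)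
  have hR : ∀ v, R v = (v.1 + v.2 • b, s * v.2) := fun v => rfl
  have hTR1 : ∀ a : Fin n, T (R (prodBasis n (Sum.inl a)))
      = T (EuclideanSpace.single a (1 : ℝ), 0) := by
    intro a; rw [prodBasis_inl, hR]; simp
  have hTR2 : ∀ a : Unit, T (R (prodBasis n (Sum.inr a))) = G := by
    intro a; rw [prodBasis_inr, hR, ← hb]; simp
  let L : EuclideanSpace ℝ (Fin n) × ℝ →ₗ[ℝ] EuclideanSpace ℝ (Fin n) × ℝ :=
    ((J.symm : 𝔤 →L[ℝ] EuclideanSpace ℝ (Fin n) × ℝ) ∘L T : _ →L[ℝ] _)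
  have hdetR : LinearMap.det R = s := by
    rw [← LinearMap.det_toMatrix (prodBasis n)]
    have : LinearMap.toMatrix (prodBasis n) (prodBasis n) R
        = Matrix.fromBlocks 1 (Matrix.of fun i _ => b i) 0 (Matrix.of fun _ _ => s) := by
      ext i j
      rcases i with i | i <;> rcases j with j | j <;>
        rw [LinearMap.toMatrix_apply, hR] <;>
        simp [prodBasis_inl, prodBasis_inr, Matrix.one_apply] <;> simp [prodBasis]
    rw [this, Matrix.det_fromBlocks_zero₂₁]
    simp
  have hgram : (LinearMap.toMatrix (prodBasis n) (prodBasis n) (L ∘ₗ R)).transpose *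
      LinearMap.toMatrix (prodBasis n) (prodBasis n) (L ∘ₗ R)
      = Matrix.fromBlocks (Matrix.gram ℝ fun a : Fin n => T (EuclideanSpace.single a (1 : ℝ), 0))
        0 0 (Matrix.of fun _ _ => s) := by
    have hent : ∀ i j, ((LinearMap.toMatrix (prodBasis n) (prodBasis n) (L ∘ₗ R)).transpose *
      LinearMap.toMatrix (prodBasis n) (prodBasis n) (L ∘ₗ R)) i j
        = inner ℝ (T (R (prodBasis n i))) (T (R (prodBasis n j))) := by
      intro i j
      rw [Matrix.mul_apply]
      simp only [Matrix.transpose_apply, LinearMap.toMatrix_apply]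
      rw [sum_prodBasis_repr_mul, ← hJ]
      simp [L]
    ext i j
    rw [hent]
    rcases i with i | i <;> rcases j with j | j
    · rw [hTR1, hTR1]; simp [Matrix.gram]
    · rw [hTR1, hTR2, real_inner_comm, hG]; simp
    · rw [hTR1, hTR2, hG]; simp
    · rw [hTR2, ← hs]; simp
  have h1 := congrArg Matrix.det hgram
  rw [Matrix.det_mul, Matrix.det_transpose, LinearMap.det_toMatrix, Matrix.det_fromBlocks_zero₂₁,
    LinearMap.det_comp, hdetR] at h1
  have h2 : (Matrix.of fun _ _ => s : Matrix Unit Unit ℝ).det = s := by simp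
  rw [h2] at h1
  have h3 : ((J.symm : 𝔤 →L[ℝ] _) ∘L T).det = LinearMap.det L := rfl
  rw [h3, ← real_inner_self_eq_norm_sq, ← hs]
  have h4 : (LinearMap.det L * s * (LinearMap.det L * s)) = (s * LinearMap.det L ^ 2) * s := by ring
  rw [h4] at h1
  exact (mul_right_cancel₀ hs0 h1).symm

theorem det_gram_comp {n : ℕ} (T : EuclideanSpace ℝ (Fin n) →L[ℝ] 𝔤)
    (M : EuclideanSpace ℝ (Fin n) →L[ℝ] EuclideanSpace ℝ (Fin n)) :
    (Matrix.gram ℝ fun a : Fin n => T (M (EuclideanSpace.single a (1 : ℝ)))).det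
      = (Matrix.gram ℝ fun a : Fin n => T (EuclideanSpace.single a (1 : ℝ))).det * M.det ^ 2 := by
  classical
  set B := (EuclideanSpace.basisFun (Fin n) ℝ).toBasis with hB
  set A := LinearMap.toMatrix B B (M : EuclideanSpace ℝ (Fin n) →ₗ[ℝ] EuclideanSpace ℝ (Fin n))
    with hA
  have hM : ∀ a, M (EuclideanSpace.single a (1 : ℝ))
      = ∑ k, A k a • EuclideanSpace.single k (1 : ℝ) := by
    intro a
    have := (B.sum_repr (M (EuclideanSpace.single a (1 : ℝ)))).symm
    rw [this]
    refine Finset.sum_congr rfl fun k _ => ?_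
    rw [hA, LinearMap.toMatrix_apply]
    simp [hB]
  have h1 : (Matrix.gram ℝ fun a : Fin n => T (M (EuclideanSpace.single a (1 : ℝ))))
      = A.transpose * (Matrix.gram ℝ fun a : Fin n => T (EuclideanSpace.single a (1 : ℝ))) * A := by
    ext i j
    simp only [Matrix.gram, Matrix.of_apply, hM, map_sum, map_smul, Matrix.mul_apply,
      sum_inner, inner_sum, inner_smul_left, inner_smul_right, Matrix.transpose_apply,
      Finset.sum_mul, Finset.mul_sum]
    refine Finset.sum_congr rfl fun k _ => Finset.sum_congr rfl fun l _ => ?_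
    simp; ring
  have h2 : A.det = M.det := LinearMap.det_toMatrix B _
  rw [h1, Matrix.det_mul, Matrix.det_mul, Matrix.det_transpose, h2]
  ring

end LinearAlgebra

namespace BoundaryChart

variable {𝔤 : Type*} [EuclideanLieAlgebra 𝔤] {S : StepTwoStratification 𝔤}
  {Ω : Set (StepTwoGroup S)} (c : BoundaryChart Ω)

/-- The gradient of the height is dual to the last coordinate under the left-translated differential
of the inverse chart, so `det_gram_of_inner_eq_snd` applies. The left translation drops out because
its determinant is `1`. -/
theorem areaDensity_param (J : (ParamSpace 𝔤 × ℝ) ≃L[ℝ] 𝔤)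
    (hJ : ∀ v w, inner ℝ (J v) (J w) = inner ℝ v.1 w.1 + v.2 * w.2)
    {p : ParamSpace 𝔤} (hp : p ∈ c.paramDomain) :
    areaDensity c.param p = ‖riemannianGradient c.height (c.param p)‖ *
      |((J.symm : 𝔤 →L[ℝ] _) ∘L fderiv ℝ c.toChart.symm (p, 0)).det| := by
  set T : ParamSpace 𝔤 × ℝ →L[ℝ] 𝔤 :=
    frame (-(c.coordParam p)) ∘L fderiv ℝ c.toChart.symm (p, 0) with hTdef
  have hT : Function.Surjective T := by
    intro v
    refine ⟨fderiv ℝ c.toChart (c.toChart.symm (p, 0)) (frame (c.coordParam p) v), ?_⟩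
    rw [hTdef, ContinuousLinearMap.comp_apply, c.fderiv_symm_fderiv hp, frame_neg_frame S]
  have hG : ∀ w, inner ℝ (riemannianGradient c.height (c.param p)) (T w) = w.2 := by
    intro w
    rw [inner_riemannianGradient (g := c.param p) (c.hasFDerivAt_height (c.coordParam_mem_source hp))]
    change (fderiv ℝ c.toChart (c.coordParam p) (frame (c.coordParam p) (T w))).2 = _
    rw [hTdef, ContinuousLinearMap.comp_apply, frame_frame_neg S]
    exact congrArg Prod.snd (c.fderiv_fderiv_symm hp w)
  have h1 := det_gram_of_inner_eq_snd J hJ T hT _ hG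
  have h2 : (fun a => leftDifferential c.param p (EuclideanSpace.single a (1 : ℝ)))
      = fun a => T (EuclideanSpace.single a (1 : ℝ), 0) := by
    funext a
    rw [c.leftDifferential_param hp]
    rfl
  have h3 : ((J.symm : 𝔤 →L[ℝ] _) ∘L T).det
      = ((J.symm : 𝔤 →L[ℝ] _) ∘L fderiv ℝ c.toChart.symm (p, 0)).det := by
    set F := frame (-(c.coordParam p))
    have e1 : (((J.symm : 𝔤 →L[ℝ] ParamSpace 𝔤 × ℝ) ∘L T :
          ParamSpace 𝔤 × ℝ →L[ℝ] ParamSpace 𝔤 × ℝ) : ParamSpace 𝔤 × ℝ →ₗ[ℝ] ParamSpace 𝔤 × ℝ)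
        = ((J.symm.toLinearEquiv : 𝔤 →ₗ[ℝ] _) ∘ₗ (F : 𝔤 →ₗ[ℝ] 𝔤) ∘ₗ
            (J.symm.toLinearEquiv.symm : _ →ₗ[ℝ] 𝔤)) ∘ₗ
          (((J.symm : 𝔤 →L[ℝ] ParamSpace 𝔤 × ℝ) ∘L fderiv ℝ c.toChart.symm (p, 0) :
            ParamSpace 𝔤 × ℝ →L[ℝ] ParamSpace 𝔤 × ℝ) : ParamSpace 𝔤 × ℝ →ₗ[ℝ] ParamSpace 𝔤 × ℝ) := by
      refine LinearMap.ext fun w => ?_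
      simp [hTdef]
    change LinearMap.det _ = LinearMap.det _
    rw [e1, LinearMap.det_comp, LinearMap.det_conj]
    have hF : LinearMap.det (F : 𝔤 →ₗ[ℝ] 𝔤) = 1 := det_frame S _
    rw [hF, one_mul]
  rw [areaDensity, h2, h1, h3, Real.sqrt_mul (sq_nonneg _), Real.sqrt_sq (norm_nonneg _),
    Real.sqrt_sq_eq_abs]

end BoundaryChart

end Carnot

namespace Carnot

open StepTwoGroup

/-! ### The surface measure in a chart. -/

section SurfaceMeasure

variable {𝔤 : Type*} [EuclideanLieAlgebra 𝔤] {S : StepTwoStratification 𝔤}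

/-- The image under a parametrization of Lebesgue measure with the area density. -/
noncomputable def paramMeasure {n : ℕ} (U : Set (EuclideanSpace ℝ (Fin n)))
    (ψ : EuclideanSpace ℝ (Fin n) → StepTwoGroup S) : Measure (StepTwoGroup S) :=
  Measure.map ψ ((volume.restrict U).withDensity fun p => ENNReal.ofReal (areaDensity ψ p))

theorem measurableSet_preimage_inter_of_continuousOn {α β : Type*} [TopologicalSpace α]
    [MeasurableSpace α] [OpensMeasurableSpace α] [TopologicalSpace β] [MeasurableSpace β]
    [BorelSpace β] {f : α → β} {U : Set α} (hf : ContinuousOn f U) (hU : MeasurableSet U)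
    {B : Set β} (hB : MeasurableSet B) : MeasurableSet (f ⁻¹' B ∩ U) := by
  have h1 : MeasurableSet ((fun x : U => f x) ⁻¹' B) :=
    (continuousOn_iff_continuous_domRestrict.1 hf).measurable hB
  have h2 := hU.subtype_image h1
  convert h2 using 1
  ext x
  simp [and_comm]

namespace IsLocalParametrization

variable {n : ℕ} {A : Set (StepTwoGroup S)} {U : Set (EuclideanSpace ℝ (Fin n))}
  {ψ : EuclideanSpace ℝ (Fin n) → StepTwoGroup S}

theorem continuousOn (h : IsLocalParametrization A U ψ) : ContinuousOn ψ U :=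
  continuous_exp.comp_continuousOn h.contDiffOn.continuousOn

theorem aemeasurable (h : IsLocalParametrization A U ψ) :
    AEMeasurable ψ ((volume.restrict U).withDensity fun p => ENNReal.ofReal (areaDensity ψ p)) :=
  (h.continuousOn.aemeasurable h.isOpen.measurableSet).mono_ac
    (withDensity_absolutelyContinuous _ _)

theorem paramMeasure_apply (h : IsLocalParametrization A U ψ) {B : Set (StepTwoGroup S)}
    (hB : MeasurableSet B) :
    paramMeasure U ψ B = ∫⁻ p in ψ ⁻¹' B ∩ U, ENNReal.ofReal (areaDensity ψ p) := by
  rw [paramMeasure, Measure.map_apply_of_aemeasurable h.aemeasurable hB, withDensity_apply',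
    Measure.restrict_restrict' h.isOpen.measurableSet]

theorem hasFDerivAt (h : IsLocalParametrization A U ψ) {p : EuclideanSpace ℝ (Fin n)}
    (hp : p ∈ U) : HasFDerivAt (fun q => (ψ q).log) (fderiv ℝ (fun q => (ψ q).log) p) p :=
  ((h.contDiffOn.contDiffAt (h.isOpen.mem_nhds hp)).differentiableAt one_ne_zero).hasFDerivAt

theorem paramMeasure_le_surfaceMeasure
    {U : Set (ParamSpace 𝔤)} {ψ : ParamSpace 𝔤 → StepTwoGroup S}
    (h : IsLocalParametrization A U ψ) : paramMeasure U ψ ≤ surfaceMeasure A :=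
  le_sSup ⟨U, ψ, h, rfl⟩

end IsLocalParametrization

theorem surfaceMeasure_le {A : Set (StepTwoGroup S)} {μ : Measure (StepTwoGroup S)}
    (h : ∀ (U : Set (ParamSpace 𝔤)) (ψ : ParamSpace 𝔤 → StepTwoGroup S),
      IsLocalParametrization A U ψ → paramMeasure U ψ ≤ μ) : surfaceMeasure A ≤ μ := by
  refine sSup_le ?_
  rintro _ ⟨U, ψ, hψ, rfl⟩
  exact h U ψ hψ

theorem surfaceMeasure_restrict {A : Set (StepTwoGroup S)} (hA : MeasurableSet A) :
    (surfaceMeasure A).restrict A = surfaceMeasure A := by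
  refine le_antisymm Measure.restrict_le_self (surfaceMeasure_le fun U ψ hψ => ?_)
  refine Measure.le_iff.2 fun E hE => ?_
  have h1 : paramMeasure U ψ E = paramMeasure U ψ (E ∩ A) := by
    rw [hψ.paramMeasure_apply hE, hψ.paramMeasure_apply (hE.inter hA)]
    congr 2
    ext p
    simp only [Set.mem_inter_iff, Set.mem_preimage]
    exact ⟨fun h => ⟨⟨h.1, hψ.mapsTo h.2⟩, h.2⟩, fun h => ⟨h.1.1, h.2⟩⟩
  rw [h1, Measure.restrict_apply hE]
  exact hψ.paramMeasure_le_surfaceMeasure _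

namespace BoundaryChart

variable {Ω : Set (StepTwoGroup S)} (c : BoundaryChart Ω)

/-- The domain of the chart, as a set of points of the group. -/
def patch : Set (StepTwoGroup S) := log ⁻¹' c.toChart.source

theorem isOpen_patch : IsOpen c.patch := c.toChart.open_source.preimage continuous_log

theorem measurableSet_patch : MeasurableSet c.patch := c.isOpen_patch.measurableSet

theorem param_mem_patch {p : ParamSpace 𝔤} (hp : p ∈ c.paramDomain) : c.param p ∈ c.patch :=
  c.coordParam_mem_source hp

/-- Any parametrization of the boundary is, in the domain of the chart, a reparametrization of
the one given by the chart. -/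
theorem paramMeasure_le (hΩ : IsOpen Ω) {U : Set (ParamSpace 𝔤)}
    {ψ : ParamSpace 𝔤 → StepTwoGroup S} (hψ : IsLocalParametrization (frontier Ω) U ψ)
    {B : Set (StepTwoGroup S)} (hB : MeasurableSet B) (hBc : B ⊆ c.patch) :
    paramMeasure U ψ B ≤ paramMeasure c.paramDomain c.param B := by
  rw [hψ.paramMeasure_apply hB, (c.isLocalParametrization hΩ).paramMeasure_apply hB]
  set s := ψ ⁻¹' B ∩ U with hs
  have hsm : MeasurableSet s :=
    measurableSet_preimage_inter_of_continuousOn hψ.continuousOn hψ.isOpen.measurableSet hB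
  -- The transition map from the given parametrization to the one of the chart.
  let θ : ParamSpace 𝔤 → ParamSpace 𝔤 := fun q => (c.toChart (ψ q).log).1
  have hkey : ∀ q ∈ U, ψ q ∈ c.patch → θ q ∈ c.paramDomain ∧ c.coordParam (θ q) = (ψ q).log :=
    fun q hq hqc => c.coordParam_fst hqc ((c.mem_frontier_iff hΩ hqc).1 (hψ.mapsTo hq))
  have hparam : ∀ q ∈ s, θ q ∈ c.paramDomain ∧ c.param (θ q) = ψ q := fun q hq => by
    obtain ⟨h1, h2⟩ := hkey q hq.2 (hBc hq.1)
    exact ⟨h1, StepTwoGroup.ext h2⟩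
  have hθ : ∀ q ∈ s, HasFDerivAt θ (fderiv ℝ θ q) q := fun q hq => by
    have h1 := (c.hasFDerivAt (hBc hq.1)).comp q (hψ.hasFDerivAt hq.2)
    have h2 := (ContinuousLinearMap.fst ℝ (ParamSpace 𝔤) ℝ).hasFDerivAt.comp q h1
    exact h2.differentiableAt.hasFDerivAt
  have hinj : Set.InjOn θ s := by
    intro p hp q hq hpq
    have h1 := (hparam p hp).2
    rw [hpq, (hparam q hq).2] at h1
    exact (hψ.injOn hq.2 hp.2 h1).symm
  have hdens : ∀ q ∈ s, ENNReal.ofReal (areaDensity ψ q)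
      = ENNReal.ofReal |(fderiv ℝ θ q).det| * ENNReal.ofReal (areaDensity c.param (θ q)) := by
    intro q hq
    obtain ⟨h1, h2⟩ := hparam q hq
    have hev : (fun q => (ψ q).log) =ᶠ[𝓝 q] fun q => c.coordParam (θ q) := by
      have hco : ContinuousAt ψ q := hψ.continuousOn.continuousAt (hψ.isOpen.mem_nhds hq.2)
      filter_upwards [hψ.isOpen.mem_nhds hq.2, hco (c.isOpen_patch.mem_nhds (hBc hq.1))]
        with r hr hrc using (hkey r hr hrc).2.symm
    have hd := ((c.hasFDerivAt_coordParam h1).comp q (hθ q hq)).congr_of_eventuallyEq hev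
    have h3 : leftDifferential ψ q = leftDifferential c.param (θ q) ∘L fderiv ℝ θ q := by
      rw [leftDifferential_eq hd, c.leftDifferential_param h1, ← h2]
      rfl
    have h4 := det_gram_comp (leftDifferential c.param (θ q)) (fderiv ℝ θ q)
    rw [← ENNReal.ofReal_mul (abs_nonneg _)]
    congr 1
    rw [areaDensity, h3]
    simp only [ContinuousLinearMap.comp_apply]
    rw [h4, mul_comm, Real.sqrt_mul (sq_nonneg _), Real.sqrt_sq_eq_abs]
    rfl
  rw [setLIntegral_congr_fun hsm hdens,
    ← lintegral_image_eq_lintegral_abs_det_fderiv_mul volume hsm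
      (fun q hq => (hθ q hq).hasFDerivWithinAt) hinj
      (fun p => ENNReal.ofReal (areaDensity c.param p))]
  -- Only an inequality results, since the image of `ψ` need not cover the whole boundary piece in
  -- the chart.
  refine lintegral_mono_set ?_
  rintro _ ⟨q, hq, rfl⟩
  obtain ⟨h1, h2⟩ := hparam q hq
  refine ⟨?_, h1⟩
  rw [Set.mem_preimage, h2]
  exact hq.1

/-- In the domain of a chart the surface measure is given by the chart. -/
theorem surfaceMeasure_restrict_patch (hΩ : IsOpen Ω) :
    (surfaceMeasure (frontier Ω)).restrict c.patch = paramMeasure c.paramDomain c.param := by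
  have hloc := c.isLocalParametrization hΩ
  -- A competitor for the supremum: the chart measure inside the patch, the surface measure itself
  -- outside. It dominates every parametrization, hence also the supremum.
  have hle : surfaceMeasure (frontier Ω) ≤ paramMeasure c.paramDomain c.param +
      (surfaceMeasure (frontier Ω)).restrict c.patchᶜ := by
    refine surfaceMeasure_le fun U ψ hψ => Measure.le_iff.2 fun E hE => ?_
    rw [← measure_inter_add_sdiff E c.measurableSet_patch, Measure.add_apply]
    refine add_le_add ?_ ?_
    · exact (c.paramMeasure_le hΩ hψ (hE.inter c.measurableSet_patch) Set.inter_subset_right).trans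
        (measure_mono Set.inter_subset_left)
    · rw [Measure.restrict_apply hE]
      exact hψ.paramMeasure_le_surfaceMeasure _
  refine le_antisymm (Measure.le_iff.2 fun E hE => ?_) (Measure.le_iff.2 fun E hE => ?_)
  · rw [Measure.restrict_apply hE]
    refine (hle _).trans ?_
    rw [Measure.add_apply, Measure.restrict_apply (hE.inter c.measurableSet_patch),
      Set.inter_assoc, Set.inter_compl_self, Set.inter_empty, measure_empty, add_zero]
    exact measure_mono Set.inter_subset_left
  · have h1 : paramMeasure c.paramDomain c.param E
        = paramMeasure c.paramDomain c.param (E ∩ c.patch) := by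
      rw [hloc.paramMeasure_apply hE, hloc.paramMeasure_apply (hE.inter c.measurableSet_patch)]
      congr 2
      ext p
      simp only [Set.mem_inter_iff, Set.mem_preimage]
      exact ⟨fun h => ⟨⟨h.1, c.param_mem_patch h.2⟩, h.2⟩, fun h => ⟨h.1.1, h.2⟩⟩
    rw [h1, Measure.restrict_apply hE]
    exact hloc.paramMeasure_le_surfaceMeasure _

end BoundaryChart

end SurfaceMeasure

end Carnot

namespace Carnot

open StepTwoGroup

/-! ### Continuity of the normal and finiteness of the surface measure. -/

section Boundary

variable {𝔤 : Type*} [EuclideanLieAlgebra 𝔤] {S : StepTwoStratification 𝔤}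
  {Ω : Set (StepTwoGroup S)}

namespace BoundaryChart

variable (c : BoundaryChart Ω)

theorem riemannianGradient_height {g : StepTwoGroup S} (hg : g ∈ c.patch) :
    riemannianGradient c.height g = (InnerProductSpace.toDual ℝ 𝔤).symm
      ((ContinuousLinearMap.snd ℝ _ ℝ ∘L fderiv ℝ c.toChart g.log) ∘L frame g.log) := by
  rw [riemannianGradient, gradient, (hasFDerivAt_comp_mul_exp (c.hasFDerivAt_height hg)).fderiv]

theorem continuousOn_riemannianGradient_height :
    ContinuousOn (riemannianGradient c.height) c.patch := by
  have h1 : ContinuousOn (fderiv ℝ c.toChart) c.toChart.source :=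
    c.contDiffOn.continuousOn_fderiv_of_isOpen c.toChart.open_source (by norm_num)
  have h2 : ContinuousOn (fun ξ : 𝔤 => (InnerProductSpace.toDual ℝ 𝔤).symm
      ((ContinuousLinearMap.snd ℝ _ ℝ ∘L fderiv ℝ c.toChart ξ) ∘L frame ξ)) c.toChart.source :=
    (InnerProductSpace.toDual ℝ 𝔤).symm.continuous.comp_continuousOn
      ((continuousOn_const.clm_comp h1).clm_comp continuous_frame.continuousOn)
  exact (h2.comp continuous_log.continuousOn fun g hg => hg).congr
    fun g hg => c.riemannianGradient_height hg

theorem outerNormal_eq {g : StepTwoGroup S} (hg : g ∈ c.patch) (hgf : g ∈ frontier Ω) :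
    outerNormal Ω g = ‖riemannianGradient c.height g‖⁻¹ • riemannianGradient c.height g :=
  (c.isLocalDefiningFunction hg hgf).outerNormal_eq

theorem continuousOn_areaDensity : ContinuousOn (areaDensity c.param) c.paramDomain := by
  borelize 𝔤
  obtain ⟨J, -, hJ⟩ := S.exists_volumeChart
  have h0 : ContinuousOn c.param c.paramDomain :=
    continuous_exp.comp_continuousOn c.contDiffOn_coordParam.continuousOn
  have h1 : ContinuousOn (fun p => ‖riemannianGradient c.height (c.param p)‖) c.paramDomain :=
    (c.continuousOn_riemannianGradient_height.comp h0 fun p hp => c.param_mem_patch hp).norm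
  have h2 : ContinuousOn (fderiv ℝ c.toChart.symm) c.toChart.target :=
    c.contDiffOn_symm.continuousOn_fderiv_of_isOpen c.toChart.open_target (by norm_num)
  have h3 : ContinuousOn (fun p : ParamSpace 𝔤 => fderiv ℝ c.toChart.symm (p, 0)) c.paramDomain :=
    h2.comp (by fun_prop) fun p hp => hp
  have h4 : ContinuousOn (fun p : ParamSpace 𝔤 =>
      |((J.symm : 𝔤 →L[ℝ] ParamSpace 𝔤 × ℝ) ∘L fderiv ℝ c.toChart.symm (p, 0)).det|)
      c.paramDomain :=
    (ContinuousLinearMap.continuous_det.comp_continuousOn (continuousOn_const.clm_comp h3)).abs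
  exact (h1.mul h4).congr fun p hp => c.areaDensity_param J hJ hp

end BoundaryChart

theorem IsC2BoundedOpen.exists_chart (hΩ : IsC2BoundedOpen Ω) {g : StepTwoGroup S}
    (hg : g ∈ frontier Ω) : ∃ c : BoundaryChart Ω, g ∈ c.patch := by
  obtain ⟨φ, hφ⟩ := hΩ.exists_defining g hg
  exact hφ.exists_boundaryChart

theorem IsC2BoundedOpen.norm_outerNormal (hΩ : IsC2BoundedOpen Ω) {g : StepTwoGroup S}
    (hg : g ∈ frontier Ω) : ‖outerNormal Ω g‖ = 1 := by
  obtain ⟨φ, hφ⟩ := hΩ.exists_defining g hg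
  exact hφ.norm_outerNormal

theorem IsC2BoundedOpen.continuousOn_outerNormal (hΩ : IsC2BoundedOpen Ω) :
    ContinuousOn (outerNormal Ω) (frontier Ω) := by
  intro g hg
  obtain ⟨c, hc⟩ := hΩ.exists_chart hg
  have h1 : ContinuousOn (fun g => ‖riemannianGradient c.height g‖⁻¹ •
      riemannianGradient c.height g) (c.patch ∩ frontier Ω) := by
    have h2 := c.continuousOn_riemannianGradient_height.mono
      (Set.inter_subset_left (t := frontier Ω))
    exact (h2.norm.inv₀ fun x hx => norm_ne_zero_iff.2
      (c.isLocalDefiningFunction hx.1 hx.2).riemannianGradient_ne_zero).smul h2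
  have h3 : ContinuousOn (outerNormal Ω) (c.patch ∩ frontier Ω) :=
    h1.congr fun x hx => c.outerNormal_eq hx.1 hx.2
  have h4 := h3 g ⟨hc, hg⟩
  rw [Set.inter_comm] at h4
  exact (continuousWithinAt_inter (c.isOpen_patch.mem_nhds hc)).1 h4

theorem IsC2BoundedOpen.isCompact_coord_closure (hΩ : IsC2BoundedOpen Ω) :
    IsCompact (exp ⁻¹' closure Ω : Set 𝔤) := by
  rw [exp_preimage_closure]
  have h1 : (exp ⁻¹' Ω : Set 𝔤) = log '' Ω := by
    ext ξ
    exact ⟨fun h => ⟨exp ξ, h, rfl⟩, by rintro ⟨g, hg, rfl⟩; exact hg⟩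
  rw [h1]
  exact hΩ.isBounded.isCompact_closure

theorem IsC2BoundedOpen.isCompact_closure (hΩ : IsC2BoundedOpen Ω) : IsCompact (closure Ω) :=
  (expHomeomorph S).isCompact_preimage.1 hΩ.isCompact_coord_closure

theorem IsC2BoundedOpen.isCompact_frontier (hΩ : IsC2BoundedOpen Ω) : IsCompact (frontier Ω) :=
  hΩ.isCompact_closure.of_isClosed_subset isClosed_frontier frontier_subset_closure

/-- The boundary is compact, so local finiteness suffices. In a chart it follows by integrating the
continuous area density over a closed ball of parameters. -/
theorem IsC2BoundedOpen.isFiniteMeasure_surfaceMeasure (hΩ : IsC2BoundedOpen Ω) :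
    IsFiniteMeasure (surfaceMeasure (frontier Ω)) := by
  have hfin : surfaceMeasure (frontier Ω) (frontier Ω) < ⊤ := by
    refine hΩ.isCompact_frontier.measure_lt_top_of_nhdsWithin fun g hg => ?_
    obtain ⟨c, hc⟩ := hΩ.exists_chart hg
    have hp := c.coordParam_fst hc ((c.mem_frontier_iff hΩ.isOpen hc).1 hg)
    obtain ⟨r, hr, hball⟩ := Metric.nhds_basis_closedBall.mem_iff.1
      (c.isOpen_paramDomain.mem_nhds hp.1)
    set p₀ := (c.toChart g.log).1
    let N : Set (StepTwoGroup S) := c.patch ∩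
      {h | (c.toChart h.log).1 ∈ Metric.ball p₀ r}
    have hcont : ContinuousOn (fun h : StepTwoGroup S => (c.toChart h.log).1) c.patch :=
      continuous_fst.comp_continuousOn
        (c.toChart.continuousOn.comp continuous_log.continuousOn fun _ hh => hh)
    have hN : IsOpen N := hcont.isOpen_inter_preimage c.isOpen_patch Metric.isOpen_ball
    refine ⟨N, mem_nhdsWithin_of_mem_nhds (hN.mem_nhds ⟨hc, Metric.mem_ball_self hr⟩), ?_⟩
    have h1 : surfaceMeasure (frontier Ω) N = paramMeasure c.paramDomain c.param N := by
      rw [← c.surfaceMeasure_restrict_patch hΩ.isOpen, Measure.restrict_apply hN.measurableSet,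
        Set.inter_eq_self_of_subset_left Set.inter_subset_left]
    rw [h1, (c.isLocalParametrization hΩ.isOpen).paramMeasure_apply hN.measurableSet]
    have hsub : c.param ⁻¹' N ∩ c.paramDomain ⊆ Metric.closedBall p₀ r := by
      intro p hp
      have h2 : (c.toChart (c.coordParam p)).1 ∈ Metric.ball p₀ r := hp.1.2
      rw [c.toChart_coordParam hp.2] at h2
      exact Metric.ball_subset_closedBall h2
    refine (lintegral_mono_set hsub).trans_lt ?_
    have h3 : IntegrableOn (areaDensity c.param) (Metric.closedBall p₀ r) :=
      (c.continuousOn_areaDensity.mono hball).integrableOn_compact (isCompact_closedBall p₀ r)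
    exact h3.lintegral_lt_top
  refine ⟨?_⟩
  rwa [← surfaceMeasure_restrict isClosed_frontier.measurableSet,
    Measure.restrict_apply_univ]

theorem IsC2BoundedOpen.integrable_surfaceMeasure (hΩ : IsC2BoundedOpen Ω)
    {F : StepTwoGroup S → ℝ} (hF : ContinuousOn F (frontier Ω)) :
    Integrable F (surfaceMeasure (frontier Ω)) := by
  have := hΩ.isFiniteMeasure_surfaceMeasure
  rw [← surfaceMeasure_restrict isClosed_frontier.measurableSet]
  obtain ⟨C, hC⟩ := hΩ.isCompact_frontier.exists_bound_of_continuousOn hF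
  exact IntegrableOn.of_bound (measure_lt_top _ _)
    (hF.aestronglyMeasurable isClosed_frontier.measurableSet) C
    ((ae_restrict_iff' isClosed_frontier.measurableSet).2 (Eventually.of_forall hC))

end Boundary

end Carnot

namespace Carnot

/-! ### Concentration of a boundary layer on a hyperplane. -/

section Layer

/-- A smooth function that vanishes for `t ≤ 1` and equals `1` for `t ≥ 2`. -/
noncomputable def cutoff (t : ℝ) : ℝ := Real.smoothTransition (t - 1)

theorem contDiff_cutoff : ContDiff ℝ 2 cutoff :=
  Real.smoothTransition.contDiff.comp (contDiff_id.sub contDiff_const)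

theorem cutoff_eq_zero {t : ℝ} (ht : t ≤ 1) : cutoff t = 0 :=
  Real.smoothTransition.zero_of_nonpos (by linarith)

theorem cutoff_eq_one {t : ℝ} (ht : 2 ≤ t) : cutoff t = 1 :=
  Real.smoothTransition.one_of_one_le (by linarith)

theorem abs_cutoff_le_one (t : ℝ) : |cutoff t| ≤ 1 := by
  unfold cutoff
  rw [abs_of_nonneg (Real.smoothTransition.nonneg _)]
  exact Real.smoothTransition.le_one _

theorem hasDerivAt_cutoff (t : ℝ) : HasDerivAt cutoff (deriv cutoff t) t :=
  (contDiff_cutoff.differentiable two_ne_zero t).hasDerivAt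

theorem continuous_deriv_cutoff : Continuous (deriv cutoff) :=
  contDiff_cutoff.continuous_deriv (by norm_num)

theorem deriv_cutoff_eq_zero_of_lt {t : ℝ} (ht : t < 1) : deriv cutoff t = 0 := by
  have : cutoff =ᶠ[𝓝 t] fun _ => 0 := by
    filter_upwards [gt_mem_nhds ht] with s hs using cutoff_eq_zero hs.le
  rw [this.deriv_eq, deriv_const]

theorem deriv_cutoff_eq_zero_of_gt {t : ℝ} (ht : 2 < t) : deriv cutoff t = 0 := by
  have : cutoff =ᶠ[𝓝 t] fun _ => 1 := by
    filter_upwards [lt_mem_nhds ht] with s hs using cutoff_eq_one (le_of_lt hs)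
  rw [this.deriv_eq, deriv_const]

theorem hasCompactSupport_deriv_cutoff : HasCompactSupport (deriv cutoff) := by
  refine HasCompactSupport.intro (isCompact_Icc (a := (1 : ℝ)) (b := 2)) fun t ht => ?_
  rw [Set.mem_Icc, not_and_or, not_le, not_le] at ht
  exact ht.elim deriv_cutoff_eq_zero_of_lt deriv_cutoff_eq_zero_of_gt

theorem integrable_deriv_cutoff : Integrable (deriv cutoff) :=
  continuous_deriv_cutoff.integrable_of_hasCompactSupport hasCompactSupport_deriv_cutoff

theorem integral_deriv_cutoff : ∫ t, deriv cutoff t = 1 := by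
  have h := integral_of_hasDerivAt_of_tendsto hasDerivAt_cutoff integrable_deriv_cutoff
    (m := 0) (n := 1)
    (tendsto_const_nhds.congr' (by
      filter_upwards [eventually_le_atBot (1 : ℝ)] with t ht using (cutoff_eq_zero ht).symm))
    (tendsto_const_nhds.congr' (by
      filter_upwards [eventually_ge_atTop (2 : ℝ)] with t ht using (cutoff_eq_one ht).symm))
  simpa using h

/-- Integration against the derivative of the cutoff of a half space, at scale `ε`, converges to
integration over the boundary hyperplane. -/
theorem tendsto_integral_boundary_layer {n : ℕ} {Q : EuclideanSpace ℝ (Fin n) × ℝ → ℝ}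
    {C : Set (EuclideanSpace ℝ (Fin n) × ℝ)} (hC : IsCompact C) (hQ0 : ∀ y, y ∉ C → Q y = 0)
    (hQ : ContinuousOn Q {y | y.2 ≤ 0}) :
    Tendsto (fun ε : ℝ => ∫ y, ε⁻¹ * deriv cutoff (-y.2 / ε) * Q y) (𝓝[>] 0)
      (𝓝 (∫ p, Q (p, 0))) := by
  obtain ⟨M, hM⟩ : ∃ M, ∀ y : EuclideanSpace ℝ (Fin n) × ℝ, y.2 ≤ 0 → ‖Q y‖ ≤ M := by
    have hcl : IsClosed {y : EuclideanSpace ℝ (Fin n) × ℝ | y.2 ≤ 0} :=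
      isClosed_le continuous_snd continuous_const
    obtain ⟨M, hM⟩ := (hC.inter_right hcl).exists_bound_of_continuousOn
      (hQ.mono Set.inter_subset_right)
    refine ⟨max M 0, fun y hy => ?_⟩
    by_cases hyC : y ∈ C
    · exact (hM y ⟨hyC, hy⟩).trans (le_max_left _ _)
    · rw [hQ0 y hyC, norm_zero]; exact le_max_right _ _
  have hint : ∀ ε : ℝ, 0 < ε →
      Integrable fun y : EuclideanSpace ℝ (Fin n) × ℝ => ε⁻¹ * deriv cutoff (-y.2 / ε) * Q y := by
    intro ε hε
    refine Continuous.integrable_of_hasCompactSupport ?_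
      (HasCompactSupport.intro hC fun y hy => by rw [hQ0 y hy, mul_zero])
    rw [continuous_iff_continuousAt]
    intro y
    -- `Q` is controlled only in the closed lower half-space. This is harmless because the kernel
    -- vanishes for `y.2 > -ε`, that is, where the argument of the cutoff derivative is below `1`.
    rcases lt_or_ge y.2 0 with hy | hy
    · have h1 : ContinuousAt Q y := hQ.continuousAt (by
        filter_upwards [(isOpen_lt continuous_snd continuous_const).mem_nhds hy] with z hz
          using le_of_lt hz)
      have h2 : Continuous fun y : EuclideanSpace ℝ (Fin n) × ℝ =>
          ε⁻¹ * deriv cutoff (-y.2 / ε) :=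
        continuous_const.mul (continuous_deriv_cutoff.comp (by fun_prop))
      exact h2.continuousAt.mul h1
    · refine (continuousAt_const (y := (0 : ℝ))).congr ?_
      have : ∀ᶠ z : EuclideanSpace ℝ (Fin n) × ℝ in 𝓝 y, -ε < z.2 :=
        (isOpen_lt continuous_const continuous_snd).mem_nhds (by
          change -ε < y.2; linarith)
      filter_upwards [this] with z hz
      rw [deriv_cutoff_eq_zero_of_lt, mul_zero, zero_mul]
      rw [div_lt_one hε]; linarith
  -- The substitution `s = -ε t` removes `ε` from the kernel, which has integral `1`, and leaves it
  -- only in the argument of `Q`.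
  have hinner : ∀ ε : ℝ, 0 < ε → ∀ p : EuclideanSpace ℝ (Fin n),
      ∫ s, ε⁻¹ * deriv cutoff (-s / ε) * Q (p, s) = ∫ t, deriv cutoff t * Q (p, -ε * t) := by
    intro ε hε p
    have h1 := Measure.integral_comp_mul_left
      (fun s => ε⁻¹ * deriv cutoff (-s / ε) * Q (p, s)) (-ε)
    have h2 : ∀ t : ℝ, -(-ε * t) / ε = t := fun t => by field_simp
    simp only [h2] at h1
    rw [abs_inv, abs_neg, abs_of_pos hε, smul_eq_mul] at h1
    have h3 : (fun t => ε⁻¹ * deriv cutoff t * Q (p, -ε * t))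
        = fun t => ε⁻¹ * (deriv cutoff t * Q (p, -ε * t)) := by funext t; ring
    rw [h3, integral_const_mul] at h1
    exact (mul_left_cancel₀ (inv_ne_zero hε.ne') h1).symm
  have hptbd : ∀ ε : ℝ, 0 < ε → ∀ p t,
      ‖deriv cutoff t * Q (p, -ε * t)‖ ≤ |deriv cutoff t| * M := by
    intro ε hε p t
    rcases lt_or_ge t 1 with ht | ht
    · rw [deriv_cutoff_eq_zero_of_lt ht]; simp
    · rw [norm_mul, Real.norm_eq_abs]
      exact mul_le_mul_of_nonneg_left (hM _ (by
        change -ε * t ≤ 0; nlinarith)) (abs_nonneg _)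
  have hmeas : ∀ ε : ℝ, 0 < ε → ∀ p,
      AEStronglyMeasurable (fun t => deriv cutoff t * Q (p, -ε * t)) volume := by
    intro ε hε p
    have hc : Continuous fun t : ℝ => deriv cutoff t * Q (p, -ε * t) := by
      rw [continuous_iff_continuousAt]
      intro t
      rcases lt_or_ge 0 t with ht | ht
      · have h1 : ContinuousAt Q (p, -ε * t) := hQ.continuousAt (by
          filter_upwards [(isOpen_lt continuous_snd continuous_const).mem_nhds
            (show ((p, -ε * t) : EuclideanSpace ℝ (Fin n) × ℝ).2 < 0 by
              change -ε * t < 0; nlinarith)] with z hz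
            using le_of_lt hz)
        exact continuous_deriv_cutoff.continuousAt.mul
          (ContinuousAt.comp (f := fun t : ℝ => (p, -ε * t)) h1 (by fun_prop))
      · refine (continuousAt_const (y := (0 : ℝ))).congr ?_
        filter_upwards [gt_mem_nhds (show t < 1 by linarith)] with s hs
        rw [deriv_cutoff_eq_zero_of_lt hs, zero_mul]
    exact hc.aestronglyMeasurable
  have hbdint : Integrable fun t => |deriv cutoff t| * M :=
    (integrable_deriv_cutoff.abs).mul_const M
  have hpt : ∀ p : EuclideanSpace ℝ (Fin n),
      Tendsto (fun ε : ℝ => ∫ t, deriv cutoff t * Q (p, -ε * t)) (𝓝[>] 0) (𝓝 (Q (p, 0))) := by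
    intro p
    have hlim : ∫ t, deriv cutoff t * Q (p, 0) = Q (p, 0) := by
      rw [integral_mul_const, integral_deriv_cutoff, one_mul]
    rw [← hlim]
    refine tendsto_integral_filter_of_dominated_convergence (fun t => |deriv cutoff t| * M) ?_ ?_
      hbdint (Eventually.of_forall fun t => ?_)
    · filter_upwards [self_mem_nhdsWithin] with ε hε using hmeas ε hε p
    · filter_upwards [self_mem_nhdsWithin] with ε hε
      exact Eventually.of_forall fun t => hptbd ε hε p t
    · rcases lt_or_ge t 1 with ht | ht
      · rw [deriv_cutoff_eq_zero_of_lt ht]; simp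
      · refine Tendsto.const_mul _ ?_
        have h1 : ContinuousWithinAt Q {y | y.2 ≤ 0} (p, 0) :=
          hQ (p, 0) (le_refl (0 : ℝ))
        refine Tendsto.comp h1 (tendsto_nhdsWithin_iff.2 ⟨?_, ?_⟩)
        · have : Continuous fun ε : ℝ => ((p, -ε * t) : EuclideanSpace ℝ (Fin n) × ℝ) := by
            fun_prop
          simpa using (this.tendsto 0).mono_left nhdsWithin_le_nhds
        · filter_upwards [self_mem_nhdsWithin] with ε hε
          have hε' : (0 : ℝ) < ε := hε
          change -ε * t ≤ 0
          nlinarith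
  have hfub : ∀ ε : ℝ, 0 < ε → ∫ y, ε⁻¹ * deriv cutoff (-y.2 / ε) * Q y
      = ∫ p, ∫ t, deriv cutoff t * Q (p, -ε * t) := by
    intro ε hε
    rw [Measure.volume_eq_prod, integral_prod _ (hint ε hε)]
    exact integral_congr_ae (Eventually.of_forall fun p => hinner ε hε p)
  refine Tendsto.congr' (f₁ := fun ε : ℝ => ∫ p, ∫ t, deriv cutoff t * Q (p, -ε * t)) ?_ ?_
  · filter_upwards [self_mem_nhdsWithin] with ε hε using (hfub ε hε).symm
  · have hC' : IsCompact (Prod.fst '' C) := hC.image continuous_fst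
    refine tendsto_integral_filter_of_dominated_convergence
      ((Prod.fst '' C).indicator fun _ => ∫ t, |deriv cutoff t| * M) ?_ ?_ ?_
      (Eventually.of_forall hpt)
    · filter_upwards [self_mem_nhdsWithin] with ε hε
      have h1 := (hint ε hε)
      rw [Measure.volume_eq_prod] at h1
      refine h1.integral_prod_left.aestronglyMeasurable.congr ?_
      exact Eventually.of_forall fun p => hinner ε hε p
    · filter_upwards [self_mem_nhdsWithin] with ε hε
      refine Eventually.of_forall fun p => ?_
      by_cases hp : p ∈ Prod.fst '' C
      · rw [Set.indicator_of_mem hp]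
        exact norm_integral_le_of_norm_le hbdint (Eventually.of_forall fun t => hptbd ε hε p t)
      · rw [Set.indicator_of_notMem hp]
        have : (fun t => deriv cutoff t * Q (p, -ε * t)) = fun _ => 0 := by
          funext t
          rw [hQ0 _ fun hm => hp ⟨_, hm, rfl⟩, mul_zero]
        rw [this]; simp
    · exact (integrable_indicator_iff hC'.measurableSet).2
        (integrableOn_const hC'.measure_lt_top.ne)

end Layer

end Carnot

namespace Carnot

open StepTwoGroup

/-! ### The divergence theorem in a boundary chart. -/

namespace BoundaryChart

variable {𝔤 : Type*} [EuclideanLieAlgebra 𝔤] {S : StepTwoStratification 𝔤}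
  {Ω : Set (StepTwoGroup S)} (c : BoundaryChart Ω)

/-- The function `χ`, cut off in a layer of width `ε` at the boundary. -/
noncomputable def layered (χ : 𝔤 → ℝ) (ε : ℝ) (ξ : 𝔤) : ℝ :=
  χ ξ * cutoff (-(c.toChart ξ).2 / ε)

variable {χ : 𝔤 → ℝ} {ε : ℝ}

theorem contDiff_layered {n : ℕ} (hn : n ≤ 2) (hχ : ContDiff ℝ n χ)
    (hχs : tsupport χ ⊆ c.toChart.source) (ε : ℝ) : ContDiff ℝ n (c.layered χ ε) := by
  have hn' : (n : WithTop ℕ∞) ≤ 2 := by exact_mod_cast hn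
  rw [contDiff_iff_contDiffAt]
  intro ξ
  by_cases hξ : ξ ∈ tsupport χ
  · have h1 : ContDiffAt ℝ n (fun ζ => (c.toChart ζ).2) ξ :=
      contDiffAt_snd.comp ξ ((c.contDiffAt (hχs hξ)).of_le hn')
    exact hχ.contDiffAt.mul
      ((contDiff_cutoff.of_le hn').contDiffAt.comp ξ (h1.neg.div_const ε))
  · refine (contDiffAt_const (c := (0 : ℝ))).congr_of_eventuallyEq ?_
    filter_upwards [(isClosed_tsupport χ).isOpen_compl.mem_nhds hξ] with ζ hζ
    rw [layered, image_eq_zero_of_notMem_tsupport hζ, zero_mul]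

theorem tsupport_layered_subset (χ : 𝔤 → ℝ) (ε : ℝ) : tsupport (c.layered χ ε) ⊆ tsupport χ :=
  closure_mono fun ξ hξ h0 => hξ (by rw [layered, h0, zero_mul])

/-- The cutoff vanishes as soon as the height exceeds `-ε`, so the support keeps away from the
boundary and interior integration by parts is available. -/
theorem tsupport_layered_subset_preimage (hχs : tsupport χ ⊆ c.toChart.source) (hε : 0 < ε) :
    tsupport (c.layered χ ε) ⊆ exp ⁻¹' Ω := by
  intro ξ hξ
  have hs : ξ ∈ c.toChart.source := hχs (c.tsupport_layered_subset χ ε hξ)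
  refine (c.mem_iff ξ hs).2 ?_
  by_contra! hge
  have hc : ContinuousAt (fun ζ => (c.toChart ζ).2) ξ :=
    continuous_snd.continuousAt.comp (c.toChart.continuousAt hs)
  rw [tsupport, mem_closure_iff_frequently] at hξ
  obtain ⟨ζ, h1, h2⟩ := (hξ.and_eventually
    (hc.eventually (lt_mem_nhds (show -ε < (c.toChart ξ).2 by linarith)))).exists
  refine h1 ?_
  rw [layered, cutoff_eq_zero, mul_zero]
  rw [div_le_one hε]; linarith

/-- Of the two terms of the product rule, the first converges to the interior contribution; the
second is the boundary layer, weighted by the derivative of the height along `X`. -/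
theorem coordDeriv_layered (X : 𝔤) (hχ : ContDiff ℝ 1 χ) (hχs : tsupport χ ⊆ c.toChart.source)
    (ε : ℝ) (ξ : 𝔤) :
    coordDeriv X (c.layered χ ε) ξ = c.layered (coordDeriv X χ) ε ξ
      - ε⁻¹ * deriv cutoff (-(c.toChart ξ).2 / ε)
        * (χ ξ * (fderiv ℝ c.toChart ξ (frame ξ X)).2) := by
  by_cases hξ : ξ ∈ tsupport χ
  · have h1 : HasFDerivAt (fun ζ => (c.toChart ζ).2)
        (ContinuousLinearMap.snd ℝ _ ℝ ∘L fderiv ℝ c.toChart ξ) ξ :=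
      c.hasFDerivAt_height (hχs hξ)
    have h2 : HasFDerivAt (fun ζ => -(c.toChart ζ).2 / ε)
        (ε⁻¹ • -(ContinuousLinearMap.snd ℝ _ ℝ ∘L fderiv ℝ c.toChart ξ)) ξ := by
      have := h1.neg.const_mul ε⁻¹
      refine this.congr_of_eventuallyEq (Eventually.of_forall fun ζ => ?_)
      simp [div_eq_inv_mul]
    have h3 := (hasDerivAt_cutoff (-(c.toChart ξ).2 / ε)).comp_hasFDerivAt ξ h2
    have h4 := (hχ.differentiable one_ne_zero ξ).hasFDerivAt.mul h3
    have h5 : HasFDerivAt (c.layered χ ε) _ ξ := h4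
    rw [coordDeriv, h5.fderiv, layered, coordDeriv]
    simp
    ring
  · have h1 : coordDeriv X (c.layered χ ε) ξ = 0 := image_eq_zero_of_notMem_tsupport
      fun h => hξ (c.tsupport_layered_subset χ ε (tsupport_coordDeriv_subset X _ h))
    have h2 : coordDeriv X χ ξ = 0 := image_eq_zero_of_notMem_tsupport
      fun h => hξ (tsupport_coordDeriv_subset X _ h)
    rw [h1, layered, h2, image_eq_zero_of_notMem_tsupport hξ]
    ring

variable [MeasurableSpace 𝔤] [BorelSpace 𝔤]

theorem integrable_layered_mul (hΩ : IsOpen Ω) {f : 𝔤 → ℝ}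
    (hf : ContinuousOn f (exp ⁻¹' closure Ω)) (hχ : Continuous χ) (hχc : HasCompactSupport χ)
    (hχs : tsupport χ ⊆ c.toChart.source) (hε : 0 < ε) :
    Integrable fun ξ => c.layered χ ε ξ * f ξ :=
  integrable_mul_of_tsupport_subset (hΩ.preimage continuous_exp)
    (hf.mono (Set.preimage_mono subset_closure))
    (c.contDiff_layered (n := 0) (by norm_num) (contDiff_zero.2 hχ) hχs ε).continuous
    (hχc.of_isClosed_subset (isClosed_tsupport _) (c.tsupport_layered_subset χ ε))
    (c.tsupport_layered_subset_preimage hχs hε)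

/-- Dominated convergence: at each fixed point of `Ω` in the support of `χ` the cutoff equals `1`
for small `ε`, and outside `Ω` the layered function is zero. -/
theorem tendsto_integral_layered_mul (hΩ : IsC2BoundedOpen Ω) {f : 𝔤 → ℝ}
    (hf : ContinuousOn f (exp ⁻¹' closure Ω)) (hχ : Continuous χ) (hχc : HasCompactSupport χ)
    (hχs : tsupport χ ⊆ c.toChart.source) :
    Tendsto (fun ε : ℝ => ∫ ξ, c.layered χ ε ξ * f ξ) (𝓝[>] 0)
      (𝓝 (∫ ξ in exp ⁻¹' Ω, χ ξ * f ξ)) := by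
  have hO : IsOpen (exp ⁻¹' Ω : Set 𝔤) := hΩ.isOpen.preimage continuous_exp
  have hint : IntegrableOn (fun ξ => χ ξ * f ξ) (exp ⁻¹' Ω) :=
    ((hχ.continuousOn.mul hf).integrableOn_compact hΩ.isCompact_coord_closure).mono_set
      (Set.preimage_mono subset_closure)
  rw [← integral_indicator hO.measurableSet]
  refine tendsto_integral_filter_of_dominated_convergence
    (fun ξ => ‖(exp ⁻¹' Ω : Set 𝔤).indicator (fun ξ => χ ξ * f ξ) ξ‖) ?_ ?_
    ((integrable_indicator_iff hO.measurableSet).2 hint).norm (Eventually.of_forall fun ξ => ?_)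
  · filter_upwards [self_mem_nhdsWithin] with ε hε
    exact (c.integrable_layered_mul hΩ.isOpen hf hχ hχc hχs hε).aestronglyMeasurable
  · filter_upwards [self_mem_nhdsWithin] with ε hε
    refine Eventually.of_forall fun ξ => ?_
    by_cases hξ : ξ ∈ (exp ⁻¹' Ω : Set 𝔤)
    · rw [Set.indicator_of_mem hξ, layered, mul_right_comm, norm_mul]
      exact mul_le_of_le_one_right (norm_nonneg _) (abs_cutoff_le_one _)
    · have : c.layered χ ε ξ = 0 := image_eq_zero_of_notMem_tsupport
        fun h => hξ (c.tsupport_layered_subset_preimage hχs hε h)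
      rw [this, zero_mul, norm_zero]
      exact norm_nonneg _
  · by_cases hξ : ξ ∈ (exp ⁻¹' Ω : Set 𝔤)
    · rw [Set.indicator_of_mem hξ]
      by_cases hs : ξ ∈ tsupport χ
      · have hz : (c.toChart ξ).2 < 0 := (c.mem_iff ξ (hχs hs)).1 hξ
        refine tendsto_const_nhds.congr' ?_
        have hpos : (0 : ℝ) < -(c.toChart ξ).2 / 2 := by linarith
        filter_upwards [self_mem_nhdsWithin, nhdsWithin_le_nhds (gt_mem_nhds hpos)] with ε hε h2
        have hε' : (0 : ℝ) < ε := hε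
        rw [layered, cutoff_eq_one, mul_one]
        rw [le_div_iff₀ hε']; linarith
      · simp [layered, image_eq_zero_of_notMem_tsupport hs]
    · rw [Set.indicator_of_notMem hξ]
      refine tendsto_const_nhds.congr' ?_
      filter_upwards [self_mem_nhdsWithin] with ε hε
      have : c.layered χ ε ξ = 0 := image_eq_zero_of_notMem_tsupport
        fun h => hξ (c.tsupport_layered_subset_preimage hχs hε h)
      rw [this, zero_mul]

/-- Integration in the coordinates of the chart. -/
theorem integral_eq_integral_chart (J : (ParamSpace 𝔤 × ℝ) ≃L[ℝ] 𝔤)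
    (hJ : MeasurePreserving J volume volume) {F : 𝔤 → ℝ}
    (hF : ∀ ξ, ξ ∉ c.toChart.source → F ξ = 0) :
    ∫ ξ, F ξ = ∫ y, c.toChart.target.indicator (fun y =>
      |((J.symm : 𝔤 →L[ℝ] _) ∘L fderiv ℝ c.toChart.symm y).det| * F (c.toChart.symm y)) y := by
  have himg : (fun y => J.symm (c.toChart.symm y)) '' c.toChart.target
      = J ⁻¹' c.toChart.source := by
    ext w
    constructor
    · rintro ⟨y, hy, rfl⟩
      rw [Set.mem_preimage, J.apply_symm_apply]
      exact c.toChart.map_target hy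
    · intro hw
      refine ⟨c.toChart (J w), c.toChart.map_source hw, ?_⟩
      simp only [c.toChart.left_inv hw, J.symm_apply_apply]
  have hinj : Set.InjOn (fun y => J.symm (c.toChart.symm y)) c.toChart.target :=
    fun y hy y' hy' h => c.toChart.symm.injOn hy hy' (J.symm.injective h)
  have hhaar : (volume : Measure (ParamSpace 𝔤 × ℝ)).IsAddHaarMeasure := by
    rw [Measure.volume_eq_prod]; infer_instance
  have h1 := integral_image_eq_integral_abs_det_fderiv_smul volume
    c.toChart.open_target.measurableSet
    (fun y hy => ((J.symm : 𝔤 →L[ℝ] ParamSpace 𝔤 × ℝ).hasFDerivAt.comp y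
      (c.hasFDerivAt_symm hy)).hasFDerivWithinAt) hinj (fun w => F (J w))
  rw [integral_indicator c.toChart.open_target.measurableSet,
    ← setIntegral_eq_integral_of_forall_compl_eq_zero hF,
    ← hJ.setIntegral_preimage_emb J.toHomeomorph.measurableEmbedding F c.toChart.source]
  rw [← himg]
  refine h1.trans ?_
  simp

omit [MeasurableSpace 𝔤] [BorelSpace 𝔤] in
-- Since `F` vanishes off the patch, the surface measure may be replaced by the explicit chart
-- measure.
theorem integral_surfaceMeasure (hΩ : IsC2BoundedOpen Ω) {F : StepTwoGroup S → ℝ}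
    (hF : ContinuousOn F (frontier Ω)) (hF0 : ∀ g, g ∉ c.patch → F g = 0) :
    ∫ g, F g ∂(surfaceMeasure (frontier Ω))
      = ∫ p in c.paramDomain, areaDensity c.param p * F (c.param p) := by
  have hloc := c.isLocalParametrization hΩ.isOpen
  have h1 := (hΩ.integrable_surfaceMeasure hF).aestronglyMeasurable.restrict (s := c.patch)
  rw [← setIntegral_eq_integral_of_forall_compl_eq_zero hF0]
  rw [c.surfaceMeasure_restrict_patch hΩ.isOpen] at h1 ⊢
  rw [paramMeasure] at h1 ⊢
  rw [integral_map hloc.aemeasurable h1]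
  have hd : AEMeasurable (fun p => (areaDensity c.param p).toNNReal)
      (volume.restrict c.paramDomain) :=
    (c.continuousOn_areaDensity.aemeasurable c.isOpen_paramDomain.measurableSet).real_toNNReal
  have h2 := integral_withDensity_eq_integral_smul₀ hd (fun p => F (c.param p))
  refine h2.trans (integral_congr_ae (Eventually.of_forall fun p => ?_))
  simp only [NNReal.smul_def, smul_eq_mul]
  rw [Real.coe_toNNReal (areaDensity c.param p) (Real.sqrt_nonneg _)]

/-- The divergence theorem for a left-invariant vector field, localized to a boundary chart. -/
theorem integral_coordDeriv_eq (hΩ : IsC2BoundedOpen Ω) (X : 𝔤) {f h : 𝔤 → ℝ}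
    (hf : ContinuousOn f (exp ⁻¹' closure Ω)) (hh : ContinuousOn h (exp ⁻¹' closure Ω))
    (hd : ∀ ξ : 𝔤, exp ξ ∈ Ω → HasDerivAt (fun t : ℝ => f (ξ + t • frame ξ X)) (h ξ) 0)
    (hχ : ContDiff ℝ 1 χ) (hχc : HasCompactSupport χ) (hχs : tsupport χ ⊆ c.toChart.source) :
    ∫ ξ in exp ⁻¹' Ω, (χ ξ * h ξ + coordDeriv X χ ξ * f ξ)
      = ∫ g, χ g.log * f g.log * inner ℝ (outerNormal Ω g) X ∂(surfaceMeasure (frontier Ω)) := by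
  obtain ⟨J, hJm, hJ⟩ := S.exists_volumeChart
  have hO : IsOpen (exp ⁻¹' Ω : Set 𝔤) := hΩ.isOpen.preimage continuous_exp
  have hsub : (exp ⁻¹' Ω : Set 𝔤) ⊆ exp ⁻¹' closure Ω := Set.preimage_mono subset_closure
  have hχ' : Continuous (coordDeriv X χ) :=
    (contDiff_coordDeriv (n := 0) X (by simpa using hχ)).continuous
  have hχ's := (tsupport_coordDeriv_subset X χ).trans hχs
  have hχ'c : HasCompactSupport (coordDeriv X χ) :=
    hχc.of_isClosed_subset (isClosed_tsupport _) (tsupport_coordDeriv_subset X χ)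
  -- the limit in the interior
  have hlim1 : Tendsto (fun ε : ℝ => (∫ ξ, c.layered χ ε ξ * h ξ) +
      ∫ ξ, c.layered (coordDeriv X χ) ε ξ * f ξ) (𝓝[>] 0)
      (𝓝 (∫ ξ in exp ⁻¹' Ω, (χ ξ * h ξ + coordDeriv X χ ξ * f ξ))) := by
    have hint : ∀ {k l : 𝔤 → ℝ}, Continuous k → ContinuousOn l (exp ⁻¹' closure Ω) →
        IntegrableOn (fun ξ => k ξ * l ξ) (exp ⁻¹' Ω) := fun hk hl =>
      ((hk.continuousOn.mul hl).integrableOn_compact hΩ.isCompact_coord_closure).mono_set hsub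
    rw [integral_add (hint hχ.continuous hh) (hint hχ' hf)]
    exact (c.tendsto_integral_layered_mul hΩ hh hχ.continuous hχc hχs).add
      (c.tendsto_integral_layered_mul hΩ hf hχ' hχ'c hχ's)
  set q : 𝔤 → ℝ := fun ξ => χ ξ * (fderiv ℝ c.toChart ξ (frame ξ X)).2 * f ξ with hq
  -- For fixed `ε` integration by parts has no boundary term; what remains is the integral against
  -- the boundary layer.
  have hlayer : ∀ ε : ℝ, 0 < ε → (∫ ξ, c.layered χ ε ξ * h ξ) +
      ∫ ξ, c.layered (coordDeriv X χ) ε ξ * f ξ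
      = ∫ ξ, ε⁻¹ * deriv cutoff (-(c.toChart ξ).2 / ε) * q ξ := by
    intro ε hε
    have e1 := integral_mul_eq_neg_coordDeriv S X hO (hf.mono hsub) (hh.mono hsub) hd
      (c.contDiff_layered (n := 1) (by norm_num) (by exact_mod_cast hχ) hχs ε)
      (hχc.of_isClosed_subset (isClosed_tsupport _) (c.tsupport_layered_subset χ ε))
      (c.tsupport_layered_subset_preimage hχs hε)
    have i1 := c.integrable_layered_mul hΩ.isOpen hf hχ' hχ'c hχ's hε
    have i2 : Integrable fun ξ => coordDeriv X (c.layered χ ε) ξ * f ξ :=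
      integrable_mul_of_tsupport_subset hO (hf.mono hsub)
        (contDiff_coordDeriv (n := 0) X
          (c.contDiff_layered (n := 1) (by norm_num) (by exact_mod_cast hχ) hχs ε)).continuous
        ((hχc.of_isClosed_subset (isClosed_tsupport _) (c.tsupport_layered_subset χ ε)).of_isClosed_subset
          (isClosed_tsupport _) (tsupport_coordDeriv_subset X _))
        ((tsupport_coordDeriv_subset X _).trans (c.tsupport_layered_subset_preimage hχs hε))
    rw [e1, neg_add_eq_sub, ← integral_sub i1 i2]
    congr 1
    funext ξ
    rw [c.coordDeriv_layered X hχ hχs ε, hq]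
    ring
  -- the limit at the boundary
  set Q : ParamSpace 𝔤 × ℝ → ℝ := c.toChart.target.indicator (fun y =>
      |((J.symm : 𝔤 →L[ℝ] _) ∘L fderiv ℝ c.toChart.symm y).det| * q (c.toChart.symm y)) with hQ
  have hchart : ∀ ε : ℝ, ∫ ξ, ε⁻¹ * deriv cutoff (-(c.toChart ξ).2 / ε) * q ξ
      = ∫ y, ε⁻¹ * deriv cutoff (-y.2 / ε) * Q y := by
    intro ε
    rw [c.integral_eq_integral_chart J hJm]
    · congr 1
      funext y
      by_cases hy : y ∈ c.toChart.target
      · rw [hQ, Set.indicator_of_mem hy, Set.indicator_of_mem hy, c.toChart.right_inv hy]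
        ring
      · rw [hQ, Set.indicator_of_notMem hy, Set.indicator_of_notMem hy, mul_zero]
    · intro ξ hξ
      rw [hq]
      simp [image_eq_zero_of_notMem_tsupport fun h => hξ (hχs h)]
  have hC : IsCompact (c.toChart '' tsupport χ) :=
    hχc.isCompact.image_of_continuousOn (c.toChart.continuousOn.mono hχs)
  have hQ0 : ∀ y, y ∉ c.toChart '' tsupport χ → Q y = 0 := by
    intro y hy
    by_cases hyt : y ∈ c.toChart.target
    · have : c.toChart.symm y ∉ tsupport χ := fun h => hy ⟨_, h, c.toChart.right_inv hyt⟩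
      rw [hQ, Set.indicator_of_mem hyt, hq]
      simp [image_eq_zero_of_notMem_tsupport this]
    · rw [hQ, Set.indicator_of_notMem hyt]
  have hQc : ContinuousOn Q {y | y.2 ≤ 0} := by
    intro y hy
    by_cases hyt : y ∈ c.toChart.target
    · have h1 : ContinuousOn (fderiv ℝ c.toChart) c.toChart.source :=
        c.contDiffOn.continuousOn_fderiv_of_isOpen c.toChart.open_source (by norm_num)
      have h2 : ContinuousOn (fderiv ℝ c.toChart.symm) c.toChart.target :=
        c.contDiffOn_symm.continuousOn_fderiv_of_isOpen c.toChart.open_target (by norm_num)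
      have h3 : ContinuousOn q (c.toChart.source ∩ exp ⁻¹' closure Ω) := by
        refine (hχ.continuous.continuousOn.mul ?_).mul (hf.mono Set.inter_subset_right)
        exact continuous_snd.comp_continuousOn ((h1.mono Set.inter_subset_left).clm_apply
          (continuous_frame.clm_apply continuous_const).continuousOn)
      have h4 : ContinuousOn (fun y =>
          |((J.symm : 𝔤 →L[ℝ] ParamSpace 𝔤 × ℝ) ∘L fderiv ℝ c.toChart.symm y).det|
            * q (c.toChart.symm y)) ({y | y.2 ≤ 0} ∩ c.toChart.target) := by
        refine ContinuousOn.mul ?_ ?_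
        · exact (ContinuousLinearMap.continuous_det.comp_continuousOn
            (continuousOn_const.clm_comp (h2.mono Set.inter_subset_right))).abs
        · refine h3.comp (c.toChart.continuousOn_symm.mono Set.inter_subset_right) ?_
          intro z hz
          have hz' := c.toChart.map_target hz.2
          refine ⟨hz', (c.mem_closure_iff hz').2 ?_⟩
          rw [c.toChart.right_inv hz.2]; exact hz.1
      have h5 : ContinuousOn Q ({y | y.2 ≤ 0} ∩ c.toChart.target) :=
        h4.congr fun z hz => by rw [hQ, Set.indicator_of_mem hz.2]
      exact (continuousWithinAt_inter (c.toChart.open_target.mem_nhds hyt)).1 (h5 y ⟨hy, hyt⟩)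
    · have hyC : y ∉ c.toChart '' tsupport χ := by
        rintro ⟨ξ, hξ, rfl⟩
        exact hyt (c.toChart.map_source (hχs hξ))
      refine ContinuousAt.continuousWithinAt ?_
      refine (continuousAt_const (y := (0 : ℝ))).congr ?_
      filter_upwards [hC.isClosed.isOpen_compl.mem_nhds hyC] with z hz using (hQ0 z hz).symm
  have hlim2 := tendsto_integral_boundary_layer hC hQ0 hQc
  have hlim3 : Tendsto (fun ε : ℝ => (∫ ξ, c.layered χ ε ξ * h ξ) +
      ∫ ξ, c.layered (coordDeriv X χ) ε ξ * f ξ) (𝓝[>] 0) (𝓝 (∫ p, Q (p, 0))) := by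
    refine hlim2.congr' ?_
    filter_upwards [self_mem_nhdsWithin] with ε hε
    rw [hlayer ε hε, hchart ε]
  rw [tendsto_nhds_unique hlim1 hlim3]
  -- the boundary integral in the chart
  have hFc : ContinuousOn (fun g : StepTwoGroup S =>
      χ g.log * f g.log * inner ℝ (outerNormal Ω g) X) (frontier Ω) := by
    refine ContinuousOn.mul (ContinuousOn.mul ?_ ?_) ?_
    · exact (hχ.continuous.comp continuous_log).continuousOn
    · exact hf.comp continuous_log.continuousOn fun g hg => frontier_subset_closure hg
    · exact hΩ.continuousOn_outerNormal.inner continuousOn_const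
  rw [c.integral_surfaceMeasure hΩ hFc, ← integral_indicator c.isOpen_paramDomain.measurableSet]
  · congr 1
    funext p
    by_cases hp : p ∈ c.paramDomain
    · have hp' : (p, (0 : ℝ)) ∈ c.toChart.target := hp
      have hsrc := c.coordParam_mem_source hp
      have hne : ‖riemannianGradient c.height (c.param p)‖ ≠ 0 := norm_ne_zero_iff.2
        (c.isLocalDefiningFunction hsrc (c.param_mem_frontier hΩ.isOpen hp)).riemannianGradient_ne_zero
      have hin := inner_riemannianGradient (g := c.param p) (c.hasFDerivAt_height hsrc) X
      -- The gradient norm in the area density cancels against the normalization of the outer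
      -- normal, leaving the unnormalized derivative of the height that occurs in `q`.
      rw [hQ, Set.indicator_of_mem hp', Set.indicator_of_mem hp, c.areaDensity_param J hJ hp,
        c.outerNormal_eq (c.param_mem_patch hp) (c.param_mem_frontier hΩ.isOpen hp),
        inner_smul_left, hin, hq]
      simp only [param, coordParam, ContinuousLinearMap.comp_apply, ContinuousLinearMap.coe_snd']
      have hne' : ‖riemannianGradient c.height (exp (c.toChart.symm (p, 0)))‖ ≠ 0 := hne
      simp only [conj_trivial]
      field_simp
    · have hp' : (p, (0 : ℝ)) ∉ c.toChart.target := hp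
      rw [hQ, Set.indicator_of_notMem hp', Set.indicator_of_notMem hp]
  · intro g hg
    have : χ g.log = 0 := image_eq_zero_of_notMem_tsupport fun h => hg (hχs h)
    rw [this, zero_mul, zero_mul]

end BoundaryChart

end Carnot

namespace Carnot

open StepTwoGroup
open scoped Manifold ContDiff

/-! ### The global divergence theorem by a partition of unity. -/

section Divergence

variable {𝔤 : Type*} [EuclideanLieAlgebra 𝔤] {S : StepTwoStratification 𝔤}
  {Ω : Set (StepTwoGroup S)} [MeasurableSpace 𝔤] [BorelSpace 𝔤]

theorem integral_coordDeriv_interior (hΩ : IsOpen Ω) (X : 𝔤) {f h χ : 𝔤 → ℝ}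
    (hf : ContinuousOn f (exp ⁻¹' closure Ω)) (hh : ContinuousOn h (exp ⁻¹' closure Ω))
    (hd : ∀ ξ : 𝔤, exp ξ ∈ Ω → HasDerivAt (fun t : ℝ => f (ξ + t • frame ξ X)) (h ξ) 0)
    (hχ : ContDiff ℝ 1 χ) (hχc : HasCompactSupport χ) (hχs : tsupport χ ⊆ exp ⁻¹' Ω) :
    ∫ ξ in exp ⁻¹' Ω, (χ ξ * h ξ + coordDeriv X χ ξ * f ξ)
      = ∫ g, χ g.log * f g.log * inner ℝ (outerNormal Ω g) X ∂(surfaceMeasure (frontier Ω)) := by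
  have hsub : (exp ⁻¹' Ω : Set 𝔤) ⊆ exp ⁻¹' closure Ω := Set.preimage_mono subset_closure
  rw [setIntegral_eq_integral_of_forall_compl_eq_zero]
  · have h1 := integral_mul_add_fderiv_mul_eq_zero S X (hΩ.preimage continuous_exp)
      (hf.mono hsub) (hh.mono hsub) hd hχ hχc hχs
    refine h1.trans ?_
    have h2 : (fun g : StepTwoGroup S => χ g.log * f g.log * inner ℝ (outerNormal Ω g) X)
        = fun _ => 0 := by
      funext g
      by_cases hg : g ∈ frontier Ω
      · have : χ g.log = 0 := image_eq_zero_of_notMem_tsupport fun h => by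
          rw [hΩ.frontier_eq] at hg
          exact hg.2 (hχs h)
        rw [this, zero_mul, zero_mul]
      · rw [outerNormal_of_notMem_frontier hg, inner_zero_left, mul_zero]
    rw [h2, integral_zero]
  · intro ξ hξ
    have e1 : χ ξ = 0 := image_eq_zero_of_notMem_tsupport fun h => hξ (hχs h)
    have e2 : coordDeriv X χ ξ = 0 := image_eq_zero_of_notMem_tsupport fun h =>
      hξ (hχs (tsupport_coordDeriv_subset X χ h))
    rw [e1, e2]; ring

/-- The divergence theorem for a left-invariant vector field; only the derivative of `f` in the
direction of the field is needed. -/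
theorem integral_eq_integral_boundary (hΩ : IsC2BoundedOpen Ω) (X : 𝔤) {f h : 𝔤 → ℝ}
    (hf : ContinuousOn f (exp ⁻¹' closure Ω)) (hh : ContinuousOn h (exp ⁻¹' closure Ω))
    (hd : ∀ ξ : 𝔤, exp ξ ∈ Ω → HasDerivAt (fun t : ℝ => f (ξ + t • frame ξ X)) (h ξ) 0) :
    ∫ ξ in exp ⁻¹' Ω, h ξ
      = ∫ g, f g.log * inner ℝ (outerNormal Ω g) X ∂(surfaceMeasure (frontier Ω)) := by
  set K : Set 𝔤 := exp ⁻¹' closure Ω with hK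
  have hKc : IsCompact K := hΩ.isCompact_coord_closure
  have hO : IsOpen (exp ⁻¹' Ω : Set 𝔤) := hΩ.isOpen.preimage continuous_exp
  have hOK : (exp ⁻¹' Ω : Set 𝔤) ⊆ K := Set.preimage_mono subset_closure
  -- Each point has a neighbourhood on which the localized theorem is available, in the interior or
  -- in a chart. Boundedness of `V` is needed so that the partition functions have compact support.
  have hlocal : ∀ ξ ∈ K, ∃ V : Set 𝔤, IsOpen V ∧ ξ ∈ V ∧ Bornology.IsBounded V ∧
      ∀ χ : 𝔤 → ℝ, ContDiff ℝ 1 χ → HasCompactSupport χ → tsupport χ ⊆ V →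
      ∫ ξ in exp ⁻¹' Ω, (χ ξ * h ξ + coordDeriv X χ ξ * f ξ)
      = ∫ g, χ g.log * f g.log * inner ℝ (outerNormal Ω g) X ∂(surfaceMeasure (frontier Ω)) := by
    intro ξ hξ
    by_cases hξO : exp ξ ∈ Ω
    · exact ⟨exp ⁻¹' Ω, hO, hξO, hKc.isBounded.subset hOK, fun χ h1 h2 h3 =>
        integral_coordDeriv_interior hΩ.isOpen X hf hh hd h1 h2 h3⟩
    · have hfr : (exp ξ : StepTwoGroup S) ∈ frontier Ω := by
        rw [hΩ.isOpen.frontier_eq]; exact ⟨hξ, hξO⟩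
      obtain ⟨c, hc⟩ := hΩ.exists_chart hfr
      exact ⟨c.toChart.source ∩ Metric.ball ξ 1, c.toChart.open_source.inter Metric.isOpen_ball,
        ⟨hc, Metric.mem_ball_self one_pos⟩, Metric.isBounded_ball.subset Set.inter_subset_right,
        fun χ h1 h2 h3 => c.integral_coordDeriv_eq hΩ X hf hh hd h1 h2
          (h3.trans Set.inter_subset_left)⟩
  choose! V hVo hVm hVb hV using hlocal
  obtain ⟨t, htK, htc⟩ := hKc.elim_nhds_subcover V fun ξ hξ => (hVo ξ hξ).mem_nhds (hVm ξ hξ)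
  obtain ⟨ρ, hρ⟩ := SmoothPartitionOfUnity.exists_isSubordinate 𝓘(ℝ, 𝔤) hKc.isClosed
    (fun i : t => V i) (fun i => hVo i (htK i i.2)) (by
      intro ξ hξ
      obtain ⟨i, hi, hξi⟩ := Set.mem_iUnion₂.1 (htc hξ)
      exact Set.mem_iUnion.2 ⟨⟨i, hi⟩, hξi⟩)
  have hρC : ∀ i, ContDiff ℝ 1 (ρ i) := fun i => (ρ i).contMDiff.contDiff.of_le (by
    exact_mod_cast le_top)
  have hρc : ∀ i, HasCompactSupport (ρ i) := fun i =>
    Metric.isCompact_of_isClosed_isBounded (isClosed_tsupport _)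
      ((hVb i (htK i i.2)).subset (hρ i))
  have hρsum : ∀ ξ ∈ K, ∑ i, ρ i ξ = 1 := fun ξ hξ => by
    have := ρ.sum_eq_one hξ
    rwa [finsum_eq_sum_of_fintype] at this
  -- The partition functions sum to `1` on the open set, so the derivative terms disappear in the
  -- sum.
  have hρD : ∀ ξ ∈ (exp ⁻¹' Ω : Set 𝔤), ∑ i, coordDeriv X (ρ i) ξ = 0 := by
    intro ξ hξ
    have h1 : HasFDerivAt (fun ζ => ∑ i, ρ i ζ) (∑ i, fderiv ℝ (ρ i) ξ) ξ :=
      HasFDerivAt.fun_sum fun i _ => ((hρC i).differentiable one_ne_zero ξ).hasFDerivAt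
    have h2 : HasFDerivAt (fun ζ => ∑ i, ρ i ζ) (0 : 𝔤 →L[ℝ] ℝ) ξ := by
      refine (hasFDerivAt_const (1 : ℝ) ξ).congr_of_eventuallyEq ?_
      filter_upwards [hO.mem_nhds hξ] with ζ hζ using hρsum ζ (hOK hζ)
    have h3 := DFunLike.congr_fun (h1.unique h2) (frame ξ X)
    simpa [coordDeriv] using h3
  have hint : ∀ i, IntegrableOn (fun ξ => ρ i ξ * h ξ + coordDeriv X (ρ i) ξ * f ξ)
      (exp ⁻¹' Ω) := fun i => by
    have hχ' : Continuous (coordDeriv X (ρ i)) :=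
      (contDiff_coordDeriv (n := 0) X (by simpa using hρC i)).continuous
    exact ((((hρC i).continuous.continuousOn.mul hh).add
      (hχ'.continuousOn.mul hf)).integrableOn_compact hKc).mono_set hOK
  have hintb : ∀ i, Integrable (fun g : StepTwoGroup S =>
      ρ i g.log * f g.log * inner ℝ (outerNormal Ω g) X) (surfaceMeasure (frontier Ω)) := fun i => by
    refine hΩ.integrable_surfaceMeasure ((ContinuousOn.mul ?_ ?_).mul ?_)
    · exact ((hρC i).continuous.comp continuous_log).continuousOn
    · exact hf.comp continuous_log.continuousOn fun g hg => frontier_subset_closure hg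
    · exact hΩ.continuousOn_outerNormal.inner continuousOn_const
  calc ∫ ξ in exp ⁻¹' Ω, h ξ
      = ∫ ξ in exp ⁻¹' Ω, ∑ i, (ρ i ξ * h ξ + coordDeriv X (ρ i) ξ * f ξ) := by
        refine setIntegral_congr_fun hO.measurableSet fun ξ hξ => ?_
        rw [Finset.sum_add_distrib, ← Finset.sum_mul, ← Finset.sum_mul, hρsum ξ (hOK hξ),
          hρD ξ hξ]
        ring
    _ = ∑ i, ∫ ξ in exp ⁻¹' Ω, (ρ i ξ * h ξ + coordDeriv X (ρ i) ξ * f ξ) :=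
        integral_finsetSum _ fun i _ => hint i
    _ = ∑ i, ∫ g, ρ i g.log * f g.log * inner ℝ (outerNormal Ω g) X
          ∂(surfaceMeasure (frontier Ω)) :=
        Finset.sum_congr rfl fun i _ => hV i (htK i i.2) (ρ i) (hρC i) (hρc i) (hρ i)
    _ = ∫ g, ∑ i, ρ i g.log * f g.log * inner ℝ (outerNormal Ω g) X
          ∂(surfaceMeasure (frontier Ω)) := (integral_finsetSum _ fun i _ => hintb i).symm
    _ = _ := by
        refine integral_congr_ae (Eventually.of_forall fun g => ?_)
        simp only
        by_cases hg : g ∈ frontier Ω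
        · rw [← Finset.sum_mul, ← Finset.sum_mul, hρsum g.log (frontier_subset_closure hg), one_mul]
        · simp [outerNormal_of_notMem_frontier hg]

end Divergence

end Carnot

namespace Carnot

open StepTwoGroup

/-! ### Derivatives up to the boundary. -/

section Extension

variable {𝔤 : Type*} [EuclideanLieAlgebra 𝔤]

/-- If `f` is of class `C^{n+1}` on the closure of an open set, then a continuous extension `h` of
`X f` to the closure is given there by the derivatives of `f`. -/
theorem exists_hasFDerivWithinAt_of_line_deriv {O : Set 𝔤} (hO : IsOpen O) {n : ℕ} {f : 𝔤 → ℝ}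
    (hf : ContDiffOn ℝ (n + 1) f (closure O)) {ξ₀ : 𝔤} (hξ₀ : ξ₀ ∈ closure O) :
    ∃ f' : 𝔤 → 𝔤 →L[ℝ] ℝ, HasFDerivWithinAt f (f' ξ₀) (closure O) ξ₀ ∧
      ContDiffWithinAt ℝ n f' (closure O) ξ₀ ∧
      ∀ (X : 𝔤) (h : 𝔤 → ℝ), ContinuousOn h (closure O) →
        (∀ ξ ∈ O, HasDerivAt (fun t : ℝ => f (ξ + t • frame ξ X)) (h ξ) 0) →
        ∀ᶠ ξ in 𝓝[closure O] ξ₀, h ξ = f' ξ (frame ξ X) := by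
  have hn : (n : WithTop ℕ∞) ≠ ((⊤ : ℕ∞) : WithTop ℕ∞) := by
    exact_mod_cast ENat.natCast_ne_top n
  obtain ⟨u, hu, hus, -, f', hf', hC⟩ :=
    (contDiffWithinAt_succ_iff_hasFDerivWithinAt' hn).1 (hf ξ₀ hξ₀)
  have hev := hC.eventually hn
  rw [Set.insert_eq_of_mem hξ₀] at hu hus hev
  have hmem : ξ₀ ∈ u := mem_of_mem_nhdsWithin hξ₀ hu
  refine ⟨f', hf' ξ₀ hmem, hC, fun X h hh hd => ?_⟩
  filter_upwards [hev, eventually_eventually_nhdsWithin.2 hu, self_mem_nhdsWithin] with ξ h1 h2 h3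
  have : (𝓝[O] ξ).NeBot := mem_closure_iff_nhdsWithin_neBot.1 h3
  have hOle : 𝓝[O] ξ ≤ 𝓝[closure O] ξ := nhdsWithin_mono _ subset_closure
  have t1 : Tendsto h (𝓝[O] ξ) (𝓝 (h ξ)) := (hh ξ h3).mono_left hOle
  have hfc : ContinuousWithinAt f' (closure O) ξ := h1.continuousWithinAt
  have t2 : Tendsto (fun ζ => f' ζ (frame ζ X)) (𝓝[O] ξ) (𝓝 (f' ξ (frame ξ X))) :=
    (hfc.clm_apply ((continuous_frame.clm_apply continuous_const).continuousWithinAt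
      (x := ξ))).mono_left hOle
  -- Both sides are continuous up to the closure and agree on the open set, where `f'` is the full
  -- derivative.
  refine tendsto_nhds_unique t1 (t2.congr' ?_)
  filter_upwards [hOle h2, self_mem_nhdsWithin] with ζ hζ hζO
  have h5 : HasFDerivAt f (f' ζ) ζ := (hf' ζ hζ).hasFDerivAt
    (mem_of_superset (hO.mem_nhds hζO) subset_closure)
  exact (hasDerivAt_comp_line h5 (frame ζ X)).unique (hd ζ hζO)

/-- Locally the extension is the derivative of `f` applied to a smooth field, so it loses exactly
one order. This makes the extensions of `X_i u` differentiable at boundary points. -/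
theorem contDiffOn_of_line_deriv {O : Set 𝔤} (hO : IsOpen O) {n : ℕ} {f : 𝔤 → ℝ}
    (hf : ContDiffOn ℝ (n + 1) f (closure O)) (X : 𝔤) {h : 𝔤 → ℝ}
    (hh : ContinuousOn h (closure O))
    (hd : ∀ ξ ∈ O, HasDerivAt (fun t : ℝ => f (ξ + t • frame ξ X)) (h ξ) 0) :
    ContDiffOn ℝ n h (closure O) := by
  intro ξ₀ hξ₀
  obtain ⟨f', -, hC, heq⟩ := exists_hasFDerivWithinAt_of_line_deriv hO hf hξ₀
  have h1 : ContDiffWithinAt ℝ n (fun ξ => f' ξ (frame ξ X)) (closure O) ξ₀ :=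
    hC.clm_apply (contDiff_frame.clm_apply contDiff_const).contDiffWithinAt
  exact h1.congr_of_eventuallyEq_of_mem (heq X h hh hd) hξ₀

theorem exists_fderivWithin_eq_of_line_deriv {O : Set 𝔤} (hO : IsOpen O) {f : 𝔤 → ℝ}
    (hf : ContDiffOn ℝ 1 f (closure O)) {ξ₀ : 𝔤} (hξ₀ : ξ₀ ∈ closure O) :
    ∃ D : 𝔤 →L[ℝ] ℝ, HasFDerivWithinAt f D (closure O) ξ₀ ∧
      ∀ (X : 𝔤) (h : 𝔤 → ℝ), ContinuousOn h (closure O) →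
        (∀ ξ ∈ O, HasDerivAt (fun t : ℝ => f (ξ + t • frame ξ X)) (h ξ) 0) →
        D (frame ξ₀ X) = h ξ₀ := by
  obtain ⟨f', h1, -, h2⟩ := exists_hasFDerivWithinAt_of_line_deriv (n := 0) hO
    (by simpa using hf) hξ₀
  exact ⟨f' ξ₀, h1, fun X h hh hd => ((h2 X h hh hd).self_of_nhdsWithin hξ₀).symm⟩

end Extension

/-! ### Curves in the boundary. -/

section Curves

variable {𝔤 : Type*} [EuclideanLieAlgebra 𝔤] {S : StepTwoStratification 𝔤}
  {Ω : Set (StepTwoGroup S)}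

/-- Every tangent vector of the boundary is the velocity of a curve in the boundary. -/
theorem IsC2BoundedOpen.exists_boundary_curve (hΩ : IsC2BoundedOpen Ω) {g : StepTwoGroup S}
    (hg : g ∈ frontier Ω) {v : 𝔤} (hv : inner ℝ (outerNormal Ω g) v = 0) :
    ∃ γ : ℝ → 𝔤, γ 0 = g.log ∧ HasDerivAt γ (frame g.log v) 0 ∧
      ∀ᶠ t in 𝓝 0, exp (γ t) ∈ frontier Ω := by
  obtain ⟨c, hc⟩ := hΩ.exists_chart hg
  obtain ⟨hp, hpe⟩ := c.coordParam_fst hc ((c.mem_frontier_iff hΩ.isOpen hc).1 hg)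
  set p₀ := (c.toChart g.log).1
  set w := fderiv ℝ c.toChart g.log (frame g.log v) with hw
  -- Tangency means that the velocity has no height component in the chart, so a straight line of
  -- parameters realizes it.
  have hw2 : w.2 = 0 := by
    have h1 := inner_riemannianGradient (c.hasFDerivAt_height hc) v
    rw [c.outerNormal_eq hc hg, inner_smul_left] at hv
    have hne : ‖riemannianGradient c.height g‖⁻¹ ≠ 0 := inv_ne_zero (norm_ne_zero_iff.2
      (c.isLocalDefiningFunction hc hg).riemannianGradient_ne_zero)
    have h2 := (mul_eq_zero.1 hv).resolve_left (by simpa using hne)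
    rw [h1] at h2
    exact h2
  have hline : HasDerivAt (fun t : ℝ => p₀ + t • w.1) w.1 0 := by
    simpa using ((hasDerivAt_id (0 : ℝ)).smul_const w.1).const_add p₀
  refine ⟨fun t => c.coordParam (p₀ + t • w.1), by simpa using hpe, ?_, ?_⟩
  · have h1 : HasFDerivAt c.coordParam (fderiv ℝ c.toChart.symm (p₀, 0) ∘L
        ContinuousLinearMap.inl ℝ (ParamSpace 𝔤) ℝ) (p₀ + (0 : ℝ) • w.1) := by
      simpa using c.hasFDerivAt_coordParam hp
    refine (h1.comp_hasDerivAt (0 : ℝ) hline).congr_deriv ?_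
    have h2 : ((w.1, 0) : ParamSpace 𝔤 × ℝ) = w := by rw [← hw2]
    change fderiv ℝ c.toChart.symm (p₀, 0) (w.1, 0) = _
    have hpe' : c.toChart.symm (p₀, 0) = g.log := hpe
    have h3 := c.fderiv_symm_fderiv hp (frame g.log v)
    rw [hpe'] at h3
    rw [h2, hw, h3]
  · have h1 : Tendsto (fun t : ℝ => p₀ + t • w.1) (𝓝 0) (𝓝 p₀) := by
      simpa using hline.continuousAt.tendsto
    filter_upwards [h1.eventually (c.isOpen_paramDomain.mem_nhds hp)] with t ht
      using c.param_mem_frontier hΩ.isOpen ht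

end Curves

/-! ### Horizontal tangent frames. -/

section Frame

/-- The image of `f ⟂ a` under the rotation that takes the unit vector `a` to the unit vector
`b`. -/
noncomputable def rotate {E : Type*} [NormedAddCommGroup E] [InnerProductSpace ℝ E]
    (a b f : E) : E := f - (inner ℝ f b / (1 + inner ℝ a b)) • (a + b)

theorem inner_rotate_self {E : Type*} [NormedAddCommGroup E] [InnerProductSpace ℝ E]
    {a b f : E} (hb : ‖b‖ = 1) (hab : 1 + inner ℝ a b ≠ 0) :
    inner ℝ b (rotate a b f) = 0 := by
  rw [rotate, inner_sub_right, inner_smul_right, inner_add_right, real_inner_self_eq_norm_sq, hb,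
    real_inner_comm f b, real_inner_comm a b]
  field_simp
  ring

theorem inner_rotate_rotate {E : Type*} [NormedAddCommGroup E] [InnerProductSpace ℝ E]
    {a b f f' : E} (ha : ‖a‖ = 1) (hb : ‖b‖ = 1) (hab : 1 + inner ℝ a b ≠ 0)
    (hf : inner ℝ f a = 0) (hf' : inner ℝ f' a = 0) :
    inner ℝ (rotate a b f) (rotate a b f') = inner ℝ f f' := by
  simp only [rotate, inner_sub_right, inner_sub_left, inner_smul_right, inner_smul_left,
    inner_add_right, inner_add_left, real_inner_self_eq_norm_sq, ha, hb, conj_trivial, hf,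
    real_inner_comm f' a, real_inner_comm f' b, real_inner_comm a b]
  rw [real_inner_comm, hf']
  field_simp
  ring

variable {𝔤 : Type*} [EuclideanLieAlgebra 𝔤] {S : StepTwoStratification 𝔤}
  {Ω : Set (StepTwoGroup S)}

theorem starProjection_inner_of_mem {V : Submodule ℝ 𝔤} {y : 𝔤} (hy : y ∈ V) (x : 𝔤) :
    inner ℝ (V.starProjection x) y = inner ℝ x y := by
  rw [Submodule.inner_starProjection_left_eq_right, Submodule.starProjection_eq_self_iff.2 hy]

/-- Horizontal tangent frames exist at noncharacteristic points. -/
theorem IsC2BoundedOpen.exists_horizontalTangentFrame (hΩ : IsC2BoundedOpen Ω)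
    {g₀ : StepTwoGroup S} (hg₀ : g₀ ∈ frontier Ω) (hW : angle Ω g₀ ≠ 0) :
    ∃ e, IsHorizontalTangentFrame Ω g₀ e := by
  obtain ⟨c, hc⟩ := hΩ.exists_chart hg₀
  let N : 𝔤 → 𝔤 := fun ξ => S.V₁.starProjection (riemannianGradient c.height (exp ξ))
  have hNC : ContDiffOn ℝ 1 N c.toChart.source := by
    have h1 : ContDiffOn ℝ 1 (fderiv ℝ c.toChart) c.toChart.source :=
      c.contDiffOn.fderiv_of_isOpen c.toChart.open_source (by norm_num)
    have h2 : ContDiffOn ℝ 1 (fun ξ : 𝔤 => (InnerProductSpace.toDual ℝ 𝔤).symm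
        ((ContinuousLinearMap.snd ℝ _ ℝ ∘L fderiv ℝ c.toChart ξ) ∘L frame ξ))
        c.toChart.source :=
      (InnerProductSpace.toDual ℝ 𝔤).symm.toContinuousLinearEquiv.contDiff.comp_contDiffOn
        ((contDiffOn_const.clm_comp h1).clm_comp contDiff_frame.contDiffOn)
    exact S.V₁.starProjection.contDiff.comp_contDiffOn
      (h2.congr fun ξ hξ => c.riemannianGradient_height (g := exp ξ) hξ)
  -- the relation with the outer normal
  have hGne : ∀ ξ : 𝔤, ξ ∈ c.toChart.source → exp ξ ∈ frontier Ω →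
      ‖riemannianGradient c.height (exp ξ)‖ ≠ 0 := fun ξ hξ hξf => norm_ne_zero_iff.2
      (c.isLocalDefiningFunction (g := exp ξ) hξ hξf).riemannianGradient_ne_zero
  have hproj : ∀ ξ : 𝔤, ξ ∈ c.toChart.source → exp ξ ∈ frontier Ω →
      horizontalNormal Ω (exp ξ) = ‖riemannianGradient c.height (exp ξ)‖⁻¹ • N ξ :=
    fun ξ hξ hξf => by
      rw [horizontalNormal, c.outerNormal_eq (g := exp ξ) hξ hξf, map_smul]
  have hN0 : N g₀.log ≠ 0 := by
    intro h0
    apply hW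
    have h1 := hproj g₀.log hc hg₀
    rw [h0, smul_zero] at h1
    rw [angle]
    exact norm_eq_zero.2 h1
  let b : 𝔤 → 𝔤 := fun ξ => ‖N ξ‖⁻¹ • N ξ
  set a := b g₀.log with ha_def
  have hNV : ∀ ξ, N ξ ∈ S.V₁ := fun ξ => Submodule.starProjection_apply_mem _ _
  have hbV : ∀ ξ, b ξ ∈ S.V₁ := fun ξ => S.V₁.smul_mem _ (hNV ξ)
  have hb1 : ∀ ξ, N ξ ≠ 0 → ‖b ξ‖ = 1 := fun ξ hξ => by
    rw [norm_smul, norm_inv, norm_norm, inv_mul_cancel₀ (norm_ne_zero_iff.2 hξ)]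
  have ha1 : ‖a‖ = 1 := hb1 _ hN0
  -- an orthonormal basis of the complement of `a` in the first layer
  let a' : S.V₁ := ⟨a, hbV _⟩
  have ha'0 : a' ≠ 0 := by
    intro h0
    have : a = 0 := congrArg Subtype.val h0
    rw [this, norm_zero] at ha1
    exact zero_ne_one ha1
  -- The truncated subtraction is genuine because the nonzero vector `a'` makes the first layer
  -- nontrivial.
  have hfact : Fact (finrank ℝ S.V₁ = finrank ℝ S.V₁ - 1 + 1) := ⟨by
    have : Nontrivial S.V₁ := ⟨a', 0, ha'0⟩
    have := finrank_pos (R := ℝ) (M := S.V₁)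
    omega⟩
  let B := OrthonormalBasis.fromOrthogonalSpanSingleton (𝕜 := ℝ) (finrank ℝ S.V₁ - 1) ha'0
  let f : Fin (finrank ℝ S.V₁ - 1) → 𝔤 := fun i => ((B i : S.V₁) : 𝔤)
  have hfV : ∀ i, f i ∈ S.V₁ := fun i => (B i : S.V₁).2
  have hfa : ∀ i, inner ℝ (f i) a = 0 := fun i => by
    have h : inner ℝ (B i : S.V₁) a' = 0 :=
      Submodule.mem_orthogonal_singleton_iff_inner_left.1 (B i).2
    exact h
  have hff : ∀ i j, inner ℝ (f i) (f j) = if i = j then (1 : ℝ) else 0 := fun i j =>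
    orthonormal_iff_ite.1 B.orthonormal i j
  -- the domain
  have hU₁ : IsOpen (c.toChart.source ∩ N ⁻¹' {0}ᶜ) :=
    hNC.continuousOn.isOpen_inter_preimage c.toChart.open_source isOpen_compl_singleton
  have hbC : ContDiffOn ℝ 1 b (c.toChart.source ∩ N ⁻¹' {0}ᶜ) := by
    have h1 := hNC.mono (Set.inter_subset_left (t := N ⁻¹' {0}ᶜ))
    exact ((h1.norm ℝ fun ξ hξ => hξ.2).inv fun ξ hξ => norm_ne_zero_iff.2 hξ.2).smul h1
  have hU : IsOpen ((c.toChart.source ∩ N ⁻¹' {0}ᶜ) ∩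
      (fun ξ => 1 + inner ℝ a (b ξ)) ⁻¹' Set.Ioi (0 : ℝ)) :=
    (continuousOn_const.add (continuousOn_const.inner hbC.continuousOn)).isOpen_inter_preimage
      hU₁ isOpen_Ioi
  -- A fixed orthonormal basis of the complement of the horizontal normal at `g₀` is carried to
  -- nearby points by the rotation taking that normal to the current one. The formula is `C¹`
  -- because the unit horizontal normal is, and `1 + ⟨a, b⟩` stays positive on the chosen
  -- neighbourhood.
  refine ⟨fun i g => rotate a (b g.log) (f i), log ⁻¹' _, hU.preimage continuous_log,
    ⟨⟨hc, hN0⟩, ?_⟩, fun i => ?_, fun g hg => ⟨?_, fun i => ?_⟩⟩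
  · change (0 : ℝ) < 1 + inner ℝ a a
    rw [real_inner_self_eq_norm_sq, ha1]; norm_num
  · have h1 : ContDiffOn ℝ 1 b ((c.toChart.source ∩ N ⁻¹' {0}ᶜ) ∩
      (fun ξ => 1 + inner ℝ a (b ξ)) ⁻¹' Set.Ioi (0 : ℝ)) := hbC.mono Set.inter_subset_left
    exact contDiffOn_const.sub (((contDiffOn_const.inner ℝ h1).div
      (contDiffOn_const.add (contDiffOn_const.inner ℝ h1)) fun ξ hξ => ne_of_gt hξ.2).smul
      (contDiffOn_const.add h1))
  · rw [orthonormal_iff_ite]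
    intro i j
    rw [inner_rotate_rotate ha1 (hb1 _ hg.1.1.2) (ne_of_gt hg.1.2) (hfa i) (hfa j), hff]
  · have hV : rotate a (b g.log) (f i) ∈ S.V₁ :=
      S.V₁.sub_mem (hfV i) (S.V₁.smul_mem _ (S.V₁.add_mem (hbV _) (hbV _)))
    refine ⟨hV, ?_⟩
    have h1 : horizontalNormal Ω g = (‖riemannianGradient c.height g‖⁻¹ * ‖N g.log‖) • b g.log := by
      have h2 := hproj g.log hg.1.1.1 hg.2
      have h3 : ‖N g.log‖ ≠ 0 := norm_ne_zero_iff.2 hg.1.1.2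
      rw [smul_smul, mul_assoc, mul_inv_cancel₀ h3, mul_one]
      exact h2
    rw [← starProjection_inner_of_mem hV]
    change inner ℝ (horizontalNormal Ω g) _ = _
    rw [h1, inner_smul_left, inner_rotate_self (hb1 _ hg.1.1.2) (ne_of_gt hg.1.2), mul_zero]

end Frame

end Carnot

/-! ### Mean curvature in terms of a function vanishing on the boundary. -/

namespace Carnot

open StepTwoGroup

variable {𝔤 : Type*} [EuclideanLieAlgebra 𝔤] {S : StepTwoStratification 𝔤} {m : ℕ}
  (X : OrthonormalBasis (Fin m) ℝ S.V₁)

include X in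
theorem eq_sum_inner_smul {y : 𝔤} (hy : y ∈ S.V₁) :
    y = ∑ i, inner ℝ (X i : 𝔤) y • (X i : 𝔤) := by
  have h := congrArg Subtype.val (X.sum_repr' ⟨y, hy⟩)
  simpa using h.symm

include X in
theorem sum_inner_mul_inner {y : 𝔤} (x : 𝔤) (hy : y ∈ S.V₁) :
    ∑ i, inner ℝ x (X i : 𝔤) * inner ℝ (X i : 𝔤) y = inner ℝ x y := by
  conv_rhs => rw [eq_sum_inner_smul X hy, inner_sum]
  simp only [inner_smul_right, mul_comm]

theorem sum_inner_sq_eq_norm_starProjection_sq (x : 𝔤) :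
    ∑ i, inner ℝ x (X i : 𝔤) ^ 2 = ‖S.V₁.starProjection x‖ ^ 2 := by
  have hP : S.V₁.starProjection x ∈ S.V₁ := Submodule.starProjection_apply_mem _ _
  rw [← real_inner_self_eq_norm_sq, ← sum_inner_mul_inner X _ hP]
  refine Finset.sum_congr rfl fun i _ => ?_
  rw [real_inner_comm (S.V₁.starProjection x) (X i : 𝔤), starProjection_inner_of_mem (X i).2]
  ring

/-- Brackets with `v` lie in `V₂`, which is orthogonal to `v`. -/
theorem adAdjoint_self_of_mem {v : 𝔤} (hv : v ∈ S.V₁) : adAdjoint v v = 0 := by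
  refine ext_inner_right ℝ fun w => ?_
  rw [adAdjoint, LinearMap.adjoint_inner_left, inner_zero_left]
  exact (Submodule.isOrtho_iff_inner_eq.1 S.orthogonal) v hv _ (S.lie_mem_V₂ v w)

variable {Ω : Set (StepTwoGroup S)}

theorem inner_horizontalNormal {y : 𝔤} (hy : y ∈ S.V₁) (g : StepTwoGroup S) :
    inner ℝ (horizontalNormal Ω g) y = inner ℝ (outerNormal Ω g) y :=
  starProjection_inner_of_mem hy _

theorem horizontalNormal_mem (g : StepTwoGroup S) : horizontalNormal Ω g ∈ S.V₁ :=
  Submodule.starProjection_apply_mem _ _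

theorem horizontalGaussMap_mem (g : StepTwoGroup S) : horizontalGaussMap Ω g ∈ S.V₁ :=
  S.V₁.smul_mem _ (horizontalNormal_mem g)

/-- All Koszul terms vanish on the diagonal for a horizontal vector, so the curvature involves only
the derivatives of the components of the frame. -/
theorem inner_horizontalConnection_self {Y : StepTwoGroup S → 𝔤} {g : StepTwoGroup S}
    (hY : Y g ∈ S.V₁) :
    inner ℝ (horizontalConnection (Y g) Y g) (horizontalGaussMap Ω g)
      = inner ℝ (deriv (fun t : ℝ => Y (g * exp (t • Y g))) 0) (horizontalGaussMap Ω g) := by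
  rw [horizontalConnection, starProjection_inner_of_mem (horizontalGaussMap_mem g), leviCivita,
    lie_self, adAdjoint_self_of_mem hY]
  simp

/-- An orthonormal frame of the horizontal tangent space together with the horizontal Gauss map
is an orthonormal basis of the first layer. -/
theorem sum_inner_mul_inner_frame {n : ℕ} (hn : finrank ℝ S.V₁ = n + 1) {e : Fin n → 𝔤} {b : 𝔤}
    (he : Orthonormal ℝ e) (heV : ∀ i, e i ∈ S.V₁) (hb : ‖b‖ = 1) (hbV : b ∈ S.V₁)
    (hbe : ∀ i, inner ℝ b (e i) = 0) {x y : 𝔤} (hx : x ∈ S.V₁) (hy : y ∈ S.V₁) :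
    ∑ k, inner ℝ x (e k) * inner ℝ y (e k) = inner ℝ x y - inner ℝ x b * inner ℝ y b := by
  classical
  let v : Option (Fin n) → S.V₁ := fun o => o.elim ⟨b, hbV⟩ fun i => ⟨e i, heV i⟩
  have hv : Orthonormal ℝ v := by
    rw [orthonormal_iff_ite] at he ⊢
    intro i j
    rcases i with _ | i <;> rcases j with _ | j
    · change inner ℝ b b = _
      rw [real_inner_self_eq_norm_sq, hb]; simp
    · change inner ℝ b (e j) = _
      rw [hbe]; simp
    · change inner ℝ (e i) b = _
      rw [real_inner_comm, hbe]; simp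
    · change inner ℝ (e i) (e j) = _
      rw [he]; simp
  have hcard : Fintype.card (Option (Fin n)) = finrank ℝ S.V₁ := by simp [hn]
  have hspan : ⊤ ≤ Submodule.span ℝ (Set.range v) :=
    (hv.linearIndependent.span_eq_top_of_card_eq_finrank' hcard).ge
  have h := (OrthonormalBasis.mk hv hspan).sum_inner_mul_inner ⟨x, hx⟩ ⟨y, hy⟩
  rw [OrthonormalBasis.coe_mk, Fintype.sum_option] at h
  have h' : inner ℝ x b * inner ℝ b y + ∑ k, inner ℝ x (e k) * inner ℝ (e k) y = inner ℝ x y := h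
  rw [← h']
  simp only [real_inner_comm y]
  ring

section Function

variable {u : 𝔤 → ℝ} {a : Fin m → 𝔤 → ℝ} {A : Fin m → Fin m → 𝔤 → ℝ}

/-- On the boundary, the horizontal gradient of a function that vanishes there is a multiple of the
horizontal normal. -/
theorem exists_eq_mul_inner_outerNormal (hΩ : IsC2BoundedOpen Ω)
    (hu : ContDiffOn ℝ 1 u (exp ⁻¹' closure Ω))
    (hu0 : ∀ ξ : 𝔤, exp ξ ∈ frontier Ω → u ξ = 0)
    (ha : ∀ i, ContinuousOn (a i) (exp ⁻¹' closure Ω))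
    (hda : ∀ i, ∀ ξ : 𝔤, exp ξ ∈ Ω →
      HasDerivAt (fun t : ℝ => u (ξ + t • frame ξ (X i))) (a i ξ) 0)
    {g : StepTwoGroup S} (hg : g ∈ frontier Ω) :
    ∃ k : ℝ, ∀ i, a i g.log = k * inner ℝ (outerNormal Ω g) (X i : 𝔤) := by
  have hO : IsOpen (exp ⁻¹' Ω : Set 𝔤) := hΩ.isOpen.preimage continuous_exp
  have hgK : g.log ∈ closure (exp ⁻¹' Ω : Set 𝔤) := by
    rw [← exp_preimage_closure]; exact frontier_subset_closure hg
  rw [exp_preimage_closure] at hu ha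
  obtain ⟨D, hD, hDX⟩ := exists_fderivWithin_eq_of_line_deriv hO hu hgK
  -- The derivative of `u` along a boundary curve with this velocity is zero because `u` vanishes on
  -- the boundary.
  have htan : ∀ v : 𝔤, inner ℝ (outerNormal Ω g) v = 0 → D (frame g.log v) = 0 := by
    intro v hv
    obtain ⟨γ, hγ0, hγd, hγ⟩ := hΩ.exists_boundary_curve hg hv
    have h1 : HasDerivWithinAt (fun t => u (γ t)) (D (frame g.log v))
        {t | exp (γ t) ∈ frontier Ω} 0 := by
      rw [← hγ0] at hD
      refine hD.comp_hasDerivWithinAt (0 : ℝ) (hγ0 ▸ hγd.hasDerivWithinAt) fun t ht => ?_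
      rw [← exp_preimage_closure]
      exact frontier_subset_closure ht
    have h2 := (h1.hasDerivAt hγ)
    have h3 : (fun t => u (γ t)) =ᶠ[𝓝 0] fun _ => 0 := by
      filter_upwards [hγ] with t ht using hu0 _ ht
    exact h2.unique ((hasDerivAt_const (0 : ℝ) (0 : ℝ)).congr_of_eventuallyEq h3)
  refine ⟨D (frame g.log (outerNormal Ω g)), fun i => ?_⟩
  rw [← hDX (X i) (a i) (ha i) (hda i)]
  -- The tangential part of `X i`; only its normal part contributes to the derivative of `u`.
  have h1 := htan ((X i : 𝔤) - inner ℝ (outerNormal Ω g) (X i : 𝔤) • outerNormal Ω g) (by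
    rw [inner_sub_right, inner_smul_right, real_inner_self_eq_norm_sq, hΩ.norm_outerNormal hg]
    ring)
  rw [map_sub, map_sub, map_smul, map_smul, smul_eq_mul] at h1
  linarith

/-- The derivative of `⟨∇_H u, Y⟩ = 0` in the direction `Y`, for a horizontal tangent field
`Y`. -/
theorem hessian_add_inner_deriv_eq_zero (hΩ : IsC2BoundedOpen Ω)
    (hu : ContDiffOn ℝ 2 u (exp ⁻¹' closure Ω))
    (hu0 : ∀ ξ : 𝔤, exp ξ ∈ frontier Ω → u ξ = 0)
    (ha : ∀ i, ContinuousOn (a i) (exp ⁻¹' closure Ω))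
    (hA : ∀ i j, ContinuousOn (A i j) (exp ⁻¹' closure Ω))
    (hda : ∀ i, ∀ ξ : 𝔤, exp ξ ∈ Ω →
      HasDerivAt (fun t : ℝ => u (ξ + t • frame ξ (X i))) (a i ξ) 0)
    (hdA : ∀ i j, ∀ ξ : 𝔤, exp ξ ∈ Ω →
      HasDerivAt (fun t : ℝ => a i (ξ + t • frame ξ (X j))) (A i j ξ) 0)
    {g : StepTwoGroup S} (hg : g ∈ frontier Ω) {U : Set (StepTwoGroup S)} (hU : IsOpen U)
    (hgU : g ∈ U) {Y : StepTwoGroup S → 𝔤}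
    (hY : ContDiffOn ℝ 1 (fun ξ : 𝔤 => Y (exp ξ)) (exp ⁻¹' U))
    (hYt : ∀ h ∈ U ∩ frontier Ω, Y h ∈ S.V₁ ∧ inner ℝ (outerNormal Ω h) (Y h) = 0) :
    ∑ i, ∑ j, A i j g.log * (inner ℝ (X i : 𝔤) (Y g) * inner ℝ (X j : 𝔤) (Y g))
      + ∑ i, a i g.log * inner ℝ (X i : 𝔤) (deriv (fun t : ℝ => Y (g * exp (t • Y g))) 0) = 0 := by
  have hO : IsOpen (exp ⁻¹' Ω : Set 𝔤) := hΩ.isOpen.preimage continuous_exp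
  have hgK : g.log ∈ closure (exp ⁻¹' Ω : Set 𝔤) := by
    rw [← exp_preimage_closure]; exact frontier_subset_closure hg
  have hYg := hYt g ⟨hgU, hg⟩
  have ha' := ha
  have hu1 : ContDiffOn ℝ 1 u (exp ⁻¹' closure Ω) := hu.of_le (by norm_num)
  rw [exp_preimage_closure] at hu ha hA
  have haC : ∀ i, ContDiffOn ℝ 1 (a i) (closure (exp ⁻¹' Ω : Set 𝔤)) := fun i => by
    have hu' : ContDiffOn ℝ ((1 : ℕ) + 1) u (closure (exp ⁻¹' Ω : Set 𝔤)) := by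
      convert hu using 1; norm_num
    exact_mod_cast contDiffOn_of_line_deriv hO hu' (X i) (ha i) (hda i)
  choose D hD hDX using fun i => exists_fderivWithin_eq_of_line_deriv hO (haC i) hgK
  obtain ⟨γ, hγ0, hγd, hγ⟩ := hΩ.exists_boundary_curve hg hYg.2
  -- the derivative of `Y`
  have hYd : HasFDerivAt (fun ξ : 𝔤 => Y (exp ξ)) (fderiv ℝ (fun ξ : 𝔤 => Y (exp ξ)) g.log)
      g.log := ((hY.contDiffAt ((hU.preimage continuous_exp).mem_nhds hgU)).differentiableAt
        one_ne_zero).hasFDerivAt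
  have hYline : deriv (fun t : ℝ => Y (g * exp (t • Y g))) 0
      = fderiv ℝ (fun ξ : 𝔤 => Y (exp ξ)) g.log (frame g.log (Y g)) := by
    simp only [mul_exp_smul]
    exact (hasDerivAt_comp_line hYd _).deriv
  have hYγ : HasDerivAt (fun t => Y (exp (γ t)))
      (deriv (fun t : ℝ => Y (g * exp (t • Y g))) 0) 0 := by
    rw [hYline]
    have h1 := hYd
    conv at h1 => rw [← hγ0]
    have h2 := h1.comp_hasDerivAt (0 : ℝ) hγd
    rw [hγ0] at h2
    exact h2
  -- the derivative of `X_i u`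
  have haγ : ∀ i, HasDerivAt (fun t => a i (γ t))
      (∑ j, A i j g.log * inner ℝ (X j : 𝔤) (Y g)) 0 := by
    intro i
    have h0 : D i (frame g.log (Y g)) = ∑ j, A i j g.log * inner ℝ (X j : 𝔤) (Y g) := by
      conv_lhs => rw [eq_sum_inner_smul X hYg.1, map_sum, map_sum]
      refine Finset.sum_congr rfl fun j _ => ?_
      rw [map_smul, map_smul, hDX i (X j) (A i j) (hA i j) (hdA i j), smul_eq_mul, mul_comm]
    rw [← h0]
    have h1 : HasDerivWithinAt (fun t => a i (γ t)) (D i (frame g.log (Y g)))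
        {t | exp (γ t) ∈ frontier Ω} 0 := by
      have hDi := hD i
      rw [← hγ0] at hDi
      refine hDi.comp_hasDerivWithinAt (0 : ℝ) (hγ0 ▸ hγd.hasDerivWithinAt) fun t ht => ?_
      rw [← exp_preimage_closure]
      exact frontier_subset_closure ht
    exact h1.hasDerivAt hγ
  have hF : HasDerivAt (fun t => ∑ i, a i (γ t) * inner ℝ (X i : 𝔤) (Y (exp (γ t))))
      (∑ i, ((∑ j, A i j g.log * inner ℝ (X j : 𝔤) (Y g)) * inner ℝ (X i : 𝔤) (Y g)
        + a i g.log * inner ℝ (X i : 𝔤) (deriv (fun t : ℝ => Y (g * exp (t • Y g))) 0))) 0 := by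
    refine HasDerivAt.fun_sum fun i _ => ?_
    have h1 : HasDerivAt (fun t => inner ℝ (X i : 𝔤) (Y (exp (γ t))))
        (inner ℝ (X i : 𝔤) (deriv (fun t : ℝ => Y (g * exp (t • Y g))) 0)) 0 := by
      simpa using (hasDerivAt_const (0 : ℝ) (X i : 𝔤)).inner ℝ hYγ
    have h2 := (haγ i).mul h1
    rw [hγ0] at h2
    exact h2
  -- Along the boundary curve `∇_H u` is a multiple of the horizontal normal, to which the tangent
  -- field `Y` is orthogonal.
  have hF0 : (fun t => ∑ i, a i (γ t) * inner ℝ (X i : 𝔤) (Y (exp (γ t)))) =ᶠ[𝓝 0]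
      fun _ => 0 := by
    have hγU : ∀ᶠ t in 𝓝 0, exp (γ t) ∈ U := by
      have h1 : Tendsto (fun t => (exp (γ t) : StepTwoGroup S)) (𝓝 0) (𝓝 (exp (γ 0))) :=
        (continuous_exp.tendsto _).comp hγd.continuousAt.tendsto
      rw [hγ0] at h1
      exact h1.eventually (hU.mem_nhds hgU)
    filter_upwards [hγ, hγU] with t ht htU
    obtain ⟨k, hk⟩ := exists_eq_mul_inner_outerNormal X hΩ hu1 hu0 ha' hda ht
    obtain ⟨hV, hperp⟩ := hYt _ ⟨htU, ht⟩
    have hk' : ∀ i, a i (γ t) = k * inner ℝ (outerNormal Ω (exp (γ t))) (X i : 𝔤) := hk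
    simp only [hk', mul_assoc]
    rw [← Finset.mul_sum, sum_inner_mul_inner X _ hV, hperp, mul_zero]
  have h := hF.unique ((hasDerivAt_const (0 : ℝ) (0 : ℝ)).congr_of_eventuallyEq hF0)
  rw [Finset.sum_add_distrib] at h
  refine Eq.trans ?_ h
  congr 1
  refine Finset.sum_congr rfl fun i _ => ?_
  rw [Finset.sum_mul]
  exact Finset.sum_congr rfl fun j _ => by ring

/-- At a noncharacteristic boundary point, the horizontal mean curvature of the boundary in terms
of the second derivatives of a function that vanishes on the boundary. -/
theorem mul_meanCurvatureOffChar_eq (hΩ : IsC2BoundedOpen Ω)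
    (hu : ContDiffOn ℝ 2 u (exp ⁻¹' closure Ω))
    (hu0 : ∀ ξ : 𝔤, exp ξ ∈ frontier Ω → u ξ = 0)
    (ha : ∀ i, ContinuousOn (a i) (exp ⁻¹' closure Ω))
    (hA : ∀ i j, ContinuousOn (A i j) (exp ⁻¹' closure Ω))
    (hda : ∀ i, ∀ ξ : 𝔤, exp ξ ∈ Ω →
      HasDerivAt (fun t : ℝ => u (ξ + t • frame ξ (X i))) (a i ξ) 0)
    (hdA : ∀ i j, ∀ ξ : 𝔤, exp ξ ∈ Ω →
      HasDerivAt (fun t : ℝ => a i (ξ + t • frame ξ (X j))) (A i j ξ) 0)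
    {g : StepTwoGroup S} (hg : g ∈ frontier Ω) (hW : angle Ω g ≠ 0) {k : ℝ}
    (hk : ∀ i, a i g.log = k * inner ℝ (outerNormal Ω g) (X i : 𝔤)) :
    k * angle Ω g ^ 3 * meanCurvatureOffChar Ω g
      = ∑ i, ∑ j, A i j g.log * (inner ℝ (outerNormal Ω g) (X i : 𝔤) *
          inner ℝ (outerNormal Ω g) (X j : 𝔤)) - angle Ω g ^ 2 * ∑ i, A i i g.log := by
  have hex := hΩ.exists_horizontalTangentFrame hg hW
  rw [meanCurvatureOffChar, dif_pos hex]
  obtain ⟨U, hU, hgU, hC, hfr⟩ := hex.choose_spec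
  set e := hex.choose
  obtain ⟨hon, het⟩ := hfr g ⟨hgU, hg⟩
  set ν := outerNormal Ω g with hν
  set W := angle Ω g with hWdef
  set b := horizontalGaussMap Ω g with hb
  have hbV : b ∈ S.V₁ := horizontalGaussMap_mem g
  have hb1 : ‖b‖ = 1 := by
    rw [hb, horizontalGaussMap, norm_smul, norm_inv, ← hWdef, Real.norm_eq_abs,
      abs_of_nonneg (show 0 ≤ W from norm_nonneg _)]
    exact inv_mul_cancel₀ hW
  have hbin : ∀ y ∈ S.V₁, inner ℝ b y = W⁻¹ * inner ℝ ν y := fun y hy => by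
    rw [hb, horizontalGaussMap, inner_smul_left, inner_horizontalNormal hy]; rfl
  have hfin : finrank ℝ S.V₁ = finrank ℝ S.V₁ - 1 + 1 := by
    have : Nontrivial S.V₁ := ⟨⟨b, hbV⟩, 0, fun h0 => by
      have : b = 0 := congrArg Subtype.val h0
      rw [this, norm_zero] at hb1
      exact zero_ne_one hb1⟩
    have := finrank_pos (R := ℝ) (M := S.V₁)
    omega
  -- The summand of the curvature for `e_l` is minus the second derivative of `u` in the direction
  -- `e_l`, because `∇_H u = k W b`.
  have hterm : ∀ l, k * W * inner ℝ (horizontalConnection (e l g) (e l) g) b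
      = - ∑ i, ∑ j, A i j g.log * (inner ℝ (X i : 𝔤) (e l g) * inner ℝ (X j : 𝔤) (e l g)) := by
    intro l
    have h1 := hessian_add_inner_deriv_eq_zero X hΩ hu hu0 ha hA hda hdA hg hU hgU (hC l)
      fun h hh => (hfr h hh).2 l
    rw [inner_horizontalConnection_self (het l).1]
    set d := deriv (fun t : ℝ => e l (g * exp (t • e l g))) 0
    have h2 : ∑ i, a i g.log * inner ℝ (X i : 𝔤) d = k * W * inner ℝ d b := by
      have h3 : inner ℝ d b = ∑ i, inner ℝ d (X i : 𝔤) * inner ℝ (X i : 𝔤) b :=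
        (sum_inner_mul_inner X d hbV).symm
      rw [h3, Finset.mul_sum]
      refine Finset.sum_congr rfl fun i _ => ?_
      rw [hk, real_inner_comm b (X i : 𝔤), hbin _ (X i).2, real_inner_comm d]
      field_simp
    rw [h2] at h1
    linarith
  -- The frame resolves the identity on the complement of `b` in the first layer; the components of
  -- `b` are those of the outer normal divided by `W`.
  have hsum : ∀ i j, ∑ l, inner ℝ (X i : 𝔤) (e l g) * inner ℝ (X j : 𝔤) (e l g)
      = inner ℝ (X i : 𝔤) (X j : 𝔤) - (W⁻¹ * inner ℝ ν (X i : 𝔤)) * (W⁻¹ * inner ℝ ν (X j : 𝔤)) := by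
    intro i j
    rw [sum_inner_mul_inner_frame hfin hon (fun l => (het l).1) hb1 hbV
      (fun l => by rw [hbin _ (het l).1, (het l).2, mul_zero]) (X i).2 (X j).2,
      real_inner_comm b (X i : 𝔤), real_inner_comm b (X j : 𝔤), hbin _ (X i).2, hbin _ (X j).2]
  have hXX : ∀ i j, inner ℝ (X i : 𝔤) (X j : 𝔤) = if i = j then (1 : ℝ) else 0 := fun i j =>
    orthonormal_iff_ite.1 X.orthonormal i j
  have hmain : k * W * ∑ l, inner ℝ (horizontalConnection (e l g) (e l) g) b
      = - (∑ i, A i i g.log - (W⁻¹) ^ 2 * ∑ i, ∑ j, A i j g.log *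
        (inner ℝ ν (X i : 𝔤) * inner ℝ ν (X j : 𝔤))) := by
    rw [Finset.mul_sum, Finset.sum_congr rfl fun l _ => hterm l, Finset.sum_neg_distrib,
      Finset.sum_comm]
    congr 1
    have e1 : ∀ i, ∑ l, ∑ j, A i j g.log * (inner ℝ (X i : 𝔤) (e l g) * inner ℝ (X j : 𝔤) (e l g))
        = A i i g.log - (W⁻¹) ^ 2 * ∑ j, A i j g.log *
          (inner ℝ ν (X i : 𝔤) * inner ℝ ν (X j : 𝔤)) := by
      intro i
      rw [Finset.sum_comm]
      simp only [← Finset.mul_sum, hsum, hXX, mul_sub, Finset.sum_sub_distrib]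
      congr 1
      · simp
      · rw [Finset.mul_sum]
        exact Finset.sum_congr rfl fun j _ => by ring
    rw [Finset.sum_congr rfl fun i _ => e1 i, Finset.sum_sub_distrib, Finset.mul_sum]
  have hW2 : W ^ 2 * (W⁻¹) ^ 2 = 1 := by field_simp
  linear_combination W ^ 2 * hmain + (∑ i, ∑ j, A i j g.log *
        (inner ℝ ν (X i : 𝔤) * inner ℝ ν (X j : 𝔤))) * hW2

end Function

end Carnot

namespace Carnot

open StepTwoGroup

variable {𝔤 : Type*} [EuclideanLieAlgebra 𝔤] {S : StepTwoStratification 𝔤} {m : ℕ}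
  {Ω : Set (StepTwoGroup S)}

/-! ### Horizontal derivatives on the group and integrability. -/

section LieDerivatives

/-- Needed for iterated derivatives: the inner derivative is identified with its continuous
representative only inside `Ω`, and openness lets the outer derivative be taken there. -/
theorem lieDeriv_congr {X : 𝔤} {f h : StepTwoGroup S → ℝ} (hΩ : IsOpen Ω)
    (hfh : ∀ g ∈ Ω, f g = h g) {g : StepTwoGroup S} (hg : g ∈ Ω) :
    lieDeriv X f g = lieDeriv X h g := by
  refine Filter.EventuallyEq.deriv_eq ?_
  simp only [mul_exp_smul]
  have h1 : Tendsto (fun t : ℝ => (exp (g.log + t • frame g.log X) : StepTwoGroup S)) (𝓝 0)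
      (𝓝 g) := by
    have h2 := (hasDerivAt_line g.log (frame g.log X)).continuousAt.tendsto
    rw [zero_smul, add_zero] at h2
    exact (continuous_exp.tendsto _).comp h2
  filter_upwards [h1.eventually (hΩ.mem_nhds hg)] with t ht using hfh _ ht

theorem lieDeriv_eq_of_hasDerivAt {X : 𝔤} {f : StepTwoGroup S → ℝ} {g : StepTwoGroup S} {d : ℝ}
    (h : HasDerivAt (fun t : ℝ => f (g * exp (t • X))) d 0) : lieDeriv X f g = d := h.deriv

theorem lieDeriv_lieDeriv_eq (hΩ : IsOpen Ω) {X Y : 𝔤} {f h : StepTwoGroup S → ℝ}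
    {g : StepTwoGroup S} {d : ℝ} (hg : g ∈ Ω)
    (hf : ∀ g ∈ Ω, HasDerivAt (fun t : ℝ => f (g * exp (t • Y))) (h g) 0)
    (hh : HasDerivAt (fun t : ℝ => h (g * exp (t • X))) d 0) :
    lieDeriv X (lieDeriv Y f) g = d := by
  rw [lieDeriv_congr hΩ (fun g hg => lieDeriv_eq_of_hasDerivAt (hf g hg)) hg]
  exact lieDeriv_eq_of_hasDerivAt hh

theorem IsC2BoundedOpen.integrableOn_haar [MeasurableSpace 𝔤] [BorelSpace 𝔤]
    (hΩ : IsC2BoundedOpen Ω) {F H : StepTwoGroup S → ℝ} (hH : ContinuousOn H (closure Ω))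
    (hFH : ∀ g ∈ Ω, F g = H g) : IntegrableOn F Ω (haar S) := by
  rw [integrableOn_haar_iff]
  have h1 : ContinuousOn (fun ξ : 𝔤 => H (exp ξ)) (exp ⁻¹' closure Ω) :=
    hH.comp continuous_exp.continuousOn fun _ h => h
  have h2 := (h1.integrableOn_compact (μ := volume) hΩ.isCompact_coord_closure).mono_set
    (Set.preimage_mono (f := (exp : 𝔤 → StepTwoGroup S)) (subset_closure (s := Ω)))
  exact h2.congr_fun (fun ξ hξ => (hFH _ hξ).symm)
    (hΩ.isOpen.preimage continuous_exp).measurableSet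

end LieDerivatives

/-! ### The Bochner field, its divergence and its boundary flux. -/

section Flux

variable (X : OrthonormalBasis (Fin m) ℝ S.V₁)
  {u : StepTwoGroup S → ℝ} {a : Fin m → StepTwoGroup S → ℝ}
  {A : Fin m → Fin m → StepTwoGroup S → ℝ} {B : Fin m → Fin m → Fin m → StepTwoGroup S → ℝ}

/-- The components of the horizontal vector field whose divergence is the integrand of the
Bochner type identity. -/
def flux (a : Fin m → StepTwoGroup S → ℝ) (A : Fin m → Fin m → StepTwoGroup S → ℝ) (i : Fin m)
    (g : StepTwoGroup S) : ℝ :=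
  a i g * ∑ k, A k k g - ∑ j, a j g * (2 * A i j g - A j i g)

/-- The derivative of the `i`-th component of `flux` in the direction `X i`. -/
def fluxDeriv (a : Fin m → StepTwoGroup S → ℝ) (A : Fin m → Fin m → StepTwoGroup S → ℝ)
    (B : Fin m → Fin m → Fin m → StepTwoGroup S → ℝ) (i : Fin m) (g : StepTwoGroup S) : ℝ :=
  (A i i g * ∑ k, A k k g + a i g * ∑ k, B k k i g)
    - ∑ j, (A j i g * (2 * A i j g - A j i g) + a j g * (2 * B i j i g - B j i i g))

theorem continuousOn_flux {K : Set (StepTwoGroup S)} (ha : ∀ i, ContinuousOn (a i) K)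
    (hA : ∀ i j, ContinuousOn (A i j) K) (i : Fin m) : ContinuousOn (flux a A i) K :=
  ((ha i).mul (continuousOn_finsetSum _ fun k _ => hA k k)).sub
    (continuousOn_finsetSum _ fun j _ => (ha j).mul
      ((continuousOn_const.mul (hA i j)).sub (hA j i)))

theorem continuousOn_fluxDeriv {K : Set (StepTwoGroup S)} (ha : ∀ i, ContinuousOn (a i) K)
    (hA : ∀ i j, ContinuousOn (A i j) K) (hB : ∀ i j k, ContinuousOn (B i j k) K) (i : Fin m) :
    ContinuousOn (fluxDeriv a A B i) K := by
  refine (((hA i i).mul (continuousOn_finsetSum _ fun k _ => hA k k)).add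
    ((ha i).mul (continuousOn_finsetSum _ fun k _ => hB k k i))).sub
    (continuousOn_finsetSum _ fun j _ => ?_)
  exact ((hA j i).mul ((continuousOn_const.mul (hA i j)).sub (hA j i))).add
    ((ha j).mul ((continuousOn_const.mul (hB i j i)).sub (hB j i i)))

/-- With `A i j = X_j X_i u` and `B i j k = X_k X_j X_i u`, the last bracket is `[X_i, [X_i, X_j]]
u`. It is left standing here, since it vanishes only almost everywhere by the weak argument. -/
theorem sum_fluxDeriv (g : StepTwoGroup S) :
    ∑ i, fluxDeriv a A B i g
      = ((∑ i, A i i g) ^ 2 - ∑ i, ∑ j, (2 * A j i g * A i j g - A j i g ^ 2))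
        + ∑ i, ∑ j, a j g * (B i i j g - 2 * B i j i g + B j i i g) := by
  simp only [fluxDeriv, Finset.sum_sub_distrib, Finset.sum_add_distrib, mul_sub, mul_add]
  have h1 : ∑ i, A i i g * ∑ k, A k k g = (∑ i, A i i g) ^ 2 := by rw [← Finset.sum_mul, sq]
  have h2 : ∑ i, a i g * ∑ k, B k k i g = ∑ i, ∑ j, a j g * B i i j g := by
    simp only [Finset.mul_sum]
    exact Finset.sum_comm
  have h3 : ∑ i, ∑ j, A j i g * (2 * A i j g) = ∑ i, ∑ j, 2 * A j i g * A i j g :=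
    Finset.sum_congr rfl fun i _ => Finset.sum_congr rfl fun j _ => by ring
  have h4 : ∑ i, ∑ j, A j i g * A j i g = ∑ i, ∑ j, A j i g ^ 2 :=
    Finset.sum_congr rfl fun i _ => Finset.sum_congr rfl fun j _ => by ring
  rw [h1, h2, h3, h4]
  ring

/-- Write `c = s + κ` with `s` symmetric and `κ` antisymmetric: the right side is `-∑ s² + 3 ∑ κ²`.
Since `κ` is half of a commutator entry, `3 κ²` becomes `3/4` of its square. -/
theorem sum_symmetrized_eq (c : Fin m → Fin m → ℝ) :
    - (∑ i, ∑ j, ((c j i + c i j) / 2) ^ 2) + 3 / 4 * ∑ i, ∑ j, (c j i - c i j) ^ 2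
      = - ∑ i, ∑ j, (2 * c j i * c i j - c j i ^ 2) := by
  have h1 : ∑ i, ∑ j, c i j ^ 2 = ∑ i, ∑ j, c j i ^ 2 := Finset.sum_comm
  have h2 : ∑ i, ∑ j, ((c j i + c i j) / 2) ^ 2
      = 1 / 4 * ∑ i, ∑ j, c j i ^ 2 + 1 / 4 * ∑ i, ∑ j, c i j ^ 2
        + 1 / 2 * ∑ i, ∑ j, c j i * c i j := by
    simp only [Finset.mul_sum, ← Finset.sum_add_distrib]
    exact Finset.sum_congr rfl fun i _ => Finset.sum_congr rfl fun j _ => by ring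
  have h3 : ∑ i, ∑ j, (c j i - c i j) ^ 2
      = ∑ i, ∑ j, c j i ^ 2 + ∑ i, ∑ j, c i j ^ 2 - 2 * ∑ i, ∑ j, c j i * c i j := by
    simp only [Finset.mul_sum, ← Finset.sum_add_distrib, ← Finset.sum_sub_distrib]
    exact Finset.sum_congr rfl fun i _ => Finset.sum_congr rfl fun j _ => by ring
  have h4 : ∑ i, ∑ j, (2 * c j i * c i j - c j i ^ 2)
      = 2 * ∑ i, ∑ j, c j i * c i j - ∑ i, ∑ j, c j i ^ 2 := by
    simp only [Finset.mul_sum, ← Finset.sum_sub_distrib]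
    exact Finset.sum_congr rfl fun i _ => Finset.sum_congr rfl fun j _ => by ring
  rw [h2, h3, h4, h1]
  ring

theorem hasDerivAt_flux {v : Fin m → 𝔤} {g : StepTwoGroup S}
    (hdA : ∀ i j, HasDerivAt (fun t : ℝ => a i (g * exp (t • v j))) (A i j g) 0)
    (hdB : ∀ i j k, HasDerivAt (fun t : ℝ => A i j (g * exp (t • v k))) (B i j k g) 0)
    (i : Fin m) : HasDerivAt (fun t : ℝ => flux a A i (g * exp (t • v i)))
      (fluxDeriv a A B i g) 0 := by
  have h0 : g * exp ((0 : ℝ) • v i) = g := by rw [mul_exp_smul, zero_smul, add_zero]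
  have h1 := (hdA i i).mul (HasDerivAt.fun_sum fun k (_ : k ∈ Finset.univ) => hdB k k i)
  have h2 := HasDerivAt.fun_sum fun j (_ : j ∈ Finset.univ) =>
    (hdA j i).mul (((hdB i j i).const_mul 2).sub (hdB j i i))
  have h3 := h1.sub h2
  simp only [Pi.sub_apply, h0] at h3
  exact h3

/-- The flux through the boundary is, up to sign, the mean curvature integrand. -/
theorem angle_mul_meanCurvature_eq_abs_flux (hΩ : IsC2BoundedOpen Ω)
    (hu : IsCkOn 2 u (closure Ω)) (hu0 : ∀ g ∈ frontier Ω, u g = 0)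
    (ha : ∀ i, ContinuousOn (a i) (closure Ω)) (hA : ∀ i j, ContinuousOn (A i j) (closure Ω))
    (hda : ∀ i, ∀ g ∈ Ω, HasDerivAt (fun t : ℝ => u (g * exp (t • (X i : 𝔤)))) (a i g) 0)
    (hdA : ∀ i j, ∀ g ∈ Ω, HasDerivAt (fun t : ℝ => a i (g * exp (t • (X j : 𝔤)))) (A i j g) 0)
    {g : StepTwoGroup S} (hg : g ∈ frontier Ω) :
    angle Ω g * (|meanCurvature Ω g| * ∑ i, a i g ^ 2)
      = |∑ i, flux a A i g * inner ℝ (outerNormal Ω g) (X i : 𝔤)| := by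
  have hu' : ContDiffOn ℝ 2 (fun ξ : 𝔤 => u (exp ξ)) (exp ⁻¹' closure Ω) := hu
  have ha' : ∀ i, ContinuousOn (fun ξ : 𝔤 => a i (exp ξ)) (exp ⁻¹' closure Ω) := fun i =>
    (ha i).comp continuous_exp.continuousOn fun _ h => h
  have hA' : ∀ i j, ContinuousOn (fun ξ : 𝔤 => A i j (exp ξ)) (exp ⁻¹' closure Ω) := fun i j =>
    (hA i j).comp continuous_exp.continuousOn fun _ h => h
  simp only [mul_exp_smul] at hda hdA
  have hsq : ∑ i, inner ℝ (outerNormal Ω g) (X i : 𝔤) ^ 2 = angle Ω g ^ 2 :=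
    sum_inner_sq_eq_norm_starProjection_sq X _
  -- At characteristic points both sides are zero, whatever value the curvature is given there.
  by_cases hW : angle Ω g = 0
  · have hn : ∀ i, inner ℝ (outerNormal Ω g) (X i : 𝔤) = 0 := fun i => by
      have h0 : horizontalNormal Ω g = 0 := norm_eq_zero.1 hW
      rw [← inner_horizontalNormal (X i).2, h0, inner_zero_left]
    simp [hW, hn]
  · obtain ⟨k, hk⟩ := exists_eq_mul_inner_outerNormal X hΩ (hu'.of_le (by norm_num))
      (fun ξ hξ => hu0 _ hξ) ha' (fun i ξ hξ => hda i _ hξ) hg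
    have hH := mul_meanCurvatureOffChar_eq X hΩ hu' (fun ξ hξ => hu0 _ hξ) ha' hA'
      (fun i ξ hξ => hda i _ hξ) (fun i j ξ hξ => hdA i j _ hξ) hg hW hk
    have hmc : meanCurvature Ω g = meanCurvatureOffChar Ω g := by
      rw [meanCurvature, if_neg]
      exact fun h => hW h.2
    have hk' : ∀ i, a i g = k * inner ℝ (outerNormal Ω g) (X i : 𝔤) := hk
    set n : Fin m → ℝ := fun i => inner ℝ (outerNormal Ω g) (X i : 𝔤) with hn
    have hA'' : ∑ i, ∑ j, A i j g * (n i * n j) - angle Ω g ^ 2 * ∑ i, A i i g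
        = k * angle Ω g ^ 3 * meanCurvatureOffChar Ω g := hH.symm
    have hflux : ∑ i, flux a A i g * n i
        = - (k ^ 2 * angle Ω g ^ 3 * meanCurvatureOffChar Ω g) := by
      -- Against the symmetric matrix `n i * n j` the order of derivatives is irrelevant, so the
      -- weights `2` and `-1` in the flux act as a single `1`.
      have e1 : ∑ i, ∑ j, A j i g * (n i * n j) = ∑ i, ∑ j, A i j g * (n i * n j) := by
        rw [Finset.sum_comm]
        exact Finset.sum_congr rfl fun i _ => Finset.sum_congr rfl fun j _ => by ring
      have e2 : ∑ i, flux a A i g * n i = k * ((∑ i, n i ^ 2) * ∑ i, A i i g)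
          - k * (2 * ∑ i, ∑ j, A i j g * (n i * n j) - ∑ i, ∑ j, A j i g * (n i * n j)) := by
        rw [Finset.sum_mul]
        simp only [Finset.mul_sum (Finset.univ) _ k, Finset.mul_sum (Finset.univ) _ (2 : ℝ),
          ← Finset.sum_sub_distrib]
        refine Finset.sum_congr rfl fun i _ => ?_
        rw [flux, hk', sub_mul, Finset.sum_mul]
        congr 1
        · change k * n i * _ * n i = _
          ring
        · refine Finset.sum_congr rfl fun j _ => ?_
          rw [hk']
          change k * n j * _ * n i = _
          ring
      have hsq' : ∑ i, n i ^ 2 = angle Ω g ^ 2 := hsq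
      rw [e2, e1, hsq']
      linear_combination (-k) * hA''
    have hgrad : ∑ i, a i g ^ 2 = k ^ 2 * angle Ω g ^ 2 := by
      rw [← hsq, Finset.mul_sum]
      exact Finset.sum_congr rfl fun i _ => by rw [hk', mul_pow]
    change _ = |∑ i, flux a A i g * n i|
    rw [hflux, hgrad, hmc, abs_neg, abs_mul, abs_of_nonneg (a := k ^ 2 * angle Ω g ^ 3)
      (mul_nonneg (sq_nonneg _) (pow_nonneg (norm_nonneg _) 3))]
    ring

variable [MeasurableSpace 𝔤] [BorelSpace 𝔤]

/-- The integrated Bochner type identity. -/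
theorem integral_bochner_eq (hΩ : IsC2BoundedOpen Ω)
    (hu : ContinuousOn u (closure Ω)) (ha : ∀ i, ContinuousOn (a i) (closure Ω))
    (hA : ∀ i j, ContinuousOn (A i j) (closure Ω))
    (hB : ∀ i j k, ContinuousOn (B i j k) (closure Ω))
    (hda : ∀ i, ∀ g ∈ Ω, HasDerivAt (fun t : ℝ => u (g * exp (t • (X i : 𝔤)))) (a i g) 0)
    (hdA : ∀ i j, ∀ g ∈ Ω, HasDerivAt (fun t : ℝ => a i (g * exp (t • (X j : 𝔤)))) (A i j g) 0)
    (hdB : ∀ i j k, ∀ g ∈ Ω,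
      HasDerivAt (fun t : ℝ => A i j (g * exp (t • (X k : 𝔤)))) (B i j k g) 0) :
    ∫ g in Ω, ((∑ i, A i i g) ^ 2 - ∑ i, ∑ j, (2 * A j i g * A i j g - A j i g ^ 2)) ∂(haar S)
      = ∫ g, ∑ i, flux a A i g * inner ℝ (outerNormal Ω g) (X i : 𝔤)
          ∂(surfaceMeasure (frontier Ω)) := by
  have hO : IsOpen (exp ⁻¹' Ω : Set 𝔤) := hΩ.isOpen.preimage continuous_exp
  have hcomp : ∀ {F : StepTwoGroup S → ℝ}, ContinuousOn F (closure Ω) →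
      ContinuousOn (fun ξ : 𝔤 => F (exp ξ)) (exp ⁻¹' closure Ω) := fun hF =>
    hF.comp continuous_exp.continuousOn fun _ h => h
  have hsub : (exp ⁻¹' Ω : Set 𝔤) ⊆ exp ⁻¹' closure Ω := Set.preimage_mono subset_closure
  have hcompO : ∀ {F : StepTwoGroup S → ℝ}, ContinuousOn F (closure Ω) →
      ContinuousOn (fun ξ : 𝔤 => F (exp ξ)) (exp ⁻¹' Ω) := fun hF => (hcomp hF).mono hsub
  have hdiv : ∀ i, ∫ ξ in exp ⁻¹' Ω, fluxDeriv a A B i (exp ξ : StepTwoGroup S)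
      = ∫ g, flux a A i g * inner ℝ (outerNormal Ω g) (X i : 𝔤)
          ∂(surfaceMeasure (frontier Ω)) := fun i => by
    refine integral_eq_integral_boundary hΩ (X i) (f := fun ξ => flux a A i (exp ξ))
      (hcomp (continuousOn_flux ha hA i)) (hcomp (continuousOn_fluxDeriv ha hA hB i))
      fun ξ hξ => ?_
    have h1 := hasDerivAt_flux (v := fun i => (X i : 𝔤)) (fun i j => hdA i j _ hξ)
      (fun i j k => hdB i j k _ hξ) i
    simp only [mul_exp_smul] at h1
    exact h1
  simp only [mul_exp_smul] at hda hdA hdB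
  -- The only use of step two in the identity: it removes the third-order terms almost everywhere,
  -- which is enough under the integral.
  have hcubic : ∀ i j, ∀ᵐ ξ : 𝔤, ξ ∈ (exp ⁻¹' Ω : Set 𝔤) →
      B i i j (exp ξ) - 2 * B i j i (exp ξ) + B j i i (exp ξ) = 0 := fun i j =>
    cubic_commutator_ae_eq_zero S (X i : 𝔤) (X j : 𝔤) hO (hcompO hu) (hcompO (ha i))
      (hcompO (ha j)) (hcompO (hA i i)) (hcompO (hA i j)) (hcompO (hA j i)) (hcompO (hB i i j))
      (hcompO (hB i j i)) (hcompO (hB j i i)) (fun ξ hξ => hda i _ hξ) (fun ξ hξ => hda j _ hξ)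
      (fun ξ hξ => hdA i i _ hξ) (fun ξ hξ => hdA i j _ hξ) (fun ξ hξ => hdA j i _ hξ)
      (fun ξ hξ => hdB i i j _ hξ) (fun ξ hξ => hdB i j i _ hξ) (fun ξ hξ => hdB j i i _ hξ)
  rw [setIntegral_haar, integral_finsetSum, ← Finset.sum_congr rfl fun i _ => hdiv i,
    ← integral_finsetSum]
  · refine setIntegral_congr_ae hO.measurableSet ?_
    have hall : ∀ᵐ ξ : 𝔤, ∀ i j, ξ ∈ (exp ⁻¹' Ω : Set 𝔤) →
      B i i j (exp ξ) - 2 * B i j i (exp ξ) + B j i i (exp ξ) = 0 :=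
      ae_all_iff.2 fun i => ae_all_iff.2 fun j => hcubic i j
    filter_upwards [hall] with ξ hξ hξO
    rw [sum_fluxDeriv]
    simp [hξ _ _ hξO]
  · exact fun i _ => ((hcomp (continuousOn_fluxDeriv ha hA hB i)).integrableOn_compact
      hΩ.isCompact_coord_closure).mono_set hsub
  · exact fun i _ => hΩ.integrable_surfaceMeasure
      (((continuousOn_flux ha hA i).mono frontier_subset_closure).mul
        (hΩ.continuousOn_outerNormal.inner continuousOn_const))

end Flux

end Carnot

/-! ### The perimeter measure and the conclusion. -/

namespace Carnot

open StepTwoGroup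

variable {𝔤 : Type*} [EuclideanLieAlgebra 𝔤] {S : StepTwoStratification 𝔤} {m : ℕ}
  {Ω : Set (StepTwoGroup S)}

/-- The representatives are continuous on the closure and agree with the Lie derivatives in `Ω`, so
they compute the limits that `extendFrom` takes; the space is Hausdorff, so these limits are unique.
-/
theorem horizontalGradNormSq_eq {v : Fin m → 𝔤} {u : StepTwoGroup S → ℝ}
    {a : Fin m → StepTwoGroup S → ℝ} (ha : ∀ i, ContinuousOn (a i) (closure Ω))
    (hda : ∀ i, ∀ g ∈ Ω, HasDerivAt (fun t : ℝ => u (g * exp (t • v i))) (a i g) 0)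
    {g : StepTwoGroup S} (hg : g ∈ closure Ω) :
    horizontalGradNormSq v Ω u g = ∑ i, a i g ^ 2 := by
  have : T2Space (StepTwoGroup S) := (expHomeomorph S).t2Space
  refine Finset.sum_congr rfl fun i _ => ?_
  rw [extendFrom_eq hg (((ha i g hg).mono subset_closure).congr' ?_)]
  filter_upwards [self_mem_nhdsWithin] with h hh
  exact (lieDeriv_eq_of_hasDerivAt (hda i h hh)).symm

theorem IsC2BoundedOpen.continuousOn_angle (hΩ : IsC2BoundedOpen Ω) :
    ContinuousOn (angle Ω) (frontier Ω) :=
  (S.V₁.starProjection.continuous.comp_continuousOn hΩ.continuousOn_outerNormal).norm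

section Perimeter

theorem IsC2BoundedOpen.integrable_perimeterMeasure_iff
    (hΩ : IsC2BoundedOpen Ω) {F : StepTwoGroup S → ℝ} :
    Integrable F (perimeterMeasure Ω)
      ↔ Integrable (fun g => angle Ω g * F g) (surfaceMeasure (frontier Ω)) := by
  have h := integrable_withDensity_iff_integrable_smul₀ (E := ℝ)
    (hΩ.integrable_surfaceMeasure hΩ.continuousOn_angle).aemeasurable.real_toNNReal (g := F)
  refine h.trans (integrable_congr (Eventually.of_forall fun g => ?_))
  change ((angle Ω g).toNNReal : ℝ) * F g = _
  rw [Real.coe_toNNReal (angle Ω g) (norm_nonneg _)]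

theorem IsC2BoundedOpen.integral_perimeterMeasure
    (hΩ : IsC2BoundedOpen Ω) (F : StepTwoGroup S → ℝ) :
    ∫ g, F g ∂(perimeterMeasure Ω)
      = ∫ g, angle Ω g * F g ∂(surfaceMeasure (frontier Ω)) := by
  have h := integral_withDensity_eq_integral_smul₀
    (hΩ.integrable_surfaceMeasure hΩ.continuousOn_angle).aemeasurable.real_toNNReal F
  refine h.trans (integral_congr_ae (Eventually.of_forall fun g => ?_))
  change ((angle Ω g).toNNReal : ℝ) * F g = _
  rw [Real.coe_toNNReal (angle Ω g) (norm_nonneg _)]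

end Perimeter

end Carnot

open Carnot StepTwoGroup in
theorem theoremT {𝔤 : Type*} [Carnot.EuclideanLieAlgebra 𝔤] [MeasurableSpace 𝔤] [BorelSpace 𝔤]
    (S : Carnot.StepTwoStratification 𝔤) {m : ℕ} (X : OrthonormalBasis (Fin m) ℝ S.V₁)
    (Ω : Set (Carnot.StepTwoGroup S)) (hΩ : Carnot.IsC2BoundedOpen Ω)
    (u : Carnot.StepTwoGroup S → ℝ)
    (hu_Gamma : Carnot.FollandStein (fun i => (X i : 𝔤)) Ω 3 u)
    (hu_C2 : Carnot.IsCkOn 2 u (closure Ω))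
    (hu_zero : ∀ g ∈ frontier Ω, u g = 0) :
    IntegrableOn (fun g => Carnot.horizontalLaplacian (fun i => (X i : 𝔤)) u g ^ 2) Ω
        (Carnot.haar S) ∧
    IntegrableOn (fun g => Carnot.symHessianNormSq (fun i => (X i : 𝔤)) u g) Ω
        (Carnot.haar S) ∧
    (∀ i j, IntegrableOn (fun g => Carnot.commutator (X i : 𝔤) (X j : 𝔤) u g ^ 2) Ω
        (Carnot.haar S)) ∧
    Integrable (fun g => |Carnot.meanCurvature Ω g| *
        Carnot.horizontalGradNormSq (fun i => (X i : 𝔤)) Ω u g) (Carnot.perimeterMeasure Ω) ∧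
    |(∫ g in Ω, Carnot.horizontalLaplacian (fun i => (X i : 𝔤)) u g ^ 2 ∂(Carnot.haar S))
        - (∫ g in Ω, Carnot.symHessianNormSq (fun i => (X i : 𝔤)) u g ∂(Carnot.haar S))
        + (3 / 4 : ℝ) * ∑ i, ∑ j,
          ∫ g in Ω, Carnot.commutator (X i : 𝔤) (X j : 𝔤) u g ^ 2 ∂(Carnot.haar S)|
      ≤ ∫ g, |Carnot.meanCurvature Ω g| *
          Carnot.horizontalGradNormSq (fun i => (X i : 𝔤)) Ω u g
          ∂(Carnot.perimeterMeasure Ω) := by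
  obtain ⟨hu, h1⟩ := hu_Gamma
  choose a ha' hda using h1
  have ha : ∀ i, ContinuousOn (a i) (closure Ω) := fun i => (ha' i).1
  -- The order of indices matters: `A i j` represents `X_j X_i u`, and below `B i j k` represents
  -- `X_k X_j X_i u`.
  choose A hA' hdA using fun i => (ha' i).2
  have hA : ∀ i j, ContinuousOn (A i j) (closure Ω) := fun i j => (hA' i j).1
  choose B hB' hdB using fun i j => (hA' i j).2
  have hB : ∀ i j k, ContinuousOn (B i j k) (closure Ω) := hB'
  have hXX : ∀ i j, ∀ g ∈ Ω, lieDeriv (X j : 𝔤) (lieDeriv (X i : 𝔤) u) g = A i j g :=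
    fun i j g hg => lieDeriv_lieDeriv_eq hΩ.isOpen hg (hda i) (hdA i j g hg)
  have hLap : ∀ g ∈ Ω, horizontalLaplacian (fun i => (X i : 𝔤)) u g ^ 2
      = (∑ i, A i i g) ^ 2 := fun g hg => by
    rw [horizontalLaplacian, Finset.sum_congr rfl fun i _ => hXX i i g hg]
  have hHess : ∀ g ∈ Ω, symHessianNormSq (fun i => (X i : 𝔤)) u g
      = ∑ i, ∑ j, ((A j i g + A i j g) / 2) ^ 2 := fun g hg =>
    Finset.sum_congr rfl fun i _ => Finset.sum_congr rfl fun j _ => by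
      rw [symHessian, hXX _ _ g hg, hXX _ _ g hg]
  have hComm : ∀ i j, ∀ g ∈ Ω, Carnot.commutator (X i : 𝔤) (X j : 𝔤) u g ^ 2
      = (A j i g - A i j g) ^ 2 := fun i j g hg => by
    rw [Carnot.commutator, hXX _ _ g hg, hXX _ _ g hg]
  have iLap := hΩ.integrableOn_haar ((continuousOn_finsetSum _ fun i _ => hA i i).pow 2) hLap
  have iHess := hΩ.integrableOn_haar (continuousOn_finsetSum _ fun i _ =>
    continuousOn_finsetSum _ fun j _ => (((hA j i).add (hA i j)).div_const 2).pow 2) hHess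
  have iComm := fun i j => hΩ.integrableOn_haar (((hA j i).sub (hA i j)).pow 2) (hComm i j)
  have hbd : ∀ g ∈ frontier Ω, angle Ω g * (|meanCurvature Ω g| *
      horizontalGradNormSq (fun i => (X i : 𝔤)) Ω u g)
      = |∑ i, flux a A i g * inner ℝ (outerNormal Ω g) (X i : 𝔤)| := fun g hg => by
    rw [horizontalGradNormSq_eq ha hda (frontier_subset_closure hg)]
    exact angle_mul_meanCurvature_eq_abs_flux X hΩ hu_C2 hu_zero ha hA hda hdA hg
  -- The pointwise identity is known only on the boundary, which carries the surface measure.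
  have hbd_ae : (fun g => |∑ i, flux a A i g * inner ℝ (outerNormal Ω g) (X i : 𝔤)|)
      =ᵐ[surfaceMeasure (frontier Ω)] fun g => angle Ω g * (|meanCurvature Ω g| *
        horizontalGradNormSq (fun i => (X i : 𝔤)) Ω u g) := by
    rw [← surfaceMeasure_restrict isClosed_frontier.measurableSet]
    filter_upwards [ae_restrict_mem isClosed_frontier.measurableSet] with g hg
    exact (hbd g hg).symm
  have iFlux : Integrable (fun g => ∑ i, flux a A i g * inner ℝ (outerNormal Ω g) (X i : 𝔤))
      (surfaceMeasure (frontier Ω)) := hΩ.integrable_surfaceMeasure <|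
    continuousOn_finsetSum _ fun i _ =>
      ((continuousOn_flux ha hA i).mono frontier_subset_closure).mul
        (hΩ.continuousOn_outerNormal.inner continuousOn_const)
  -- Integrability of the curvature term, including its measurability, is inherited from the flux
  -- density, which is continuous on the compact boundary.
  refine ⟨iLap, iHess, iComm, hΩ.integrable_perimeterMeasure_iff.2 (iFlux.abs.congr hbd_ae), ?_⟩
  have hcomb : (∫ g in Ω, horizontalLaplacian (fun i => (X i : 𝔤)) u g ^ 2 ∂(haar S))
        - (∫ g in Ω, symHessianNormSq (fun i => (X i : 𝔤)) u g ∂(haar S))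
        + (3 / 4 : ℝ) * ∑ i, ∑ j, ∫ g in Ω, Carnot.commutator (X i : 𝔤) (X j : 𝔤) u g ^ 2 ∂(haar S)
      = ∫ g in Ω, ((∑ i, A i i g) ^ 2 - ∑ i, ∑ j, (2 * A j i g * A i j g - A j i g ^ 2))
          ∂(haar S) := by
    have hsum : ∑ i, ∑ j, ∫ g in Ω, Carnot.commutator (X i : 𝔤) (X j : 𝔤) u g ^ 2 ∂(haar S)
        = ∫ g in Ω, ∑ i, ∑ j, Carnot.commutator (X i : 𝔤) (X j : 𝔤) u g ^ 2 ∂(haar S) := by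
      rw [integral_finsetSum _ fun i _ => integrable_finsetSum _ fun j _ => iComm i j]
      exact Finset.sum_congr rfl fun i _ => (integral_finsetSum _ fun j _ => iComm i j).symm
    have iSum : IntegrableOn (fun g => ∑ i, ∑ j, Carnot.commutator (X i : 𝔤) (X j : 𝔤) u g ^ 2) Ω
        (haar S) :=
      integrable_finsetSum _ fun i _ => integrable_finsetSum _ fun j _ => iComm i j
    rw [hsum, ← integral_sub iLap iHess, ← integral_const_mul,
      ← integral_add (by exact iLap.sub iHess) (iSum.const_mul _)]
    refine setIntegral_congr_fun hΩ.isOpen.measurableSet fun g hg => ?_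
    have hsym := sum_symmetrized_eq fun i j => A i j g
    simp only [hLap g hg, hHess g hg,
      Finset.sum_congr rfl fun i _ => Finset.sum_congr rfl fun j _ => hComm i j g hg]
    linear_combination hsym
  rw [hcomb, integral_bochner_eq X hΩ hu ha hA hB hda hdA hdB, hΩ.integral_perimeterMeasure,
    ← integral_congr_ae hbd_ae]
  -- The only inequality of the argument.
  exact abs_integral_le_integral_abs
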